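/- **Model.** Let $U,V\ge 0$ be random variables with $\mathbb E[U]=\mathbb E[V]=1$, let $\mathcal B=[\underline\mu,\bar\mu]\times[\underline p,\bar p]$, let $\lambda>0$ be the demand rate on $[\underline p,\bar p]$, $c$ the staffing cost rate on $[\underline\mu,\bar\mu]$, and $h_0>0$ the holding cost per customer and unit of time. For a fixed decision $(\mu,p)\in\mathcal B$, a $GI/GI/1$ queue (single server, first in first out) has i.i.d. interarrival times distributed as $U/\lambda(p)$ and independent i.i.d. service times distributed as $V/\mu$; $\mathbb E[Q_\infty(\mu,p)]$ is its steady-state (long-run time average) mean number of customers in the system, and $$f(\mu,p)=h_0\,\mathbb E[Q_\infty(\mu,p)]+c(\mu)-p\,\lambda(p).$$ *Assumption 1.* $\lambda$ is continuously differentiable and non-increasing on $[\underline p,\bar p]$, $c$ is continuously differentiable and non-decreasing on $[\underline\mu,\bar\mu]$, and $\lambda(\underline p)<\underline\mu$. *Assumption 2.* There are $\eta>0$ with $\mathbb E[e^{\eta U}],\mathbb E[e^{\eta V}]<\infty$, and $0<\theta<\eta/2$, $0<a<\frac{\underline\mu-\lambda(\underline p)}{\underline\mu+\lambda(\underline p)}$,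 $\gamma_0>0$ with $\log\mathbb E[e^{-\theta U}]<-(1-a)\theta-\gamma_0$ and $\log\mathbb E[e^{\theta V}]<(1+a)\theta-\gamma_0$. Put $\gamma=\gamma_0\min\left(1/\bar\mu,\,1/\lambda(\underline p)\right)$. **Controlled queue.** Cycle $k\ge1$ is operated under a random decision $x_k=(\mu_k,p_k)\in\mathcal B$; $p_0\in[\underline p,\bar p]$ is the price before the first cycle, and $\lambda_k=\lambda(p_k)$. Cycle $k$ starts when its customer $0$ (the last customer of the previous cycle) enters service and ends when its customer $D_k$ enters service, where the $D_k\in\mathbb N$ are deterministic. Let $(U_n^k,V_n^k)_{n\ge1}$ be the inputs of cycle $k$: i.i.d. pairs of independent copies of $U$ and $V$, independent of the history $\mathcal F_k$ up to the start of cycle $k$, where $(\mathcal F_k)$ is a filtration such that $x_k$, the inputs of index $n\le D_j$ of the cycles $j<k$, the initial waiting time $W_0^1\ge0$ and $p_0$ are $\mathcal F_k$-measurable. Let $Q_k$ be the number of customers in the system at the start of cycle $k$ (just after customer $0$ enters service, customer $0$ included, the customers after customer $0$ having arrived at rate $\lambda_{k-1}$), i.e. $$Q_k=\#\Big\{n\ge0:\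 \sum_{j=1}^{n}U_j^k/\lambda_{k-1}\le W_0^k\Big\}.$$ For $1\le n\le D_k$ customer $n$ pays the fee $p_n^k=p_{k-1}$ if $n\le Q_k$ and $p_n^k=p_k$ otherwise, the time between the arrivals of customers $n-1$ and $n$ is $\tau_n^k=U_n^k/\lambda(p_n^k)$, and $$W_n^k=\Big(W_{n-1}^k+\frac{V_n^k}{\mu_k}-\tau_n^k\Big)^+,\qquad W_0^{k+1}=W_{D_k}^k .$$ The service times are $S_n^k=V_{n+1}^k/\mu_k$ for $n<D_k$ and $S_{D_k}^k=V_1^{k+1}/\mu_{k+1}$, and the length of the cycle is $T_k=\sum_{n=1}^{D_k}\tau_n^k+W_{D_k}^k-W_0^k$. The regrets of nonstationarity are $$R_{1,k}=\mathbb E\Big[\sum_{n=1}^{D_k}\big(h_0(W_n^k+S_n^k)-p_n^k\big)+c(\mu_k)T_k\Big]-\mathbb E\big[f(\mu_k,p_k)\,T_k\big],\qquad R_1(L)=\sum_{k=1}^{L}R_{1,k}.$$ **Theorem (regret of nonstationarity).** Suppose that Assumptions 1 and 2 hold, that $\mathbb E[e^{\varepsilon W_0^1}]\le M_0$ for some $\varepsilon>0$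 and $M_0$ (for instance $W_0^1=0$), and that (a) $D_k\ge 2\log(k)/\gamma$ for all $k\ge1$; (b) $\mathbb E\big[\|x_k-x_{k+1}\|^2\big]\le K_2k^{-2\alpha}$ for all $k\ge1$, with constants $K_2>0$ and $0<\alpha\le1$. Then the expectations in $R_{1,k}$ exist, and there is a constant $K>0$ such that $$R_{1,k}\le K\,k^{-\alpha}\quad(k\ge1)\qquad\text{and}\qquad R_1(L)\le K\sum_{k=1}^{L}k^{-\alpha}\quad(L\ge1).$$ The constant $K$ depends only on the model ($\lambda$, $c$, $h_0$, $\mathcal B$, the laws of $U$ and $V$, and the constants of Assumption 2) and on $K_2,\alpha,\varepsilon,M_0$, not on the decisions or the cycle lengths. -/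

import Mathlib

open MeasureTheory ProbabilityTheory Filter
open scoped ENNReal

namespace GIGIOne

/-! ### The model -/

/-- Primitives of the pricing and capacity sizing problem for a single-server queue:
the laws of the unscaled interarrival times and service times, the demand rate,
the staffing cost, the holding cost rate, and the box of feasible decisions. -/
structure Model where
  /-- law of the unscaled interarrival times `U` -/
  lawU : Measure ℝ
  /-- law of the unscaled service times `V` -/
  lawV : Measure ℝ
  /-- demand rate as a function of the price -/
  lam : ℝ → ℝ
  /-- staffing cost rate as a function of the service rate -/
  cost : ℝ → ℝ
  /-- holding cost per customer and unit of time -/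
  h0 : ℝ
  muLo : ℝ
  muHi : ℝ
  pLo : ℝ
  pHi : ℝ

/-- The conventions of the model: `U` and `V` are nonnegative with unit mean, the holding cost is
positive, the feasible box is a product of two intervals, and demand rates are positive. -/
structure Model.Standing (M : Model) : Prop where
  probU : IsProbabilityMeasure M.lawU
  probV : IsProbabilityMeasure M.lawV
  nonnegU : ∀ᵐ u ∂M.lawU, 0 ≤ u
  nonnegV : ∀ᵐ v ∂M.lawV, 0 ≤ v
  meanU : ∫ u, u ∂M.lawU = 1
  meanV : ∫ v, v ∂M.lawV = 1
  h0_pos : 0 < M.h0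
  mu_le : M.muLo ≤ M.muHi
  p_le : M.pLo ≤ M.pHi
  lam_pos : ∀ p ∈ Set.Icc M.pLo M.pHi, 0 < M.lam p

/-- Demand rate, staffing cost, and uniform stability. -/
structure Model.Stable (M : Model) : Prop where
  lam_contDiff : ContDiffOn ℝ 1 M.lam (Set.Icc M.pLo M.pHi)
  lam_anti : AntitoneOn M.lam (Set.Icc M.pLo M.pHi)
  cost_contDiff : ContDiffOn ℝ 1 M.cost (Set.Icc M.muLo M.muHi)
  cost_mono : MonotoneOn M.cost (Set.Icc M.muLo M.muHi)
  stable : M.lam M.pLo < M.muLo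

/-- Light-tailed service and interarrival times, with the constants `η, θ, a, γ₀`. -/
structure Model.LightTail (M : Model) (η θ a γ₀ : ℝ) : Prop where
  eta_pos : 0 < η
  expU : Integrable (fun u => Real.exp (η * u)) M.lawU
  expV : Integrable (fun v => Real.exp (η * v)) M.lawV
  theta_pos : 0 < θ
  theta_lt : θ < η / 2
  a_pos : 0 < a
  a_lt : a < (M.muLo - M.lam M.pLo) / (M.muLo + M.lam M.pLo)
  gamma_pos : 0 < γ₀
  cgfU : cgf id M.lawU (-θ) < -(1 - a) * θ - γ₀
  cgfV : cgf id M.lawV θ < (1 + a) * θ - γ₀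

/-- The rate `γ = γ₀ min(1/μ̄, 1/λ(p̲))`. -/
noncomputable def Model.rate (M : Model) (γ₀ : ℝ) : ℝ :=
  γ₀ * min (1 / M.muHi) (1 / M.lam M.pLo)

/-! ### The queue under a fixed decision and the steady-state cost

An input path `z : ℕ → ℝ × ℝ` lists `z n = (U (n+1), V (n+1))`.  Customer `0` arrives at time `0`
to an empty system, customer `n` has service time `V (n+1) / μ`, and the time between the
arrivals of customers `n` and `n + 1` is `U (n+1) / l`, with `l` the arrival rate. -/

/-- Waiting time of customer `n` (Lindley recursion). -/
noncomputable def wait (mu l : ℝ) (z : ℕ → ℝ × ℝ) : ℕ → ℝ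
  | 0 => 0
  | n + 1 => max (wait mu l z n + (z n).2 / mu - (z n).1 / l) 0

/-- Arrival time of customer `n`. -/
noncomputable def arrival (l : ℝ) (z : ℕ → ℝ × ℝ) (n : ℕ) : ℝ :=
  ∑ j ∈ Finset.range n, (z j).1 / l

/-- Departure time of customer `n`. -/
noncomputable def departure (mu l : ℝ) (z : ℕ → ℝ × ℝ) (n : ℕ) : ℝ :=
  arrival l z n + wait mu l z n + (z n).2 / mu

/-- Number of customers in the system (waiting or in service) at time `s`. -/
noncomputable def queueLength (mu l : ℝ) (z : ℕ → ℝ × ℝ) (s : ℝ) : ℝ≥0∞ :=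
  ∑' n : ℕ, (Set.Ico (arrival l z n) (departure mu l z n)).indicator 1 s

/-- Law of the input path: i.i.d. pairs with independent components. -/
noncomputable def Model.inputLaw (M : Model) : Measure (ℕ → ℝ × ℝ) :=
  Measure.infinitePi fun _ : ℕ => M.lawU.prod M.lawV

/-- The mean steady-state queue length `E[Q_∞(μ, p)]` in continuous time, as the long-run time
average `lim_{T → ∞} T⁻¹ ∫_0^T E[Q(s)] ds` (in a stable queue the limit exists). -/
noncomputable def Model.meanQueue (M : Model) (mu p : ℝ) : ℝ :=
  (limsup (fun T : ℝ =>
    (∫⁻ s in Set.Ioc 0 T, ∫⁻ z, queueLength mu (M.lam p) z s ∂M.inputLaw) / ENNReal.ofReal T)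
    atTop).toReal

/-- The steady-state cost rate `f(μ, p) = h₀ E[Q_∞(μ, p)] + c(μ) - p λ(p)`. -/
noncomputable def Model.f (M : Model) (mu p : ℝ) : ℝ :=
  M.h0 * M.meanQueue mu p + M.cost mu - p * M.lam p

/-! ### The queue under a sequence of decisions -/

/-- Number of customers in the system just after customer `0` of a cycle enters service, customer
`0` (now in service) included: the customers `n ≥ 0` that arrive within the waiting time `w` of
customer `0`, when they arrive with rate `l`. -/
noncomputable def leftover (l w : ℝ) (u : ℕ → ℝ) : ℕ∞ :=
  Set.encard {n : ℕ | ∑ j ∈ Finset.range n, u j / l ≤ w}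

/-- Waiting times in a cycle, with initial waiting time `w`, service rate `mu`, arrival rate
`lPrev` for the first `Q` customers (`Q` the number of leftover customers) and `lCur` for the later
ones.  Here `u n`, `v n` stand for the variables of index `n + 1`. -/
noncomputable def cycleWait (lPrev lCur mu w : ℝ) (u v : ℕ → ℝ) : ℕ → ℝ
  | 0 => w
  | n + 1 => open Classical in
    max (cycleWait lPrev lCur mu w u v n + v n / mu
      - u n / (if ((n + 1 : ℕ) : ℕ∞) ≤ leftover lPrev w u then lPrev else lCur)) 0

/-- The random data of an online algorithm that operates the queue: cycle lengths `D k`, unscaled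
interarrival and service times (`U k n`, `V k n` are the variables of cycle `k` with index `n + 1`),
decisions `(mu k, p k)` in cycle `k ≥ 1`, with `p 0` the price before the first cycle,
and the waiting time `W0` of customer `0` of the first cycle. -/
structure Controlled (Ω : Type*) where
  D : ℕ → ℕ
  U : ℕ → ℕ → Ω → ℝ
  V : ℕ → ℕ → Ω → ℝ
  mu : ℕ → Ω → ℝ
  p : ℕ → Ω → ℝ
  W0 : Ω → ℝ

namespace Controlled

variable {Ω : Type*}

/-- The standing requirements: the inputs of each cycle are i.i.d. with the laws of the model and
independent of the history `ℱ k` up to the start of cycle `k`; the history contains the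
inputs consumed in the earlier cycles; the decisions are feasible, and the decision for cycle
`k` is made from the history `ℱ k` (which may contain additional randomization). -/
structure IsAdmissible [mΩ : MeasurableSpace Ω] (S : Controlled Ω) (M : Model) (P : Measure Ω)
    (ℱ : Filtration ℕ mΩ) : Prop where
  measU : ∀ k, 1 ≤ k → ∀ n, Measurable (S.U k n)
  measV : ∀ k, 1 ≤ k → ∀ n, Measurable (S.V k n)
  law : ∀ k, 1 ≤ k → ∀ n, P.map (fun ω => (S.U k n ω, S.V k n ω)) = M.lawU.prod M.lawV
  indep : ∀ k, 1 ≤ k → iIndepFun (fun n ω => (S.U k n ω, S.V k n ω)) P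
  indep_past : ∀ k, 1 ≤ k →
    Indep (MeasurableSpace.comap (fun ω n => (S.U k n ω, S.V k n ω)) inferInstance) (ℱ k) P
  histU : ∀ k, 1 ≤ k → ∀ n < S.D k, Measurable[ℱ (k + 1)] (S.U k n)
  histV : ∀ k, 1 ≤ k → ∀ n < S.D k, Measurable[ℱ (k + 1)] (S.V k n)
  hist_mu : ∀ k, 1 ≤ k → Measurable[ℱ k] (S.mu k)
  hist_p : ∀ k, 1 ≤ k → Measurable[ℱ k] (S.p k)
  hist_p0 : Measurable[ℱ 1] (S.p 0)
  hist_W0 : Measurable[ℱ 1] S.W0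
  W0_nonneg : ∀ ω, 0 ≤ S.W0 ω
  mu_mem : ∀ k, 1 ≤ k → ∀ ω, S.mu k ω ∈ Set.Icc M.muLo M.muHi
  p_mem : ∀ k ω, S.p k ω ∈ Set.Icc M.pLo M.pHi

variable (S : Controlled Ω) (M : Model)

/-- Waiting times in cycle `k ≥ 1` from the initial waiting time `w`, at the sample point `ω`. -/
noncomputable def waitFrom (k : ℕ) (ω : Ω) (w : ℝ) : ℕ → ℝ :=
  cycleWait (M.lam (S.p (k - 1) ω)) (M.lam (S.p k ω)) (S.mu k ω) w
    (fun n => S.U k n ω) (fun n => S.V k n ω)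

/-- `W_0^k` for `k ≥ 1`: the waiting time of the last customer that enters service in cycle
`k - 1`, respectively the initial waiting time for `k = 1` (the index `0` is not used). -/
noncomputable def startWait (ω : Ω) : ℕ → ℝ
  | 0 => S.W0 ω
  | 1 => S.W0 ω
  | k + 2 => S.waitFrom M (k + 1) ω (startWait ω (k + 1)) (S.D (k + 1))

/-- `W_n^k`. -/
noncomputable def W (k n : ℕ) (ω : Ω) : ℝ :=
  S.waitFrom M k ω (S.startWait M ω k) n

/-- `Q_k`, the number of customers in the system at the start of cycle `k`. -/
noncomputable def Q (k : ℕ) (ω : Ω) : ℕ∞ :=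
  leftover (M.lam (S.p (k - 1) ω)) (S.startWait M ω k) (fun n => S.U k n ω)

open Classical in
/-- The price in force when customer `n ≥ 1` of cycle `k` was admitted: the first `Q_k` customers
belong to the previous price. -/
noncomputable def fee (k n : ℕ) (ω : Ω) : ℝ :=
  if (n : ℕ∞) ≤ S.Q M k ω then S.p (k - 1) ω else S.p k ω

/-- The interarrival time between customers `n - 1` and `n` of cycle `k`, for `n ≥ 1`. -/
noncomputable def interarrival (k n : ℕ) (ω : Ω) : ℝ :=
  S.U k (n - 1) ω / M.lam (S.fee M k n ω)

/-- The service time of customer `n` of cycle `k`; the last customer of a cycle is served in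
the next cycle. -/
noncomputable def service (k n : ℕ) (ω : Ω) : ℝ :=
  if n < S.D k then S.V k n ω / S.mu k ω else S.V (k + 1) 0 ω / S.mu (k + 1) ω

/-- `T_k`, the length of cycle `k` in units of time: it lasts from the instant customer `0` enters
service to the instant customer `D k` enters service. -/
noncomputable def T (k : ℕ) (ω : Ω) : ℝ :=
  (∑ n ∈ Finset.Icc 1 (S.D k), S.interarrival M k n ω) + S.W M k (S.D k) ω - S.W M k 0 ω

/-- Net cost incurred in cycle `k`. -/
noncomputable def cycleCost (k : ℕ) (ω : Ω) : ℝ :=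
  (∑ n ∈ Finset.Icc 1 (S.D k),
      (M.h0 * (S.W M k n ω + S.service k n ω) - S.fee M k n ω))
    + M.cost (S.mu k ω) * S.T M k ω

/-- Cost that the steady-state cost rate under the decision of cycle `k` would incur during
cycle `k`. -/
noncomputable def steadyCost (k : ℕ) (ω : Ω) : ℝ :=
  M.f (S.mu k ω) (S.p k ω) * S.T M k ω

/-- `R_{1,k}`, the regret of nonstationarity of cycle `k`. -/
noncomputable def R1 [MeasurableSpace Ω] (P : Measure Ω) (k : ℕ) : ℝ :=
  ∫ ω, S.cycleCost M k ω ∂P - ∫ ω, S.steadyCost M k ω ∂P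

/-- `R_1(L)`, the regret of nonstationarity of the first `L` cycles. -/
noncomputable def R1Total [MeasurableSpace Ω] (P : Measure Ω) (L : ℕ) : ℝ :=
  ∑ k ∈ Finset.Icc 1 L, S.R1 M P k

end Controlled

end GIGIOne

/-! The regret of a cycle is a bias: costs are charged along the actual path, whereas `f` charges
the steady state of the current decision. Three effects produce it: the initial waiting time is not
stationary for the new decision, the leftover customers still carry the old price, and the waiting
time changes between the two ends of the cycle. Since the decision is chosen from the history, none
of these can be averaged with the decision treated as a constant. Each must be of order k^{-α}.

The engine is a weighted contraction. All recursions are dominated by the increment X = V/μ̲ -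
U/λ(p̲), and the light tails give a β > 0 with E[e^{βX}] ≤ ρ < 1. For two waiting times w, w' with
the same input, the weighted distance |w - w'| e^{β max(w,w')} vanishes once both are zero, and
otherwise it grows by at most the factor e^{βX}, plus a term for the difference of the parameters
(`lindley_dist_mul_exp_le`). Hence initial states are forgotten at rate ρ^n and parameter errors are
not amplified. A telescoping of this bound shows that the effect of the initial state is Lipschitz
in the decision with constant of order σ^n, for any σ in (ρ, 1) (`Tilted.abs_meanWait_sub_sub_le`);
the steady-state mean waiting time and the deviation from it summed over a cycle are therefore
Lipschitz, the latter uniformly in the length of the cycle (`Tilted.abs_transient_sub_le`).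

Little's law (`Model.meanQueue_eq`) turns `f` into a cost per customer divided by the mean
interarrival time, plus the staffing cost. The staffing cost cancels, and the excess cost splits
into waiting times minus their steady means, services, centred interarrival times, leftover
customers, and a rate times the change of the initial waiting time (`Controlled.cycleCost_eq`). The
interarrival part has mean zero, in the service part only the last customer counts, and the leftover
part is a price change times a geometrically decaying indicator (`IsMixed.old_moment`).

For the two remaining parts the decision of cycle k is compared with that of cycle j = k - n, for a
fixed n. A reference queue starts empty in cycle j, keeps the decision x_j, and uses the true
inputs. As x_j belongs to the history, its mean waiting times are exactly those of a fixed decision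
(`Regime.integral_mul_ref`), so after N customers it is within order ρ^N of its steady state. The
true queue stays close to it because the decisions in between differ by order k^{-α} in mean square
(`Regime.dist_ref_le`); exponential moments of order 2β make this usable with the weight. By D_i ≥ 2
log(i)/γ, the number N is at least n · 2 log(j)/γ, and n is taken so large that ρ^N ≤ 1/j. The first
n + 1 cycles use j = 1 and are absorbed by the constant. -/

namespace GIGIOne

/-! ### The Lindley step and its mean iterates -/

/-- One step of the Lindley recursion with mean service time `s`, mean interarrival time `t` and
unscaled input `y = (u, v)`. -/
noncomputable def lindley (s t w : ℝ) (y : ℝ × ℝ) : ℝ := max (w + s * y.2 - t * y.1) 0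

/-- The increment of the walk that dominates the waiting times under all decisions. -/
def dom (sHi tLo : ℝ) (y : ℝ × ℝ) : ℝ := sHi * y.2 - tLo * y.1

/-- Exponential moment bounds for the dominating increment, under the input law `ν`. -/
structure Tilted (ν : Measure (ℝ × ℝ)) (sHi tLo β ρ σ C : ℝ) : Prop where
  prob : IsProbabilityMeasure ν
  nonneg : ∀ᵐ y ∂ν, 0 ≤ y.1 ∧ 0 ≤ y.2
  intU : Integrable (fun y : ℝ × ℝ => y.1) ν
  intV : Integrable (fun y : ℝ × ℝ => y.2) ν
  meanU : ∫ y, y.1 ∂ν = 1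
  meanV : ∫ y, y.2 ∂ν = 1
  sHi_pos : 0 < sHi
  tLo_pos : 0 < tLo
  β_pos : 0 < β
  ρ_pos : 0 < ρ
  ρ_lt : ρ < σ
  σ_lt : σ < 1
  C_pos : 0 < C
  int1 : Integrable (fun y => Real.exp (β * dom sHi tLo y)) ν
  le1 : ∫ y, Real.exp (β * dom sHi tLo y) ∂ν ≤ ρ
  int2 : Integrable (fun y => Real.exp (2 * β * dom sHi tLo y)) ν
  le2 : ∫ y, Real.exp (2 * β * dom sHi tLo y) ∂ν ≤ ρ
  intC : Integrable (fun y => (y.1 + y.2) * Real.exp (β * dom sHi tLo y)) ν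
  leC : ∫ y, (y.1 + y.2) * Real.exp (β * dom sHi tLo y) ∂ν ≤ C

/-- Mean waiting time after `n` steps of the Lindley recursion started from `w`. -/
noncomputable def meanWait (ν : Measure (ℝ × ℝ)) : ℕ → ℝ → ℝ → ℝ → ℝ
  | 0, _, _, w => w
  | n + 1, s, t, w => ∫ y, meanWait ν n s t (lindley s t w y) ∂ν

lemma lindley_nonneg (s t w : ℝ) (y : ℝ × ℝ) : 0 ≤ lindley s t w y := le_max_right _ _

lemma measurable_lindley :
    Measurable fun x : (ℝ × ℝ × ℝ) × ℝ × ℝ => lindley x.1.1 x.1.2.1 x.1.2.2 x.2 := by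
  unfold lindley; fun_prop

lemma measurable_dom (sHi tLo : ℝ) : Measurable (dom sHi tLo) := by
  unfold dom; fun_prop

/-- A positive value has not been truncated, so it is a step of the free walk and the extreme
parameters dominate it. At value zero the bound may fail, because `w + dom` can be negative; every
use therefore splits on positivity. -/
lemma lindley_le {s t w sHi tLo : ℝ} {y : ℝ × ℝ} (hy : 0 ≤ y.1 ∧ 0 ≤ y.2) (hs : s ≤ sHi)
    (ht : tLo ≤ t) (h : 0 < lindley s t w y) : lindley s t w y ≤ w + dom sHi tLo y := by
  have h1 := mul_le_mul_of_nonneg_right hs hy.2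
  have h2 := mul_le_mul_of_nonneg_right ht hy.1
  have h3 : lindley s t w y = w + s * y.2 - t * y.1 := by
    unfold lindley at *
    rcases le_total (w + s * y.2 - t * y.1) 0 with h | h
    · simp [max_eq_right h] at *
    · exact max_eq_left h
  rw [h3]; unfold dom; linarith

lemma abs_lindley_sub_le {s t w s' t' w' : ℝ} {y : ℝ × ℝ} (hy : 0 ≤ y.1 ∧ 0 ≤ y.2) :
    |lindley s t w y - lindley s' t' w' y|
      ≤ |w - w'| + (|s - s'| + |t - t'|) * (y.1 + y.2) := by
  unfold lindley
  have h1 := abs_max_sub_max_le_abs (w + s * y.2 - t * y.1) (w' + s' * y.2 - t' * y.1) 0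
  refine h1.trans ?_
  have e : w + s * y.2 - t * y.1 - (w' + s' * y.2 - t' * y.1)
      = (w - w') + (s - s') * y.2 - (t - t') * y.1 := by ring
  rw [e]
  have h2 := abs_sub ((w - w') + (s - s') * y.2) ((t - t') * y.1)
  have h3 := abs_add_le (w - w') ((s - s') * y.2)
  rw [abs_mul, abs_of_nonneg hy.2] at h3
  rw [abs_mul, abs_of_nonneg hy.1] at h2
  have := abs_nonneg (s - s')
  have := abs_nonneg (t - t')
  nlinarith [mul_nonneg (abs_nonneg (s - s')) hy.1, mul_nonneg (abs_nonneg (t - t')) hy.2]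

lemma lindley_mono_left {s t w w' : ℝ} (h : w ≤ w') (y : ℝ × ℝ) :
    lindley s t w y ≤ lindley s t w' y := by
  unfold lindley; exact max_le_max (by linarith) le_rfl

/-- The weighted distance of two Lindley steps: it vanishes as soon as both have reached zero. -/
lemma lindley_dist_mul_exp_le {s t w s' t' w' sHi tLo β m : ℝ} {y : ℝ × ℝ}
    (hy : 0 ≤ y.1 ∧ 0 ≤ y.2) (hβ : 0 ≤ β) (hs : s ≤ sHi) (hs' : s' ≤ sHi) (ht : tLo ≤ t)
    (ht' : tLo ≤ t') (hw : w ≤ m) (hw' : w' ≤ m) :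
    |lindley s t w y - lindley s' t' w' y|
        * Real.exp (β * max (lindley s t w y) (lindley s' t' w' y))
      ≤ (|w - w'| + (|s - s'| + |t - t'|) * (y.1 + y.2))
        * (Real.exp (β * m) * Real.exp (β * dom sHi tLo y)) := by
  have hB : 0 ≤ |w - w'| + (|s - s'| + |t - t'|) * (y.1 + y.2) := by
    have := hy.1; have := hy.2; positivity
  -- If the larger of the two values is zero, both are, and the distance vanishes whatever the
  -- weight. Otherwise the larger value is positive and `lindley_le` bounds the weight.
  rcases (le_max_of_le_left (lindley_nonneg s t w y) :
    0 ≤ max (lindley s t w y) (lindley s' t' w' y)).eq_or_lt with h | h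
  · have a1 := lindley_nonneg s t w y
    have a2 := lindley_nonneg s' t' w' y
    have b1 := le_max_left (lindley s t w y) (lindley s' t' w' y)
    have b2 := le_max_right (lindley s t w y) (lindley s' t' w' y)
    have e1 : lindley s t w y = 0 := by linarith
    have e2 : lindley s' t' w' y = 0 := by linarith
    rw [e1, e2]; simp; positivity
  · rw [← Real.exp_add]
    refine mul_le_mul (abs_lindley_sub_le hy) (Real.exp_le_exp.2 ?_) (Real.exp_nonneg _) hB
    rw [← mul_add]
    refine mul_le_mul_of_nonneg_left ?_ hβ
    rcases max_choice (lindley s t w y) (lindley s' t' w' y) with h1 | h1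
    · rw [h1] at h ⊢
      linarith [lindley_le hy hs ht h]
    · rw [h1] at h ⊢
      linarith [lindley_le hy hs' ht' h]

section

variable {ν : Measure (ℝ × ℝ)} {sHi tLo β ρ σ C : ℝ}

lemma measurable_meanWait [SFinite ν] (n : ℕ) :
    Measurable fun x : ℝ × ℝ × ℝ => meanWait ν n x.1 x.2.1 x.2.2 := by
  induction n with
  | zero => exact measurable_snd.snd
  | succ n ih =>
    have h : StronglyMeasurable (Function.uncurry fun (x : ℝ × ℝ × ℝ) (y : ℝ × ℝ) =>
        meanWait ν n x.1 x.2.1 (lindley x.1 x.2.1 x.2.2 y)) := by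
      refine Measurable.stronglyMeasurable ?_
      have h2 : Measurable fun z : (ℝ × ℝ × ℝ) × ℝ × ℝ =>
          ((z.1.1, z.1.2.1, lindley z.1.1 z.1.2.1 z.1.2.2 z.2) : ℝ × ℝ × ℝ) :=
        (measurable_fst.fst).prodMk ((measurable_fst.snd.fst).prodMk measurable_lindley)
      exact ih.comp h2
    exact h.integral_prod_right.measurable

lemma measurable_meanWait_lindley [SFinite ν] (n : ℕ) (s t w : ℝ) :
    Measurable fun y => meanWait ν n s t (lindley s t w y) := by
  have h : Measurable fun y : ℝ × ℝ => ((s, t, lindley s t w y) : ℝ × ℝ × ℝ) := by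
    unfold lindley; fun_prop
  exact (measurable_meanWait n).comp h

/-- Admissible pairs of mean service and interarrival times. -/
def InBox (sHi tLo s t : ℝ) : Prop := 0 ≤ s ∧ s ≤ sHi ∧ tLo ≤ t

lemma Tilted.lindley_le_add (H : Tilted ν sHi tLo β ρ σ C) {s t w : ℝ} {y : ℝ × ℝ}
    (hy : 0 ≤ y.1 ∧ 0 ≤ y.2) (hx : InBox sHi tLo s t) (hw : 0 ≤ w) :
    lindley s t w y ≤ w + sHi * y.2 := by
  have h1 := mul_le_mul_of_nonneg_right hx.2.1 hy.2
  have h2 := mul_nonneg (H.tLo_pos.le.trans hx.2.2) hy.1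
  have h3 := mul_nonneg H.sHi_pos.le hy.2
  exact max_le (by linarith) (by linarith)

/-- A crude bound that ignores arrivals altogether and grows with `n`. It serves only for
integrability. -/
lemma Tilted.abs_meanWait_le (H : Tilted ν sHi tLo β ρ σ C) (n : ℕ) {s t w : ℝ}
    (hx : InBox sHi tLo s t) (hw : 0 ≤ w) : |meanWait ν n s t w| ≤ w + n * sHi := by
  have := H.prob
  induction n generalizing w with
  | zero => simp [meanWait, abs_of_nonneg hw]
  | succ n ih =>
    have hi : Integrable (fun y : ℝ × ℝ => w + sHi * y.2 + n * sHi) ν :=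
      (((integrable_const w).add (H.intV.const_mul sHi)).add (integrable_const _))
    have h1 : |∫ y, meanWait ν n s t (lindley s t w y) ∂ν|
        ≤ ∫ y, (w + sHi * y.2 + n * sHi) ∂ν := by
      rw [← Real.norm_eq_abs]
      refine norm_integral_le_of_norm_le hi ?_
      filter_upwards [H.nonneg] with y hy
      rw [Real.norm_eq_abs]
      linarith [ih (lindley_nonneg s t w y), H.lindley_le_add hy hx hw]
    have h2 : ∫ y : ℝ × ℝ, (w + sHi * y.2 + n * sHi) ∂ν = w + (n + 1 : ℕ) * sHi := by
      have hi1 : Integrable (fun y : ℝ × ℝ => w + sHi * y.2) ν :=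
        (integrable_const w).add (H.intV.const_mul sHi)
      rw [integral_add hi1 (integrable_const _),
        integral_add (integrable_const w) (H.intV.const_mul sHi), integral_const_mul, H.meanV]
      simp; ring
    exact h1.trans_eq h2

lemma Tilted.integrable_meanWait_lindley (H : Tilted ν sHi tLo β ρ σ C) (n : ℕ) {s t w : ℝ}
    (hx : InBox sHi tLo s t) (hw : 0 ≤ w) :
    Integrable (fun y => meanWait ν n s t (lindley s t w y)) ν := by
  have := H.prob
  have hi : Integrable (fun y : ℝ × ℝ => w + sHi * y.2 + n * sHi) ν :=
    (((integrable_const w).add (H.intV.const_mul sHi)).add (integrable_const _))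
  refine hi.mono' (measurable_meanWait_lindley n s t w).aestronglyMeasurable ?_
  filter_upwards [H.nonneg] with y hy
  rw [Real.norm_eq_abs]
  linarith [H.abs_meanWait_le n hx (lindley_nonneg s t w y), H.lindley_le_add hy hx hw]

/-- Contraction of the mean waiting times in the initial state. -/
lemma Tilted.abs_meanWait_sub_le (H : Tilted ν sHi tLo β ρ σ C) (n : ℕ) {s t w w' : ℝ}
    (hx : InBox sHi tLo s t) (hw : 0 ≤ w) (hw' : 0 ≤ w') :
    |meanWait ν n s t w - meanWait ν n s t w'|
      ≤ |w - w'| * Real.exp (β * max w w') * ρ ^ n := by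
  have := H.prob
  induction n generalizing w w' with
  | zero =>
    simp only [meanWait, pow_zero, mul_one]
    have h1 : 1 ≤ Real.exp (β * max w w') :=
      Real.one_le_exp (mul_nonneg H.β_pos.le (le_max_of_le_left hw))
    nlinarith [abs_nonneg (w - w')]
  | succ n ih =>
    simp only [meanWait]
    rw [← integral_sub (H.integrable_meanWait_lindley n hx hw)
      (H.integrable_meanWait_lindley n hx hw'), ← Real.norm_eq_abs]
    have h1 := norm_integral_le_of_norm_le
      (f := fun y => meanWait ν n s t (lindley s t w y) - meanWait ν n s t (lindley s t w' y))
      (H.int1.const_mul (|w - w'| * Real.exp (β * max w w') * ρ ^ n)) (by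
        filter_upwards [H.nonneg] with y hy
        rw [Real.norm_eq_abs]
        refine (ih (lindley_nonneg s t w y) (lindley_nonneg s t w' y)).trans ?_
        -- With equal parameters the weighted distance is multiplied by at most `exp (β * dom)`,
        -- whose mean is at most `ρ`; the weight in the induction hypothesis is exactly the one
        -- reproduced by the step.
        have h2 := lindley_dist_mul_exp_le (s := s) (t := t) (s' := s) (t' := t) hy H.β_pos.le
          hx.2.1 hx.2.1 hx.2.2 hx.2.2 (le_max_left w w') (le_max_right w w')
        have h3 := mul_le_mul_of_nonneg_right h2 (pow_nonneg H.ρ_pos.le n)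
        refine h3.trans_eq ?_
        simp; ring)
    refine h1.trans ?_
    rw [integral_const_mul, pow_succ, ← mul_assoc]
    refine mul_le_mul_of_nonneg_left H.le1 ?_
    have := H.ρ_pos
    positivity

/-- Sensitivity constant. -/
noncomputable def sens (ρ σ C : ℝ) : ℝ := 2 * C / (σ - ρ)

lemma Tilted.sens_pos (H : Tilted ν sHi tLo β ρ σ C) : 0 < sens ρ σ C :=
  div_pos (mul_pos two_pos H.C_pos) (sub_pos.2 H.ρ_lt)

/-- The relation sens · σ = 2C + sens · ρ closes the inductions below: each step adds a fresh error
with factor C and contracts the old one by ρ. The gap between ρ and σ absorbs the factor n of the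
accumulated n ρ^n. -/
lemma Tilted.sens_mul (H : Tilted ν sHi tLo β ρ σ C) :
    sens ρ σ C * (σ - ρ) = 2 * C :=
  div_mul_cancel₀ _ (sub_pos.2 H.ρ_lt).ne'

lemma Tilted.σ_pos (H : Tilted ν sHi tLo β ρ σ C) : 0 < σ := H.ρ_pos.trans H.ρ_lt

lemma Tilted.pow_le (H : Tilted ν sHi tLo β ρ σ C) (n : ℕ) : ρ ^ n ≤ σ ^ n :=
  pow_le_pow_left₀ H.ρ_pos.le H.ρ_lt.le n

/-- The effect of the initial state depends on the decision in a Lipschitz way, and the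
Lipschitz constant decays geometrically. -/
lemma Tilted.abs_meanWait_sub_sub_le (H : Tilted ν sHi tLo β ρ σ C) (n : ℕ)
    {s t s' t' w w' : ℝ} (hx : InBox sHi tLo s t) (hx' : InBox sHi tLo s' t')
    (hw : 0 ≤ w) (hww : w ≤ w') :
    |(meanWait ν n s t w' - meanWait ν n s t w)
        - (meanWait ν n s' t' w' - meanWait ν n s' t' w)|
      ≤ sens ρ σ C * (|s - s'| + |t - t'|) * Real.exp (β * w') * σ ^ n := by
  have := H.prob
  set Δ := |s - s'| + |t - t'| with hΔ
  have hΔ0 : 0 ≤ Δ := by positivity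
  have hA := H.sens_pos
  have hσ := H.σ_pos
  induction n generalizing w w' with
  | zero => simp only [meanWait, sub_self, abs_zero]; positivity
  | succ n ih =>
    have hw' : 0 ≤ w' := hw.trans hww
    simp only [meanWait]
    have j1 : Integrable (fun y => meanWait ν n s t (lindley s t w' y)
        - meanWait ν n s t (lindley s t w y)) ν :=
      (H.integrable_meanWait_lindley n hx hw').sub (H.integrable_meanWait_lindley n hx hw)
    have j2 : Integrable (fun y => meanWait ν n s' t' (lindley s' t' w' y)
        - meanWait ν n s' t' (lindley s' t' w y)) ν :=
      (H.integrable_meanWait_lindley n hx' hw').sub (H.integrable_meanWait_lindley n hx' hw)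
    rw [← integral_sub (H.integrable_meanWait_lindley n hx hw')
      (H.integrable_meanWait_lindley n hx hw), ← integral_sub
      (H.integrable_meanWait_lindley n hx' hw')
      (H.integrable_meanWait_lindley n hx' hw), ← integral_sub j1 j2, ← Real.norm_eq_abs]
    set c1 := 2 * Δ * Real.exp (β * w') * ρ ^ n with hc1
    set c2 := sens ρ σ C * Δ * Real.exp (β * w') * σ ^ n with hc2
    have h1 := norm_integral_le_of_norm_le
      (f := fun y => (meanWait ν n s t (lindley s t w' y) - meanWait ν n s t (lindley s t w y))
        - (meanWait ν n s' t' (lindley s' t' w' y) - meanWait ν n s' t' (lindley s' t' w y)))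
      ((H.intC.const_mul c1).add (H.int1.const_mul c2)) (by
        filter_upwards [H.nonneg] with y hy
        rw [Real.norm_eq_abs]
        -- The mixed difference is split after the first step. Changing the parameters in the first
        -- step only, once from `w'` and once from `w`, costs two `key` terms of order ρ^n by
        -- contraction of the remaining steps. Changing them in the remaining steps, with common
        -- states after the first one, is the induction hypothesis (`k3`).
        have key : ∀ v, 0 ≤ v → v ≤ w' →
            |meanWait ν n s t (lindley s t v y) - meanWait ν n s t (lindley s' t' v y)|
              ≤ Δ * (y.1 + y.2) * (Real.exp (β * w') * Real.exp (β * dom sHi tLo y)) * ρ ^ n := by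
          intro v hv hvw
          refine (H.abs_meanWait_sub_le n hx (lindley_nonneg s t v y)
            (lindley_nonneg s' t' v y)).trans ?_
          refine mul_le_mul_of_nonneg_right ?_ (pow_nonneg H.ρ_pos.le n)
          have := lindley_dist_mul_exp_le (s := s) (t := t) (s' := s') (t' := t') hy H.β_pos.le
            hx.2.1 hx'.2.1 hx.2.2 hx'.2.2 hvw hvw
          simpa using this
        have k1 := key w' hw' le_rfl
        have k2 := key w hw hww
        have k3 : |(meanWait ν n s t (lindley s' t' w' y) - meanWait ν n s t (lindley s' t' w y))
            - (meanWait ν n s' t' (lindley s' t' w' y) - meanWait ν n s' t' (lindley s' t' w y))|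
            ≤ c2 * Real.exp (β * dom sHi tLo y) := by
          have hmono := lindley_mono_left (s := s') (t := t') hww y
          -- By monotonicity, if the larger start has reached zero then so has the smaller one, and
          -- nothing is left to compare.
          rcases (lindley_nonneg s' t' w' y).eq_or_lt with h | h
          · have h0 : lindley s' t' w y = 0 :=
              le_antisymm (by rw [h]; exact hmono) (lindley_nonneg _ _ _ _)
            rw [← h, h0]; simp; positivity
          · refine (ih (lindley_nonneg s' t' w y) hmono).trans ?_
            have h4 : Real.exp (β * lindley s' t' w' y)
                ≤ Real.exp (β * w') * Real.exp (β * dom sHi tLo y) := by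
              rw [← Real.exp_add, ← mul_add]
              exact Real.exp_le_exp.2 (mul_le_mul_of_nonneg_left
                (lindley_le hy hx'.2.1 hx'.2.2 h) H.β_pos.le)
            calc sens ρ σ C * Δ * Real.exp (β * lindley s' t' w' y) * σ ^ n
                ≤ sens ρ σ C * Δ * (Real.exp (β * w') * Real.exp (β * dom sHi tLo y)) * σ ^ n := by
                  gcongr
              _ = c2 * Real.exp (β * dom sHi tLo y) := by rw [hc2]; ring
        simp only [Pi.add_apply]
        rw [abs_le] at k1 k2 k3 ⊢
        have e : c1 * ((y.1 + y.2) * Real.exp (β * dom sHi tLo y))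
            = 2 * (Δ * (y.1 + y.2) * (Real.exp (β * w') * Real.exp (β * dom sHi tLo y)) * ρ ^ n) :=
          by rw [hc1]; ring
        rw [e]
        constructor <;> linarith)
    have e := integral_add (H.intC.const_mul c1) (H.int1.const_mul c2)
    refine h1.trans (e.trans_le ?_)
    rw [integral_const_mul, integral_const_mul]
    have hρ := H.ρ_pos
    have hc1' : 0 ≤ c1 := by positivity
    have hc2' : 0 ≤ c2 := by positivity
    have i1 := mul_le_mul_of_nonneg_left H.leC hc1'
    have i2 := mul_le_mul_of_nonneg_left H.le1 hc2'
    have i3 : c1 * C ≤ 2 * Δ * Real.exp (β * w') * σ ^ n * C := by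
      rw [hc1]; gcongr; exact H.C_pos.le; exact H.ρ_lt.le
    have hC := H.sens_mul
    have e2 : sens ρ σ C * Δ * Real.exp (β * w') * σ ^ (n + 1)
        = 2 * Δ * Real.exp (β * w') * σ ^ n * C + c2 * ρ := by
      have : sens ρ σ C * σ = 2 * C + sens ρ σ C * ρ := by linarith
      rw [hc2, pow_succ]
      linear_combination Δ * Real.exp (β * w') * σ ^ n * this
    rw [e2]
    linarith

/-! ### The steady-state mean waiting time -/

/-- Increment of the mean waiting times started from the empty system. -/
noncomputable def waitIncr (ν : Measure (ℝ × ℝ)) (n : ℕ) (s t : ℝ) : ℝ :=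
  meanWait ν (n + 1) s t 0 - meanWait ν n s t 0

/-- The steady-state mean waiting time. -/
noncomputable def steadyWait (ν : Measure (ℝ × ℝ)) (s t : ℝ) : ℝ := ∑' n, waitIncr ν n s t

/-- Without service the empty queue stays empty. Comparing with this fictitious step lets
`lindley_dist_mul_exp_le` measure how far one true step moves away from zero. -/
lemma Tilted.lindley_zero (H : Tilted ν sHi tLo β ρ σ C) {s t : ℝ} {y : ℝ × ℝ}
    (hy : 0 ≤ y.1 ∧ 0 ≤ y.2) (hx : InBox sHi tLo s t) : lindley 0 t 0 y = 0 := by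
  have := mul_nonneg (H.tLo_pos.le.trans hx.2.2) hy.1
  unfold lindley
  exact max_eq_right (by linarith)

/-- Conditioning on the first step turns one more customer into a change of the initial state, so
contraction in the initial state makes the increments summable. -/
lemma Tilted.waitIncr_eq (H : Tilted ν sHi tLo β ρ σ C) (n : ℕ) {s t : ℝ}
    (hx : InBox sHi tLo s t) :
    waitIncr ν n s t = ∫ y, (meanWait ν n s t (lindley s t 0 y) - meanWait ν n s t 0) ∂ν := by
  have := H.prob
  rw [integral_sub (H.integrable_meanWait_lindley n hx le_rfl) (integrable_const _)]
  simp [waitIncr, meanWait]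

lemma Tilted.abs_waitIncr_le (H : Tilted ν sHi tLo β ρ σ C) (n : ℕ) {s t : ℝ}
    (hx : InBox sHi tLo s t) : |waitIncr ν n s t| ≤ sHi * C * ρ ^ n := by
  rw [H.waitIncr_eq n hx, ← Real.norm_eq_abs]
  have hρ := H.ρ_pos
  have h1 := norm_integral_le_of_norm_le
    (f := fun y => meanWait ν n s t (lindley s t 0 y) - meanWait ν n s t 0)
    (H.intC.const_mul (s * ρ ^ n)) (by
      filter_upwards [H.nonneg] with y hy
      rw [Real.norm_eq_abs]
      refine (H.abs_meanWait_sub_le n hx (lindley_nonneg s t 0 y) le_rfl).trans ?_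
      have h2 := lindley_dist_mul_exp_le (s := s) (t := t) (s' := 0) (t' := t) hy H.β_pos.le
        hx.2.1 H.sHi_pos.le hx.2.2 hx.2.2 le_rfl (le_refl (0 : ℝ))
      rw [H.lindley_zero hy hx] at h2
      have h3 := mul_le_mul_of_nonneg_right h2 (pow_nonneg H.ρ_pos.le n)
      refine h3.trans_eq ?_
      simp [abs_of_nonneg hx.1]; ring)
  refine h1.trans ?_
  rw [integral_const_mul]
  have hs := hx.1
  calc s * ρ ^ n * _ ≤ s * ρ ^ n * C := mul_le_mul_of_nonneg_left H.leC (by positivity)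
    _ ≤ sHi * ρ ^ n * C := by have := H.C_pos.le; have := hx.2.1; gcongr
    _ = _ := by ring

/-- Lipschitz constant of the increments of the mean waiting times. -/
noncomputable def sensIncr (ρ σ C : ℝ) : ℝ := C + sens ρ σ C

lemma Tilted.sensIncr_pos (H : Tilted ν sHi tLo β ρ σ C) : 0 < sensIncr ρ σ C :=
  add_pos H.C_pos H.sens_pos

/-- The parameters are changed first in the initial step (`k1`, by contraction), then in the `n`
later steps (`k3`, by the mixed-difference bound). -/
lemma Tilted.abs_waitIncr_sub_le (H : Tilted ν sHi tLo β ρ σ C) (n : ℕ) {s t s' t' : ℝ}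
    (hx : InBox sHi tLo s t) (hx' : InBox sHi tLo s' t') :
    |waitIncr ν n s t - waitIncr ν n s' t'|
      ≤ sensIncr ρ σ C * (|s - s'| + |t - t'|) * σ ^ n := by
  have := H.prob
  set Δ := |s - s'| + |t - t'| with hΔ
  have hΔ0 : 0 ≤ Δ := by positivity
  have hρ := H.ρ_pos
  have hA := H.sens_pos
  have hσ := H.σ_pos
  have j1 : Integrable (fun y => meanWait ν n s t (lindley s t 0 y) - meanWait ν n s t 0) ν :=
    (H.integrable_meanWait_lindley n hx le_rfl).sub (integrable_const _)
  have j2 : Integrable (fun y => meanWait ν n s' t' (lindley s' t' 0 y)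
      - meanWait ν n s' t' 0) ν :=
    (H.integrable_meanWait_lindley n hx' le_rfl).sub (integrable_const _)
  rw [H.waitIncr_eq n hx, H.waitIncr_eq n hx', ← integral_sub j1 j2, ← Real.norm_eq_abs]
  have h1 := norm_integral_le_of_norm_le
    (f := fun y => (meanWait ν n s t (lindley s t 0 y) - meanWait ν n s t 0)
        - (meanWait ν n s' t' (lindley s' t' 0 y) - meanWait ν n s' t' 0))
    ((H.intC.const_mul (Δ * ρ ^ n)).add (H.int1.const_mul (sens ρ σ C * Δ * σ ^ n))) (by
      filter_upwards [H.nonneg] with y hy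
      rw [Real.norm_eq_abs]
      have k1 : |meanWait ν n s t (lindley s t 0 y) - meanWait ν n s t (lindley s' t' 0 y)|
          ≤ Δ * ρ ^ n * ((y.1 + y.2) * Real.exp (β * dom sHi tLo y)) := by
        refine (H.abs_meanWait_sub_le n hx (lindley_nonneg s t 0 y)
            (lindley_nonneg s' t' 0 y)).trans ?_
        have h2 := lindley_dist_mul_exp_le (s := s) (t := t) (s' := s') (t' := t') hy H.β_pos.le
          hx.2.1 hx'.2.1 hx.2.2 hx'.2.2 le_rfl (le_refl (0 : ℝ))
        refine (mul_le_mul_of_nonneg_right h2 (pow_nonneg H.ρ_pos.le n)).trans_eq ?_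
        simp [hΔ]; ring
      have k3 : |(meanWait ν n s t (lindley s' t' 0 y) - meanWait ν n s t 0)
            - (meanWait ν n s' t' (lindley s' t' 0 y) - meanWait ν n s' t' 0)|
            ≤ sens ρ σ C * Δ * σ ^ n * Real.exp (β * dom sHi tLo y) := by
        rcases (lindley_nonneg s' t' 0 y).eq_or_lt with h | h
        · rw [← h]; simp; positivity
        · refine (H.abs_meanWait_sub_sub_le n hx hx' le_rfl h.le).trans ?_
          have h4 : Real.exp (β * lindley s' t' 0 y) ≤ Real.exp (β * dom sHi tLo y) := by
            have := lindley_le hy hx'.2.1 hx'.2.2 h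
            exact Real.exp_le_exp.2 (mul_le_mul_of_nonneg_left (by linarith) H.β_pos.le)
          calc sens ρ σ C * Δ * Real.exp (β * lindley s' t' 0 y) * σ ^ n
              ≤ sens ρ σ C * Δ * Real.exp (β * dom sHi tLo y) * σ ^ n := by gcongr
            _ = _ := by ring
      simp only [Pi.add_apply]
      rw [abs_le] at k1 k3 ⊢
      constructor <;> linarith)
  have e := integral_add (H.intC.const_mul (Δ * ρ ^ n))
    (H.int1.const_mul (sens ρ σ C * Δ * σ ^ n))
  refine h1.trans (e.trans_le ?_)
  rw [integral_const_mul, integral_const_mul]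
  have i1 := mul_le_mul_of_nonneg_left H.leC (show 0 ≤ Δ * ρ ^ n by positivity)
  have i2 := mul_le_mul_of_nonneg_left (H.le1.trans (H.ρ_lt.trans H.σ_lt).le)
    (show 0 ≤ sens ρ σ C * Δ * σ ^ n by positivity)
  have i3 := mul_le_mul_of_nonneg_left (H.pow_le n) (mul_nonneg hΔ0 H.C_pos.le)
  unfold sensIncr
  nlinarith

lemma Tilted.summable_waitIncr (H : Tilted ν sHi tLo β ρ σ C) {s t : ℝ}
    (hx : InBox sHi tLo s t) : Summable fun n => waitIncr ν n s t :=
  Summable.of_norm_bounded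
    ((summable_geometric_of_lt_one H.ρ_pos.le (H.ρ_lt.trans H.σ_lt)).mul_left (sHi * C))
    fun n => H.abs_waitIncr_le n hx

lemma Tilted.steadyWait_sub_eq (H : Tilted ν sHi tLo β ρ σ C) (n : ℕ) {s t : ℝ}
    (hx : InBox sHi tLo s t) :
    steadyWait ν s t - meanWait ν n s t 0 = ∑' i, waitIncr ν (i + n) s t := by
  have h := (H.summable_waitIncr hx).sum_add_tsum_nat_add n
  have h2 : ∑ i ∈ Finset.range n, waitIncr ν i s t = meanWait ν n s t 0 := by
    unfold waitIncr
    rw [Finset.sum_range_sub (fun i => meanWait ν i s t 0)]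
    simp [meanWait]
  unfold steadyWait
  rw [← h, h2]; ring

lemma Tilted.abs_steadyWait_sub_le (H : Tilted ν sHi tLo β ρ σ C) (n : ℕ) {s t : ℝ}
    (hx : InBox sHi tLo s t) :
    |steadyWait ν s t - meanWait ν n s t 0| ≤ sHi * C / (1 - ρ) * ρ ^ n := by
  rw [H.steadyWait_sub_eq n hx, ← Real.norm_eq_abs]
  have hg := (hasSum_geometric_of_lt_one H.ρ_pos.le (H.ρ_lt.trans H.σ_lt)).mul_left
    (sHi * C * ρ ^ n)
  refine (tsum_of_norm_bounded hg fun i => ?_).trans_eq (by rw [div_mul_eq_mul_div, div_eq_mul_inv])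
  rw [Real.norm_eq_abs]
  refine (H.abs_waitIncr_le (i + n) hx).trans_eq ?_
  rw [pow_add]; ring

/-- The decay of the Lipschitz constant in `n` is the point: it makes the sum over a cycle Lipschitz
with a constant that does not depend on the cycle length. -/
lemma Tilted.abs_steadyWait_tail_sub_le (H : Tilted ν sHi tLo β ρ σ C) (n : ℕ) {s t s' t' : ℝ}
    (hx : InBox sHi tLo s t) (hx' : InBox sHi tLo s' t') :
    |(steadyWait ν s t - meanWait ν n s t 0) - (steadyWait ν s' t' - meanWait ν n s' t' 0)|
      ≤ sensIncr ρ σ C / (1 - σ) * (|s - s'| + |t - t'|) * σ ^ n := by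
  rw [H.steadyWait_sub_eq n hx, H.steadyWait_sub_eq n hx', ← Summable.tsum_sub
    ((summable_nat_add_iff n).2 (H.summable_waitIncr hx))
    ((summable_nat_add_iff n).2 (H.summable_waitIncr hx')), ← Real.norm_eq_abs]
  have hg := (hasSum_geometric_of_lt_one H.σ_pos.le H.σ_lt).mul_left
    (sensIncr ρ σ C * (|s - s'| + |t - t'|) * σ ^ n)
  refine (tsum_of_norm_bounded hg fun i => ?_).trans_eq (by rw [div_eq_mul_inv]; ring)
  rw [Real.norm_eq_abs]
  refine (H.abs_waitIncr_sub_le (i + n) hx hx').trans_eq ?_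
  rw [pow_add]; ring

lemma Tilted.abs_steadyWait_sub_steadyWait_le (H : Tilted ν sHi tLo β ρ σ C) {s t s' t' : ℝ}
    (hx : InBox sHi tLo s t) (hx' : InBox sHi tLo s' t') :
    |steadyWait ν s t - steadyWait ν s' t'|
      ≤ sensIncr ρ σ C / (1 - σ) * (|s - s'| + |t - t'|) := by
  simpa [meanWait] using H.abs_steadyWait_tail_sub_le 0 hx hx'

lemma Tilted.abs_steadyWait_le (H : Tilted ν sHi tLo β ρ σ C) {s t : ℝ}
    (hx : InBox sHi tLo s t) : |steadyWait ν s t| ≤ sHi * C / (1 - ρ) := by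
  simpa [meanWait] using H.abs_steadyWait_sub_le 0 hx

lemma Tilted.tendsto_meanWait (H : Tilted ν sHi tLo β ρ σ C) {s t : ℝ}
    (hx : InBox sHi tLo s t) :
    Tendsto (fun n => meanWait ν n s t 0) atTop (nhds (steadyWait ν s t)) := by
  have h0 : Tendsto (fun n => sHi * C / (1 - ρ) * ρ ^ n) atTop (nhds 0) := by
    simpa using (tendsto_pow_atTop_nhds_zero_of_lt_one H.ρ_pos.le
      (H.ρ_lt.trans H.σ_lt)).const_mul (sHi * C / (1 - ρ))
  rw [tendsto_iff_norm_sub_tendsto_zero]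
  refine squeeze_zero (fun _ => norm_nonneg _) (fun n => ?_) h0
  rw [Real.norm_eq_abs, abs_sub_comm]
  exact H.abs_steadyWait_sub_le n hx

/-! ### Deviation from the steady state accumulated over a cycle -/

lemma geom_sum_range_le {r : ℝ} (h0 : 0 ≤ r) (h1 : r < 1) (D : ℕ) :
    ∑ i ∈ Finset.range D, r ^ i ≤ 1 / (1 - r) := by
  rw [one_div, ← tsum_geometric_of_lt_one h0 h1]
  exact (summable_geometric_of_lt_one h0 h1).sum_le_tsum _ fun _ _ => by positivity

/-- Accumulated deviation from the steady state over `D` customers. -/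
noncomputable def transient (ν : Measure (ℝ × ℝ)) (D : ℕ) (s t w : ℝ) : ℝ :=
  ∑ i ∈ Finset.range D, (meanWait ν (i + 1) s t w - steadyWait ν s t)

/-- Lipschitz constant of `transient`. -/
noncomputable def transLip (ρ σ C : ℝ) : ℝ :=
  (1 + sens ρ σ C + sensIncr ρ σ C / (1 - σ)) / (1 - σ)

lemma Tilted.transLip_pos (H : Tilted ν sHi tLo β ρ σ C) : 0 < transLip ρ σ C := by
  have := H.sens_pos; have := H.sensIncr_pos; have : 0 < 1 - σ := sub_pos.2 H.σ_lt
  unfold transLip; positivity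

/-- The accumulated deviation is Lipschitz in the decision and in the initial state, uniformly in
the number of customers. -/
lemma Tilted.abs_transient_sub_le (H : Tilted ν sHi tLo β ρ σ C) (D : ℕ)
    {s t s' t' w w' : ℝ} (hx : InBox sHi tLo s t) (hx' : InBox sHi tLo s' t')
    (hw : 0 ≤ w) (hw' : 0 ≤ w') :
    |transient ν D s t w - transient ν D s' t' w'|
      ≤ transLip ρ σ C * (|w - w'| + (|s - s'| + |t - t'|)) * Real.exp (β * max w w') := by
  set Δ := |s - s'| + |t - t'| with hΔ
  set E := Real.exp (β * max w w') with hE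
  have hΔ0 : 0 ≤ Δ := by positivity
  have hA := H.sens_pos
  have hB := H.sensIncr_pos
  have h1σ : 0 < 1 - σ := sub_pos.2 H.σ_lt
  have hσ := H.σ_pos
  have hE1 : 1 ≤ E := Real.one_le_exp (mul_nonneg H.β_pos.le (le_max_of_le_left hw))
  have hterm : ∀ i ∈ Finset.range D,
      |(meanWait ν (i + 1) s t w - steadyWait ν s t)
        - (meanWait ν (i + 1) s' t' w' - steadyWait ν s' t')|
        ≤ (1 + sens ρ σ C + sensIncr ρ σ C / (1 - σ)) * (|w - w'| + Δ) * E * σ ^ i := by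
    intro i _
    have k0 : σ ^ (i + 1) ≤ σ ^ i := pow_le_pow_of_le_one hσ.le H.σ_lt.le (Nat.le_succ i)
    -- Three changes are separated: the initial state under the first decision (`k1`), the
    -- dependence on the decision of the effect of `w'` relative to an empty start (`k2`), and that
    -- of the distance of the empty start to the steady state (`k3`).
    have k1 := H.abs_meanWait_sub_le (i + 1) hx hw hw'
    have k2 := H.abs_meanWait_sub_sub_le (i + 1) hx hx' le_rfl hw'
    have k3 := H.abs_steadyWait_tail_sub_le (i + 1) hx hx'
    have l1 : |w - w'| * E * ρ ^ (i + 1) ≤ |w - w'| * E * σ ^ i := by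
      have := (H.pow_le (i + 1)).trans k0
      gcongr
    have l2 : sens ρ σ C * Δ * Real.exp (β * w') * σ ^ (i + 1)
        ≤ sens ρ σ C * Δ * E * σ ^ i := by
      have : Real.exp (β * w') ≤ E :=
        Real.exp_le_exp.2 (mul_le_mul_of_nonneg_left (le_max_right _ _) H.β_pos.le)
      gcongr
    have l3 : sensIncr ρ σ C / (1 - σ) * Δ * σ ^ (i + 1)
        ≤ sensIncr ρ σ C / (1 - σ) * Δ * E * σ ^ i := by
      have : sensIncr ρ σ C / (1 - σ) * Δ * 1 ≤ sensIncr ρ σ C / (1 - σ) * Δ * E := by gcongr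
      rw [mul_one] at this
      gcongr
    have m1 : 0 ≤ sensIncr ρ σ C / (1 - σ) * |w - w'| * E * σ ^ i := by positivity
    have m2 : 0 ≤ sens ρ σ C * |w - w'| * E * σ ^ i := by positivity
    have m3 : 0 ≤ Δ * E * σ ^ i := by positivity
    have e : (1 + sens ρ σ C + sensIncr ρ σ C / (1 - σ)) * (|w - w'| + Δ) * E * σ ^ i
      = |w - w'| * E * σ ^ i + sens ρ σ C * Δ * E * σ ^ i
        + sensIncr ρ σ C / (1 - σ) * Δ * E * σ ^ i
        + sensIncr ρ σ C / (1 - σ) * |w - w'| * E * σ ^ i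
        + sens ρ σ C * |w - w'| * E * σ ^ i + Δ * E * σ ^ i := by ring
    rw [e]
    rw [abs_le] at k1 k2 k3 ⊢
    constructor <;> linarith
  unfold transient
  rw [← Finset.sum_sub_distrib]
  refine (Finset.abs_sum_le_sum_abs _ _).trans ((Finset.sum_le_sum hterm).trans ?_)
  rw [← Finset.mul_sum]
  have hg := geom_sum_range_le hσ.le H.σ_lt D
  refine (mul_le_mul_of_nonneg_left hg (by positivity)).trans_eq ?_
  unfold transLip
  field_simp

lemma Tilted.sum_abs_meanWait_sub_steadyWait_le (H : Tilted ν sHi tLo β ρ σ C) (D N : ℕ)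
    {s t : ℝ} (hx : InBox sHi tLo s t) :
    |∑ i ∈ Finset.range D, (meanWait ν (i + 1 + N) s t 0 - steadyWait ν s t)|
      ≤ sHi * C / (1 - ρ) ^ 2 * ρ ^ N := by
  have h1ρ : 0 < 1 - ρ := sub_pos.2 (H.ρ_lt.trans H.σ_lt)
  have hρ := H.ρ_pos
  have hs := H.sHi_pos
  have hC := H.C_pos
  refine (Finset.abs_sum_le_sum_abs _ _).trans ?_
  have : ∀ i ∈ Finset.range D, |meanWait ν (i + 1 + N) s t 0 - steadyWait ν s t|
      ≤ sHi * C / (1 - ρ) * ρ ^ N * ρ ^ i := by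
    intro i _
    rw [abs_sub_comm]
    refine (H.abs_steadyWait_sub_le _ hx).trans ?_
    rw [mul_assoc, ← pow_add]
    refine mul_le_mul_of_nonneg_left ?_ (by positivity)
    exact pow_le_pow_of_le_one hρ.le (H.ρ_lt.trans H.σ_lt).le (by omega)
  refine (Finset.sum_le_sum this).trans ?_
  rw [← Finset.mul_sum]
  refine (mul_le_mul_of_nonneg_left
    (geom_sum_range_le hρ.le (H.ρ_lt.trans H.σ_lt) D) (by positivity)).trans_eq ?_
  field_simp

end

end GIGIOne

namespace GIGIOne

set_option linter.unusedSectionVars false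

/-! ### Adapted Lindley recursions -/

section

variable {Ω : Type*} [mΩ : MeasurableSpace Ω]

/-- Inputs `ζ n` with law `ν`, independent of the history `G n` and contained in `G (n + 1)`. -/
structure Innov (P : Measure Ω) (G : Filtration ℕ mΩ) (ζ : ℕ → Ω → ℝ × ℝ)
    (ν : Measure (ℝ × ℝ)) : Prop where
  meas : ∀ n, Measurable[G (n + 1)] (ζ n)
  indep : ∀ n, Indep (MeasurableSpace.comap (ζ n) inferInstance) (G n) P
  law : ∀ n, P.map (ζ n) = ν

variable {P : Measure Ω} [IsProbabilityMeasure P] {G : Filtration ℕ mΩ} {ζ : ℕ → Ω → ℝ × ℝ}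
  {ν : Measure (ℝ × ℝ)}

lemma Innov.measurable (I : Innov P G ζ ν) (n : ℕ) : Measurable (ζ n) :=
  (I.meas n).mono (G.le _) le_rfl

lemma Innov.indepFun (I : Innov P G ζ ν) (n : ℕ) {E : Type*} [MeasurableSpace E] {A : Ω → E}
    (hA : Measurable[G n] A) : IndepFun A (ζ n) P :=
  (indep_of_indep_of_le_right (I.indep n) hA.comap_le).symm

lemma Innov.map_prod (I : Innov P G ζ ν) (n : ℕ) {E : Type*} [MeasurableSpace E] {A : Ω → E}
    (hA : Measurable[G n] A) : P.map (fun ω => (A ω, ζ n ω)) = (P.map A).prod ν := by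
  have hA' : Measurable A := hA.mono (G.le _) le_rfl
  rw [(indepFun_iff_map_prod_eq_prod_map_map hA'.aemeasurable (I.measurable n).aemeasurable).1
    (I.indepFun n hA), I.law n]

/-- The input can be integrated out with the history frozen. -/
lemma Innov.integral_freeze [SFinite ν] (I : Innov P G ζ ν) (n : ℕ) {E : Type*}
    [MeasurableSpace E] {A : Ω → E} (hA : Measurable[G n] A) {Ψ : E × ℝ × ℝ → ℝ}
    (hΨ : Measurable Ψ) (hi : Integrable (fun ω => Ψ (A ω, ζ n ω)) P) :
    ∫ ω, Ψ (A ω, ζ n ω) ∂P = ∫ ω, ∫ y, Ψ (A ω, y) ∂ν ∂P := by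
  have hA' : Measurable A := hA.mono (G.le _) le_rfl
  have hp : Measurable fun ω => (A ω, ζ n ω) := hA'.prodMk (I.measurable n)
  have h1 : ∫ ω, Ψ (A ω, ζ n ω) ∂P = ∫ z, Ψ z ∂(P.map fun ω => (A ω, ζ n ω)) :=
    (integral_map hp.aemeasurable hΨ.aestronglyMeasurable).symm
  have h2 : Integrable Ψ (P.map fun ω => (A ω, ζ n ω)) :=
    (integrable_map_measure hΨ.aestronglyMeasurable hp.aemeasurable).2 hi
  rw [h1, I.map_prod n hA] at *
  rw [integral_prod _ h2, integral_map hA'.aemeasurable]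
  exact (hΨ.stronglyMeasurable.integral_prod_right').aestronglyMeasurable

lemma Innov.integrable_comp (I : Innov P G ζ ν) (n : ℕ) {g : ℝ × ℝ → ℝ}
    (hgi : Integrable g ν) : Integrable (fun ω => g (ζ n ω)) P := by
  rw [← I.law n] at hgi
  exact hgi.comp_measurable (I.measurable n)

lemma Innov.integral_comp (I : Innov P G ζ ν) (n : ℕ) {g : ℝ × ℝ → ℝ} (hg : Measurable g) :
    ∫ ω, g (ζ n ω) ∂P = ∫ y, g y ∂ν := by
  rw [← I.law n, integral_map (I.measurable n).aemeasurable hg.aestronglyMeasurable]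

lemma Innov.integrable_mul (I : Innov P G ζ ν) (n : ℕ) {X : Ω → ℝ} {g : ℝ × ℝ → ℝ}
    (hX : Measurable[G n] X) (hXi : Integrable X P) (hg : Measurable g) (hgi : Integrable g ν) :
    Integrable (fun ω => X ω * g (ζ n ω)) P :=
  ((I.indepFun n hX).comp measurable_id hg).integrable_mul hXi (I.integrable_comp n hgi)

lemma Innov.integral_mul (I : Innov P G ζ ν) (n : ℕ) {X : Ω → ℝ} {g : ℝ × ℝ → ℝ}
    (hX : Measurable[G n] X) (hg : Measurable g) :
    ∫ ω, X ω * g (ζ n ω) ∂P = (∫ ω, X ω ∂P) * ∫ y, g y ∂ν := by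
  rw [← I.integral_comp n hg]
  exact ((I.indepFun n hX).comp measurable_id hg).integral_mul_eq_mul_integral
    (hX.mono (G.le _) le_rfl).aestronglyMeasurable
    (hg.comp (I.measurable n)).aestronglyMeasurable

lemma Innov.ae_nonneg (I : Innov P G ζ ν) (h : ∀ᵐ y ∂ν, 0 ≤ y.1 ∧ 0 ≤ y.2) :
    ∀ᵐ ω ∂P, ∀ n, 0 ≤ (ζ n ω).1 ∧ 0 ≤ (ζ n ω).2 := by
  rw [ae_all_iff]
  intro n
  rw [← I.law n] at h
  exact ae_of_ae_map (I.measurable n).aemeasurable h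

/-- A Lindley recursion with predictable parameters in the box. -/
structure IsLindley (G : Filtration ℕ mΩ) (ζ : ℕ → Ω → ℝ × ℝ) (sHi tLo : ℝ)
    (s t W : ℕ → Ω → ℝ) : Prop where
  meas_s : ∀ n, Measurable[G n] (s n)
  meas_t : ∀ n, Measurable[G n] (t n)
  meas_zero : Measurable[G 0] (W 0)
  nonneg_zero : ∀ ω, 0 ≤ W 0 ω
  box : ∀ n ω, InBox sHi tLo (s n ω) (t n ω)
  step : ∀ n ω, W (n + 1) ω = lindley (s n ω) (t n ω) (W n ω) (ζ n ω)

variable {sHi tLo β ρ σ C : ℝ} {s t W s' t' W' : ℕ → Ω → ℝ}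

lemma measurable_abs_comp {m : MeasurableSpace Ω} {f : Ω → ℝ} (h : Measurable[m] f) :
    Measurable[m] fun ω => |f ω| := continuous_abs.measurable.comp h

lemma measurable_lindley_comp {m : MeasurableSpace Ω} {s t w : Ω → ℝ} {y : Ω → ℝ × ℝ}
    (hs : Measurable[m] s) (ht : Measurable[m] t) (hw : Measurable[m] w) (hy : Measurable[m] y) :
    Measurable[m] fun ω => lindley (s ω) (t ω) (w ω) (y ω) :=
  (measurable_lindley).comp ((hs.prodMk (ht.prodMk hw)).prodMk hy)

lemma measurable_meanWait_comp [SFinite ν] {m : MeasurableSpace Ω} (n : ℕ) {s t w : Ω → ℝ}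
    (hs : Measurable[m] s) (ht : Measurable[m] t) (hw : Measurable[m] w) :
    Measurable[m] fun ω => meanWait ν n (s ω) (t ω) (w ω) :=
  (measurable_meanWait n).comp (hs.prodMk (ht.prodMk hw))

lemma IsLindley.measurable (L : IsLindley G ζ sHi tLo s t W) (I : Innov P G ζ ν) (n : ℕ) :
    Measurable[G n] (W n) := by
  induction n with
  | zero => exact L.meas_zero
  | succ n ih =>
    have h : W (n + 1) = fun ω => lindley (s n ω) (t n ω) (W n ω) (ζ n ω) := funext (L.step n)
    rw [h]
    have hm := G.mono (Nat.le_succ n)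
    exact measurable_lindley_comp ((L.meas_s n).mono hm le_rfl) ((L.meas_t n).mono hm le_rfl)
      (ih.mono hm le_rfl) (I.meas n)

lemma IsLindley.measurable' (L : IsLindley G ζ sHi tLo s t W) (I : Innov P G ζ ν) (n : ℕ) :
    Measurable (W n) := (L.measurable I n).mono (G.le _) le_rfl

lemma IsLindley.nonneg (L : IsLindley G ζ sHi tLo s t W) (n : ℕ) (ω : Ω) : 0 ≤ W n ω := by
  cases n with
  | zero => exact L.nonneg_zero ω
  | succ n => rw [L.step]; exact lindley_nonneg _ _ _ _

/-- Uniform exponential moments. -/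
lemma IsLindley.exp_moment (L : IsLindley G ζ sHi tLo s t W) (I : Innov P G ζ ν)
    (H : Tilted ν sHi tLo β ρ σ C) {m : ℝ} (hm : 1 + ρ * m ≤ m)
    (h0 : Integrable (fun ω => Real.exp (2 * β * W 0 ω)) P)
    (h0' : ∫ ω, Real.exp (2 * β * W 0 ω) ∂P ≤ m) (n : ℕ) :
    Integrable (fun ω => Real.exp (2 * β * W n ω)) P ∧ ∫ ω, Real.exp (2 * β * W n ω) ∂P ≤ m := by
  induction n with
  | zero => exact ⟨h0, h0'⟩
  | succ n ih =>
    have hg : Measurable fun y : ℝ × ℝ => Real.exp (2 * β * dom sHi tLo y) :=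
      ((measurable_dom sHi tLo).const_mul _).exp
    have hX : Measurable[G n] fun ω => Real.exp (2 * β * W n ω) :=
      ((L.measurable I n).const_mul _).exp
    have hi : Integrable (fun ω => 1 + Real.exp (2 * β * W n ω)
        * Real.exp (2 * β * dom sHi tLo (ζ n ω))) P :=
      (integrable_const _).add (I.integrable_mul n hX ih.1 hg H.int2)
    -- The summand 1 covers the value zero, where `lindley_le` is not available. The resulting
    -- recursion x ↦ 1 + ρ x for the moments keeps every level `m` with `1 + ρ * m ≤ m`.
    have hle : ∀ᵐ ω ∂P, Real.exp (2 * β * W (n + 1) ω) ≤ 1 + Real.exp (2 * β * W n ω)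
        * Real.exp (2 * β * dom sHi tLo (ζ n ω)) := by
      filter_upwards [I.ae_nonneg H.nonneg] with ω hω
      rcases (L.nonneg (n + 1) ω).eq_or_lt with h | h
      · rw [← h]; simp; positivity
      · rw [← Real.exp_add, ← mul_add]
        have h2 := Real.exp_le_exp.2 (mul_le_mul_of_nonneg_left
          (lindley_le (hω n) (L.box n ω).2.1 (L.box n ω).2.2 (L.step n ω ▸ h))
          (mul_nonneg two_pos.le H.β_pos.le))
        rw [L.step n ω]
        linarith
    have hint : Integrable (fun ω => Real.exp (2 * β * W (n + 1) ω)) P := by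
      refine hi.mono' ((L.measurable' I (n + 1)).const_mul _).exp.aestronglyMeasurable ?_
      filter_upwards [hle] with ω hω
      rwa [Real.norm_eq_abs, abs_of_pos (Real.exp_pos _)]
    refine ⟨hint, (integral_mono_ae hint hi hle).trans ?_⟩
    rw [integral_add (integrable_const _) (I.integrable_mul n hX ih.1 hg H.int2),
      I.integral_mul n hX hg]
    have h3 : (0 : ℝ) ≤ ∫ ω, Real.exp (2 * β * W n ω) ∂P :=
      integral_nonneg fun ω => (Real.exp_pos _).le
    have h4 := mul_le_mul_of_nonneg_left H.le2 h3
    have h5 := mul_le_mul_of_nonneg_right ih.2 H.ρ_pos.le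
    simp only [integral_const, probReal_univ, smul_eq_mul, mul_one]
    linarith

/-- Two Lindley recursions driven by the same inputs: the weighted distance contracts, up to the
distance of the parameters. -/
lemma IsLindley.dist_le (L : IsLindley G ζ sHi tLo s t W) (L' : IsLindley G ζ sHi tLo s' t' W')
    (I : Innov P G ζ ν) (H : Tilted ν sHi tLo β ρ σ C) {δ : Ω → ℝ} (hδ : Measurable[G 0] δ)
    (hδs : ∀ n ω, |s n ω - s' n ω| + |t n ω - t' n ω| ≤ δ ω) {B d₀ : ℝ}
    (hB : ∀ n, Integrable (fun ω => δ ω * Real.exp (β * max (W n ω) (W' n ω))) P ∧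
      ∫ ω, δ ω * Real.exp (β * max (W n ω) (W' n ω)) ∂P ≤ B)
    (h0 : Integrable (fun ω => |W 0 ω - W' 0 ω| * Real.exp (β * max (W 0 ω) (W' 0 ω))) P)
    (h0' : ∫ ω, |W 0 ω - W' 0 ω| * Real.exp (β * max (W 0 ω) (W' 0 ω)) ∂P ≤ d₀) (n : ℕ) :
    Integrable (fun ω => |W n ω - W' n ω| * Real.exp (β * max (W n ω) (W' n ω))) P ∧
      ∫ ω, |W n ω - W' n ω| * Real.exp (β * max (W n ω) (W' n ω)) ∂P
        ≤ ρ ^ n * d₀ + C * B / (1 - ρ) := by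
  have h1ρ : 0 < 1 - ρ := sub_pos.2 (H.ρ_lt.trans H.σ_lt)
  have hδ0 : ∀ ω, 0 ≤ δ ω := fun ω => le_trans (by positivity) (hδs 0 ω)
  have hB0 : 0 ≤ B := (integral_nonneg fun ω => mul_nonneg (hδ0 ω) (Real.exp_pos _).le).trans
    (hB 0).2
  have hC := H.C_pos
  induction n with
  | zero =>
    refine ⟨h0, ?_⟩
    have : 0 ≤ C * B / (1 - ρ) := by positivity
    simp only [pow_zero, one_mul]
    linarith
  | succ n ih =>
    have hm : G 0 ≤ G n := G.mono (Nat.zero_le n)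
    have hE : Measurable[G n] fun ω => Real.exp (β * max (W n ω) (W' n ω)) :=
      (((L.measurable I n).max (L'.measurable I n)).const_mul _).exp
    have hX1 : Measurable[G n] fun ω =>
        |W n ω - W' n ω| * Real.exp (β * max (W n ω) (W' n ω)) :=
      (measurable_abs_comp ((L.measurable I n).sub (L'.measurable I n))).mul hE
    have hX2 : Measurable[G n] fun ω => δ ω * Real.exp (β * max (W n ω) (W' n ω)) :=
      (hδ.mono hm le_rfl).mul hE
    have hg1 : Measurable fun y : ℝ × ℝ => Real.exp (β * dom sHi tLo y) :=
      ((measurable_dom sHi tLo).const_mul _).exp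
    have hg2 : Measurable fun y : ℝ × ℝ => (y.1 + y.2) * Real.exp (β * dom sHi tLo y) :=
      (measurable_fst.add measurable_snd).mul hg1
    have i1 := I.integrable_mul n hX1 ih.1 hg1 H.int1
    have i2 := I.integrable_mul n hX2 (hB n).1 hg2 H.intC
    have hle : ∀ᵐ ω ∂P, |W (n + 1) ω - W' (n + 1) ω|
          * Real.exp (β * max (W (n + 1) ω) (W' (n + 1) ω))
        ≤ |W n ω - W' n ω| * Real.exp (β * max (W n ω) (W' n ω))
            * Real.exp (β * dom sHi tLo (ζ n ω))
          + δ ω * Real.exp (β * max (W n ω) (W' n ω))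
            * (((ζ n ω).1 + (ζ n ω).2) * Real.exp (β * dom sHi tLo (ζ n ω))) := by
      filter_upwards [I.ae_nonneg H.nonneg] with ω hω
      rw [L.step n ω, L'.step n ω]
      have h2 := lindley_dist_mul_exp_le (hω n) H.β_pos.le (L.box n ω).2.1 (L'.box n ω).2.1
        (L.box n ω).2.2 (L'.box n ω).2.2 (le_max_left (W n ω) (W' n ω))
        (le_max_right (W n ω) (W' n ω))
      refine h2.trans ?_
      have h3 : (|s n ω - s' n ω| + |t n ω - t' n ω|) * ((ζ n ω).1 + (ζ n ω).2)
          ≤ δ ω * ((ζ n ω).1 + (ζ n ω).2) :=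
        mul_le_mul_of_nonneg_right (hδs n ω) (add_nonneg (hω n).1 (hω n).2)
      have h4 := mul_le_mul_of_nonneg_right h3 (show 0 ≤ Real.exp (β * max (W n ω) (W' n ω))
        * Real.exp (β * dom sHi tLo (ζ n ω)) by positivity)
      linarith
    have hmeas : Measurable fun ω => |W (n + 1) ω - W' (n + 1) ω|
          * Real.exp (β * max (W (n + 1) ω) (W' (n + 1) ω)) :=
      (measurable_abs_comp ((L.measurable' I _).sub (L'.measurable' I _))).mul
        (((L.measurable' I _).max (L'.measurable' I _)).const_mul _).exp
    have hi := i1.add i2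
    have hint : Integrable (fun ω => |W (n + 1) ω - W' (n + 1) ω|
          * Real.exp (β * max (W (n + 1) ω) (W' (n + 1) ω))) P := by
      refine hi.mono' hmeas.aestronglyMeasurable ?_
      filter_upwards [hle] with ω hω
      rwa [Real.norm_eq_abs, abs_of_nonneg (by positivity)]
    refine ⟨hint, (integral_mono_ae hint hi hle).trans ?_⟩
    have e := integral_add i1 i2
    refine e.trans_le ?_
    rw [I.integral_mul n hX1 hg1, I.integral_mul n hX2 hg2]
    have p1 : 0 ≤ ∫ ω, |W n ω - W' n ω| * Real.exp (β * max (W n ω) (W' n ω)) ∂P :=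
      integral_nonneg fun ω => by positivity
    have p2 : 0 ≤ ∫ ω, δ ω * Real.exp (β * max (W n ω) (W' n ω)) ∂P :=
      integral_nonneg fun ω => mul_nonneg (hδ0 ω) (Real.exp_pos _).le
    have q1 := mul_le_mul ih.2 H.le1 (integral_nonneg fun y => (Real.exp_pos _).le)
      (p1.trans ih.2)
    have q2 := mul_le_mul (hB n).2 H.leC (integral_nonneg_of_ae (by
      filter_upwards [H.nonneg] with y hy
      exact mul_nonneg (add_nonneg hy.1 hy.2) (Real.exp_pos _).le)) hB0
    -- C B / (1 - ρ) is the fixed point of x ↦ ρ x + C B.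
    have e2 : (ρ ^ n * d₀ + C * B / (1 - ρ)) * ρ + B * C
        = ρ ^ (n + 1) * d₀ + C * B / (1 - ρ) := by
      field_simp; ring
    linarith

/-- With constant parameters the mean waiting times form a semigroup along the recursion. -/
lemma IsLindley.integral_mul_meanWait (H : Tilted ν sHi tLo β ρ σ C) (I : Innov P G ζ ν)
    {s t : Ω → ℝ} (L : IsLindley G ζ sHi tLo (fun _ => s) (fun _ => t) W)
    (hW : ∀ n, Integrable (W n) P) {b : Ω → ℝ} (hb : Measurable[G 0] b) {K : ℝ}
    (hbK : ∀ ω, |b ω| ≤ K) (m n : ℕ) :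
    ∫ ω, b ω * meanWait ν m (s ω) (t ω) (W n ω) ∂P
      = ∫ ω, b ω * meanWait ν (m + n) (s ω) (t ω) (W 0 ω) ∂P := by
  have := H.prob
  induction n generalizing m with
  | zero => rfl
  | succ n ih =>
    have hm : G 0 ≤ G n := G.mono (Nat.zero_le n)
    have hA : Measurable[G n] fun ω => (b ω, s ω, t ω, W n ω) :=
      (hb.mono hm le_rfl).prodMk ((L.meas_s n).prodMk ((L.meas_t n).prodMk (L.measurable I n)))
    have hΨ : Measurable fun z : (ℝ × ℝ × ℝ × ℝ) × ℝ × ℝ =>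
        z.1.1 * meanWait ν m z.1.2.1 z.1.2.2.1 (lindley z.1.2.1 z.1.2.2.1 z.1.2.2.2 z.2) :=
      (measurable_fst.fst).mul (measurable_meanWait_comp m measurable_fst.snd.fst
        measurable_fst.snd.snd.fst (measurable_lindley_comp measurable_fst.snd.fst
        measurable_fst.snd.snd.fst measurable_fst.snd.snd.snd measurable_snd))
    have hint : Integrable (fun ω => b ω * meanWait ν m (s ω) (t ω)
        (lindley (s ω) (t ω) (W n ω) (ζ n ω))) P := by
      refine (((hW (n + 1)).add (integrable_const (m * sHi))).const_mul K).mono'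
        ((hΨ.comp ((hA.mono (G.le _) le_rfl).prodMk (I.measurable n))).aestronglyMeasurable)
        (ae_of_all _ fun ω => ?_)
      rw [Real.norm_eq_abs, abs_mul, ← L.step n ω]
      exact mul_le_mul (hbK ω) (H.abs_meanWait_le m (L.box n ω) (L.nonneg _ ω)) (abs_nonneg _)
        ((abs_nonneg _).trans (hbK ω))
    -- Integrating out the input `n` trades one step of the path for one more step of `meanWait`.
    -- The parameters and the factor `b` may be random because they are measurable at time 0; no
    -- conditional expectation is needed.
    have h1 := I.integral_freeze n hA hΨ hint
    simp only [integral_const_mul] at h1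
    have h2 : ∫ ω, b ω * meanWait ν m (s ω) (t ω) (W (n + 1) ω) ∂P
        = ∫ ω, b ω * meanWait ν (m + 1) (s ω) (t ω) (W n ω) ∂P := by
      rw [show W (n + 1) = fun ω => lindley (s ω) (t ω) (W n ω) (ζ n ω) from funext (L.step n)]
      exact h1
    rw [h2, ih (m + 1), Nat.add_right_comm, Nat.add_assoc]

/-! ### A change of the arrival rate after the leftover customers -/

/-- Sum of the first `n` unscaled interarrival times. -/
noncomputable def arrSum (ζ : ℕ → Ω → ℝ × ℝ) (n : ℕ) (ω : Ω) : ℝ :=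
  ∑ j ∈ Finset.range n, (ζ j ω).1

open Classical in
/-- Indicator of the event that the interarrival time with index `n` belongs to the old rate. -/
noncomputable def oldInd (ζ : ℕ → Ω → ℝ × ℝ) (w tOld : Ω → ℝ) (n : ℕ) (ω : Ω) : ℝ :=
  if tOld ω * arrSum ζ n ω ≤ w ω then 1 else 0

/-- Mean interarrival time in force for the interarrival time with index `n`. -/
noncomputable def mixRate (ζ : ℕ → Ω → ℝ × ℝ) (w tOld t : Ω → ℝ) (n : ℕ) (ω : Ω) : ℝ :=
  t ω + oldInd ζ w tOld n ω * (tOld ω - t ω)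

lemma oldInd_cases {Ω : Type*} (ζ : ℕ → Ω → ℝ × ℝ) (w tOld : Ω → ℝ) (n : ℕ) (ω : Ω) :
    (oldInd ζ w tOld n ω = 1 ∧ tOld ω * arrSum ζ n ω ≤ w ω) ∨
      (oldInd ζ w tOld n ω = 0 ∧ ¬ tOld ω * arrSum ζ n ω ≤ w ω) := by
  unfold oldInd
  split_ifs with h
  · exact Or.inl ⟨rfl, h⟩
  · exact Or.inr ⟨rfl, h⟩

lemma oldInd_mem {Ω : Type*} (ζ : ℕ → Ω → ℝ × ℝ) (w tOld : Ω → ℝ) (n : ℕ) (ω : Ω) :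
    0 ≤ oldInd ζ w tOld n ω ∧ oldInd ζ w tOld n ω ≤ 1 := by
  rcases oldInd_cases ζ w tOld n ω with h | h <;> rw [h.1] <;> norm_num

lemma measurable_arrSum (I : Innov P G ζ ν) (n : ℕ) : Measurable[G n] (arrSum ζ n) := by
  unfold arrSum
  refine Finset.measurable_fun_sum _ fun j hj => ?_
  exact ((I.meas j).mono (G.mono (Finset.mem_range.1 hj)) le_rfl).fst

lemma measurable_oldInd (I : Innov P G ζ ν) {w tOld : Ω → ℝ} (hw : Measurable[G 0] w)
    (ht : Measurable[G 0] tOld) (n : ℕ) : Measurable[G n] (oldInd ζ w tOld n) := by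
  have hm : G 0 ≤ G n := G.mono (Nat.zero_le n)
  refine Measurable.ite ?_ measurable_const measurable_const
  exact measurableSet_le ((ht.mono hm le_rfl).mul (measurable_arrSum I n)) (hw.mono hm le_rfl)

lemma measurable_mixRate (I : Innov P G ζ ν) {w tOld t : Ω → ℝ} (hw : Measurable[G 0] w)
    (hto : Measurable[G 0] tOld) (ht : Measurable[G 0] t) (n : ℕ) :
    Measurable[G n] (mixRate ζ w tOld t n) := by
  have hm : G 0 ≤ G n := G.mono (Nat.zero_le n)
  exact (ht.mono hm le_rfl).add ((measurable_oldInd I hw hto n).mul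
    ((hto.mono hm le_rfl).sub (ht.mono hm le_rfl)))

lemma mixRate_ge {ζ : ℕ → Ω → ℝ × ℝ} {w tOld t : Ω → ℝ} {n : ℕ} {ω : Ω} (h1 : tLo ≤ tOld ω)
    (h2 : tLo ≤ t ω) : tLo ≤ mixRate ζ w tOld t n ω := by
  unfold mixRate
  rcases oldInd_cases ζ w tOld n ω with h | h <;> rw [h.1] <;> linarith

/-- A Lindley recursion in which the arrival rate changes after the leftover customers. -/
def IsMixed (G : Filtration ℕ mΩ) (ζ : ℕ → Ω → ℝ × ℝ) (sHi tLo : ℝ) (s tOld t : Ω → ℝ)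
    (W : ℕ → Ω → ℝ) : Prop :=
  IsLindley G ζ sHi tLo (fun _ => s) (mixRate ζ (W 0) tOld t) W ∧ Measurable[G 0] tOld ∧
    Measurable[G 0] t ∧ ∀ ω, tLo ≤ tOld ω ∧ tLo ≤ t ω

/-- Discarding the service times and the truncation only lowers the waiting time, which then becomes
the initial one minus the arrival time of customer `n` under the old rate. -/
lemma IsMixed.old_le {s tOld t : Ω → ℝ} (L : IsMixed G ζ sHi tLo s tOld t W)
    (H : Tilted ν sHi tLo β ρ σ C)
    {ω : Ω} (hω : ∀ n, 0 ≤ (ζ n ω).1 ∧ 0 ≤ (ζ n ω).2) (n : ℕ)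
    (h : tOld ω * arrSum ζ n ω ≤ W 0 ω) : W 0 ω - tOld ω * arrSum ζ n ω ≤ W n ω := by
  induction n with
  | zero => simp [arrSum]
  | succ n ih =>
    have ht : 0 ≤ tOld ω := H.tLo_pos.le.trans (L.2.2.2 ω).1
    have e : arrSum ζ (n + 1) ω = arrSum ζ n ω + (ζ n ω).1 := Finset.sum_range_succ _ _
    have h1 := mul_nonneg ht (hω n).1
    rw [e] at h ⊢
    have h2 := ih (by linarith)
    have h3 := mul_nonneg (L.1.box n ω).1 (hω n).2
    have hc : oldInd ζ (W 0) tOld n ω = 1 := by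
      unfold oldInd; rw [if_pos]; linarith
    rw [L.1.step n ω]
    refine le_trans ?_ (le_max_left _ _)
    unfold mixRate
    rw [hc]
    linarith

/-- If index `n + 1` is still old, the next interarrival time fits into the waiting time of customer
`n` by `old_le`. The truncation is then inactive, so the bound by the dominating walk holds even if
the new value is zero, and no additive constant appears. -/
lemma IsMixed.old_step {s tOld t : Ω → ℝ} (L : IsMixed G ζ sHi tLo s tOld t W)
    (H : Tilted ν sHi tLo β ρ σ C)
    {ω : Ω} (hω : ∀ n, 0 ≤ (ζ n ω).1 ∧ 0 ≤ (ζ n ω).2) (n : ℕ) :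
    oldInd ζ (W 0) tOld (n + 1) ω * Real.exp (β * W (n + 1) ω)
      ≤ oldInd ζ (W 0) tOld n ω * Real.exp (β * W n ω) * Real.exp (β * dom sHi tLo (ζ n ω)) := by
  rcases oldInd_cases ζ (W 0) tOld (n + 1) ω with h | h
  · have ht : 0 ≤ tOld ω := H.tLo_pos.le.trans (L.2.2.2 ω).1
    have e : arrSum ζ (n + 1) ω = arrSum ζ n ω + (ζ n ω).1 := Finset.sum_range_succ _ _
    have h1 := mul_nonneg ht (hω n).1
    have hn : tOld ω * arrSum ζ n ω ≤ W 0 ω := by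
      have := h.2; rw [e] at this; linarith
    have hc : oldInd ζ (W 0) tOld n ω = 1 := by unfold oldInd; rw [if_pos hn]
    have h2 := L.old_le H hω n hn
    have h3 := mul_nonneg (L.1.box n ω).1 (hω n).2
    have h4 := h.2
    rw [e] at h4
    have h5 : W (n + 1) ω ≤ W n ω + dom sHi tLo (ζ n ω) := by
      rw [L.1.step n ω]
      unfold lindley mixRate dom
      rw [hc]
      have k1 := mul_le_mul_of_nonneg_right (L.1.box n ω).2.1 (hω n).2
      have k2 := mul_le_mul_of_nonneg_right (L.2.2.2 ω).1 (hω n).1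
      refine max_le ?_ ?_ <;> linarith
    rw [h.1, hc, one_mul, one_mul, ← Real.exp_add, ← mul_add]
    exact Real.exp_le_exp.2 (mul_le_mul_of_nonneg_left h5 H.β_pos.le)
  · rw [h.1, zero_mul]
    have := (oldInd_mem ζ (W 0) tOld n ω).1
    positivity

/-- The leftover customers are few, with exponential weights. -/
lemma IsMixed.old_moment {s tOld t : Ω → ℝ} (L : IsMixed G ζ sHi tLo s tOld t W)
    (H : Tilted ν sHi tLo β ρ σ C) (I : Innov P G ζ ν) {b : Ω → ℝ} (hb : Measurable[G 0] b)
    (hb0 : ∀ ω, 0 ≤ b ω) (hi : Integrable (fun ω => b ω * Real.exp (β * W 0 ω)) P) (n : ℕ) :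
    Integrable (fun ω => b ω * (oldInd ζ (W 0) tOld n ω * Real.exp (β * W n ω))) P ∧
      ∫ ω, b ω * (oldInd ζ (W 0) tOld n ω * Real.exp (β * W n ω)) ∂P
        ≤ ρ ^ n * ∫ ω, b ω * Real.exp (β * W 0 ω) ∂P := by
  have hmeas : ∀ n, Measurable[G n] fun ω =>
      b ω * (oldInd ζ (W 0) tOld n ω * Real.exp (β * W n ω)) := fun n =>
    (hb.mono (G.mono (Nat.zero_le n)) le_rfl).mul
      ((measurable_oldInd I L.1.meas_zero L.2.1 n).mul ((L.1.measurable I n).const_mul _).exp)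
  have h0 : ∀ n ω, 0 ≤ b ω * (oldInd ζ (W 0) tOld n ω * Real.exp (β * W n ω)) := fun n ω =>
    mul_nonneg (hb0 ω) (mul_nonneg (oldInd_mem _ _ _ _ _).1 (Real.exp_pos _).le)
  induction n with
  | zero =>
    have e : (fun ω => b ω * (oldInd ζ (W 0) tOld 0 ω * Real.exp (β * W 0 ω)))
        = fun ω => b ω * Real.exp (β * W 0 ω) := by
      funext ω
      have : oldInd ζ (W 0) tOld 0 ω = 1 := by
        unfold oldInd; rw [if_pos]; simpa [arrSum] using L.1.nonneg 0 ω
      rw [this, one_mul]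
    rw [e]; simpa using hi
  | succ n ih =>
    have hg : Measurable fun y : ℝ × ℝ => Real.exp (β * dom sHi tLo y) :=
      ((measurable_dom sHi tLo).const_mul _).exp
    have i1 := I.integrable_mul n (hmeas n) ih.1 hg H.int1
    have hle : ∀ᵐ ω ∂P, b ω * (oldInd ζ (W 0) tOld (n + 1) ω * Real.exp (β * W (n + 1) ω))
        ≤ b ω * (oldInd ζ (W 0) tOld n ω * Real.exp (β * W n ω))
          * Real.exp (β * dom sHi tLo (ζ n ω)) := by
      filter_upwards [I.ae_nonneg H.nonneg] with ω hω
      have := mul_le_mul_of_nonneg_left (L.old_step H hω n) (hb0 ω)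
      linarith
    have hint : Integrable (fun ω => b ω * (oldInd ζ (W 0) tOld (n + 1) ω
        * Real.exp (β * W (n + 1) ω))) P := by
      refine i1.mono' (((hmeas (n + 1)).mono (G.le _) le_rfl).aestronglyMeasurable) ?_
      filter_upwards [hle] with ω hω
      rwa [Real.norm_eq_abs, abs_of_nonneg (h0 _ _)]
    refine ⟨hint, (integral_mono_ae hint i1 hle).trans ?_⟩
    rw [I.integral_mul n (hmeas n) hg, pow_succ, mul_right_comm]
    exact mul_le_mul ih.2 H.le1 (integral_nonneg fun y => (Real.exp_pos _).le)
      (mul_nonneg (pow_nonneg H.ρ_pos.le n)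
        (integral_nonneg fun ω => mul_nonneg (hb0 ω) (Real.exp_pos _).le))

/-- The mean waiting times under a changed arrival rate, compared with those under the new rate. -/
lemma IsMixed.abs_integral_meanWait_sub_le {s tOld t : Ω → ℝ}
    (L : IsMixed G ζ sHi tLo s tOld t W) (H : Tilted ν sHi tLo β ρ σ C) (I : Innov P G ζ ν)
    (hW : ∀ n, Integrable (W n) P)
    (hi : Integrable (fun ω => |tOld ω - t ω| * Real.exp (β * W 0 ω)) P) (m n : ℕ) :
    |∫ ω, meanWait ν m (s ω) (t ω) (W n ω) ∂P - ∫ ω, meanWait ν (m + n) (s ω) (t ω) (W 0 ω) ∂P|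
      ≤ sens ρ σ C * ρ ^ m * σ ^ n * ∫ ω, |tOld ω - t ω| * Real.exp (β * W 0 ω) ∂P := by
  have := H.prob
  set B := ∫ ω, |tOld ω - t ω| * Real.exp (β * W 0 ω) ∂P with hBdef
  have hB : 0 ≤ B := integral_nonneg fun ω => mul_nonneg (abs_nonneg _) (Real.exp_pos _).le
  have hσ := H.σ_pos
  have hρ := H.ρ_pos
  have hA := H.sens_pos
  have hbox : ∀ ω, InBox sHi tLo (s ω) (t ω) := fun ω =>
    ⟨(L.1.box 0 ω).1, (L.1.box 0 ω).2.1, (L.2.2.2 ω).2⟩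
  induction n generalizing m with
  | zero => simp only [Nat.add_zero, sub_self, abs_zero]; positivity
  | succ n ih =>
    have hm : G 0 ≤ G n := G.mono (Nat.zero_le n)
    have ht : Measurable[G n] t := L.2.2.1.mono hm le_rfl
    have hs : Measurable[G n] s := L.1.meas_s n
    have hWn := L.1.measurable I n
    have hA : Measurable[G n] fun ω => (s ω, t ω, W n ω) := hs.prodMk (ht.prodMk hWn)
    have hΨ : Measurable fun z : (ℝ × ℝ × ℝ) × ℝ × ℝ =>
        meanWait ν m z.1.1 z.1.2.1 (lindley z.1.1 z.1.2.1 z.1.2.2 z.2) :=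
      measurable_meanWait_comp m measurable_fst.fst
        measurable_fst.snd.fst (measurable_lindley_comp measurable_fst.fst
        measurable_fst.snd.fst measurable_fst.snd.snd measurable_snd)
    have hint1 : Integrable (fun ω => meanWait ν m (s ω) (t ω)
        (lindley (s ω) (t ω) (W n ω) (ζ n ω))) P := by
      refine (((hW n).add ((I.integrable_comp n H.intV).const_mul sHi)).add
        (integrable_const (m * sHi))).mono'
        ((hΨ.comp ((hA.mono (G.le _) le_rfl).prodMk (I.measurable n))).aestronglyMeasurable) ?_
      filter_upwards [I.ae_nonneg H.nonneg] with ω hω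
      rw [Real.norm_eq_abs]
      have h1 := H.abs_meanWait_le m (hbox ω) (lindley_nonneg (s ω) (t ω) (W n ω) (ζ n ω))
      have h2 := H.lindley_le_add (hω n) (hbox ω) (L.1.nonneg n ω)
      simp only [Pi.add_apply]
      linarith
    have hint2 : Integrable (fun ω => meanWait ν m (s ω) (t ω) (W (n + 1) ω)) P := by
      refine ((hW (n + 1)).add (integrable_const (m * sHi))).mono'
        ((measurable_meanWait_comp m (hs.mono (G.le _) le_rfl) (ht.mono (G.le _) le_rfl)
          (L.1.measurable' I (n + 1))).aestronglyMeasurable) (ae_of_all _ fun ω => ?_)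
      rw [Real.norm_eq_abs]
      exact H.abs_meanWait_le m (hbox ω) (L.1.nonneg _ ω)
    have h1 : ∫ ω, meanWait ν m (s ω) (t ω) (lindley (s ω) (t ω) (W n ω) (ζ n ω)) ∂P
        = ∫ ω, meanWait ν (m + 1) (s ω) (t ω) (W n ω) ∂P := I.integral_freeze n hA hΨ hint1
    have hold := L.old_moment H I
      (measurable_abs_comp ((L.2.1).sub (L.2.2.1))) (fun ω => abs_nonneg _) hi n
    have hmo : Measurable[G n] fun ω => |tOld ω - t ω|
        * (oldInd ζ (W 0) tOld n ω * Real.exp (β * W n ω)) :=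
      (measurable_abs_comp ((L.2.1.mono hm le_rfl).sub ht)).mul
      ((measurable_oldInd I L.1.meas_zero L.2.1 n).mul ((L.1.measurable I n).const_mul _).exp)
    have hg2 : Measurable fun y : ℝ × ℝ => (y.1 + y.2) * Real.exp (β * dom sHi tLo y) :=
      (measurable_fst.add measurable_snd).mul ((measurable_dom sHi tLo).const_mul _).exp
    have i2 := (I.integrable_mul n hmo hold.1 hg2 H.intC).const_mul (ρ ^ m)
    -- Exchange of one step: step `n` is taken at the new rate instead of the mixed one. The two
    -- differ only where index `n` is old, which contributes ρ^n by `old_moment`; the `m` later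
    -- steps contract by ρ^m.
    have h3 : |∫ ω, meanWait ν m (s ω) (t ω) (W (n + 1) ω) ∂P
        - ∫ ω, meanWait ν (m + 1) (s ω) (t ω) (W n ω) ∂P| ≤ ρ ^ m * (ρ ^ n * B * C) := by
      rw [← h1, ← integral_sub hint2 hint1, ← Real.norm_eq_abs]
      refine (norm_integral_le_of_norm_le i2 ?_).trans ?_
      · filter_upwards [I.ae_nonneg H.nonneg] with ω hω
        rw [Real.norm_eq_abs]
        refine (H.abs_meanWait_sub_le m (hbox ω) (L.1.nonneg _ ω) (lindley_nonneg _ _ _ _)).trans ?_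
        rw [L.1.step n ω]
        have h4 := lindley_dist_mul_exp_le (hω n) H.β_pos.le (L.1.box n ω).2.1 (hbox ω).2.1
          (L.1.box n ω).2.2 (hbox ω).2.2 (le_refl (W n ω)) le_rfl
        have h5 : mixRate ζ (W 0) tOld t n ω - t ω
            = oldInd ζ (W 0) tOld n ω * (tOld ω - t ω) := by unfold mixRate; ring
        rw [h5, abs_mul, abs_of_nonneg (oldInd_mem ζ (W 0) tOld n ω).1] at h4
        refine (mul_le_mul_of_nonneg_right h4 (pow_nonneg hρ.le m)).trans_eq ?_
        simp; ring
      · rw [integral_const_mul, I.integral_mul n hmo hg2]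
        refine mul_le_mul_of_nonneg_left ?_ (pow_nonneg hρ.le m)
        exact mul_le_mul hold.2 H.leC (integral_nonneg_of_ae (by
          filter_upwards [H.nonneg] with y hy
          exact mul_nonneg (add_nonneg hy.1 hy.2) (Real.exp_pos _).le)) (by positivity)
    have h6 := ih (m + 1)
    rw [show m + 1 + n = m + (n + 1) by ring] at h6
    have h7 := H.sens_mul
    have h8 : ρ ^ m * (ρ ^ n * B * C) ≤ ρ ^ m * (σ ^ n * B * C) := by
      have := H.pow_le n; have := H.C_pos; gcongr
    -- The relation `sens_mul` once more; it leaves twice the room that the new error requires.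
    have e : sens ρ σ C * ρ ^ m * σ ^ (n + 1) * B
        = sens ρ σ C * ρ ^ (m + 1) * σ ^ n * B + 2 * (ρ ^ m * (σ ^ n * B * C)) := by
      rw [pow_succ, pow_succ]; linear_combination ρ ^ m * σ ^ n * B * h7
    have h9 : 0 ≤ ρ ^ m * (σ ^ n * B * C) := by have := H.C_pos; positivity
    rw [e]
    rw [abs_le] at h3 h6 ⊢
    constructor <;> linarith

end

end GIGIOne

namespace GIGIOne

/-! ### Inputs that are independent of a history -/

section

/-- The history `F` enlarged by the first inputs. -/
def inputFiltration {Ω : Type*} (F : MeasurableSpace Ω) [mΩ : MeasurableSpace Ω]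
    (hF : F ≤ mΩ) (ζ : ℕ → Ω → ℝ × ℝ)
    (hζ : ∀ n, Measurable (ζ n)) : Filtration ℕ mΩ where
  seq n := F ⊔ ⨆ i, ⨆ (_ : i < n), MeasurableSpace.comap (ζ i) inferInstance
  mono' := fun _ _ h => sup_le_sup le_rfl
    (iSup_mono fun _ => iSup_le fun hi => le_iSup_of_le (lt_of_lt_of_le hi h) le_rfl)
  le' := fun _ => sup_le hF (iSup_le fun i => iSup_le fun _ => (hζ i).comap_le)

lemma le_inputFiltration {Ω : Type*} (F : MeasurableSpace Ω) [mΩ : MeasurableSpace Ω]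
    (hF : F ≤ mΩ) (ζ : ℕ → Ω → ℝ × ℝ)
    (hζ : ∀ n, Measurable (ζ n)) (n : ℕ) : F ≤ inputFiltration F hF ζ hζ n := le_sup_left

/-- The history is adjoined to the inputs as one more member of an independent family, with index
`none`. Independence of an input from the history together with the earlier inputs is then
independence over disjoint index sets. -/
lemma iIndep_option_elim {Ω : Type*} {F : MeasurableSpace Ω} [mΩ : MeasurableSpace Ω]
    {P : Measure Ω} {ζ : ℕ → Ω → ℝ × ℝ}
    (hind : iIndepFun ζ P)
    (hpast : Indep (MeasurableSpace.comap (fun ω n => ζ n ω) inferInstance) F P) :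
    iIndep (fun o : Option ℕ => o.elim F fun n => MeasurableSpace.comap (ζ n) inferInstance) P := by
  rw [iIndep_iff]
  intro S f hf
  have hseq : ∀ n, MeasurableSpace.comap (ζ n) inferInstance
      ≤ MeasurableSpace.comap (fun ω n => ζ n ω) inferInstance := by
    intro n
    rw [show ζ n = (fun z : ℕ → ℝ × ℝ => z n) ∘ (fun ω n => ζ n ω) from rfl,
      ← MeasurableSpace.comap_comp]
    exact MeasurableSpace.comap_mono (measurable_pi_apply n).comap_le
  have hind' : ∀ T : Finset ℕ, (∀ i ∈ T, MeasurableSet[MeasurableSpace.comap (ζ i) inferInstance]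
      (f (some i))) → P (⋂ i ∈ T, f (some i)) = ∏ i ∈ T, P (f (some i)) :=
    fun T hT => (iIndep_iff _ _).1 hind.iIndep T hT
  have hsome : ∀ i ∈ S.eraseNone,
      MeasurableSet[MeasurableSpace.comap (ζ i) inferInstance] (f (some i)) :=
    fun i hi => hf (some i) (Finset.mem_eraseNone.1 hi)
  have hB : MeasurableSet[MeasurableSpace.comap (fun ω n => ζ n ω) inferInstance]
      (⋂ i ∈ S.eraseNone, f (some i)) :=
    Finset.measurableSet_biInter _ fun i hi => hseq i _ (hsome i hi)
  by_cases hn : none ∈ S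
  · have e : S = Finset.insertNone S.eraseNone := by
      rw [Finset.insertNone_eraseNone, Finset.insert_eq_of_mem hn]
    have e1 : ⋂ i ∈ S, f i = (⋂ i ∈ S.eraseNone, f (some i)) ∩ f none := by
      ext ω
      simp only [Set.mem_iInter, Set.mem_inter_iff, Finset.mem_eraseNone]
      refine ⟨fun h => ⟨fun i hi => h _ hi, h _ hn⟩, fun h i hi => ?_⟩
      cases i with
      | none => exact h.2
      | some i => exact h.1 i hi
    have e2 : ∏ i ∈ S, P (f i) = P (f none) * ∏ i ∈ S.eraseNone, P (f (some i)) := by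
      conv_lhs => rw [e]
      exact Finset.prod_insertNone _ _
    rw [e1, e2, (Indep_iff _ _ _).1 hpast _ _ hB (hf none hn), hind' _ hsome, mul_comm]
  · have e : S = S.eraseNone.map Function.Embedding.some := by
      rw [Finset.map_some_eraseNone, Finset.erase_eq_of_notMem hn]
    have e1 : ⋂ i ∈ S, f i = ⋂ i ∈ S.eraseNone, f (some i) := by
      ext ω
      simp only [Set.mem_iInter, Finset.mem_eraseNone]
      refine ⟨fun h i hi => h _ hi, fun h i hi => ?_⟩
      cases i with
      | none => exact absurd hi hn
      | some i => exact h i hi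
    have e2 : ∏ i ∈ S, P (f i) = ∏ i ∈ S.eraseNone, P (f (some i)) := by
      conv_lhs => rw [e]
      exact Finset.prod_map _ _ _
    rw [e1, e2, hind' _ hsome]

lemma innov_inputFiltration {Ω : Type*} {F : MeasurableSpace Ω} [mΩ : MeasurableSpace Ω]
    {P : Measure Ω} (hF : F ≤ mΩ)
    {ζ : ℕ → Ω → ℝ × ℝ} (hζ : ∀ n, Measurable (ζ n)) {ν : Measure (ℝ × ℝ)}
    (hlaw : ∀ n, P.map (ζ n) = ν) (hind : iIndepFun ζ P)
    (hpast : Indep (MeasurableSpace.comap (fun ω n => ζ n ω) inferInstance) F P) :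
    Innov P (inputFiltration F hF ζ hζ) ζ ν where
  meas n := by
    refine Measurable.mono (comap_measurable (ζ n)) ?_ le_rfl
    exact le_sup_of_le_right (le_iSup_of_le n (le_iSup_of_le (Nat.lt_succ_self n) le_rfl))
  law := hlaw
  indep n := by
    have hle : ∀ o : Option ℕ, (o.elim F fun n => MeasurableSpace.comap (ζ n) inferInstance) ≤ mΩ :=
      by rintro (_ | n)
         · exact hF
         · exact (hζ n).comap_le
    have hd : Disjoint ({some n} : Set (Option ℕ)) {o | ∀ i, o = some i → i < n} := by
      rw [Set.disjoint_singleton_left]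
      intro h
      exact lt_irrefl _ (h n rfl)
    have h := indep_iSup_of_disjoint hle (iIndep_option_elim hind hpast) hd
    refine indep_of_indep_of_le_left (indep_of_indep_of_le_right h ?_) ?_
    · refine sup_le ?_ (iSup_le fun i => iSup_le fun hi => ?_)
      · exact le_iSup₂_of_le none (by simp) le_rfl
      · exact le_iSup₂_of_le (some i) (by rintro j hj; cases hj; exact hi) le_rfl
    · exact le_iSup₂_of_le (some n) rfl le_rfl

end

/-! ### Exponential moment bounds from the light tails -/

/-- Jensen's inequality for fractional powers. -/
lemma integral_rpow_le {α : Type*} [MeasurableSpace α] {P : Measure α} [IsProbabilityMeasure P]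
    {Y : α → ℝ} (hY : ∀ x, 0 < Y x) (hi : Integrable Y P) {r : ℝ} (hr : 0 ≤ r) (hr1 : r ≤ 1) :
    Integrable (fun x => Y x ^ r) P ∧ ∫ x, Y x ^ r ∂P ≤ (∫ x, Y x ∂P) ^ r := by
  set c := ∫ x, Y x ∂P with hc
  have hcpos : 0 < c := by
    rw [hc, integral_pos_iff_support_of_nonneg (fun x => (hY x).le) hi]
    have : Function.support Y = Set.univ := Set.eq_univ_of_forall fun x => (hY x).ne'
    rw [this]; simp
  -- Bernoulli's inequality is the tangent of the concave power at the mean `c`; the bracket on the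
  -- right has mean 1.
  have hle : ∀ x, Y x ^ r ≤ c ^ r * (1 + r * (Y x / c - 1)) := by
    intro x
    have h0 : 0 < Y x / c := div_pos (hY x) hcpos
    have h1 := rpow_one_add_le_one_add_mul_self (s := Y x / c - 1) (by linarith) hr hr1
    have h2 : Y x ^ r = c ^ r * (1 + (Y x / c - 1)) ^ r := by
      rw [← Real.mul_rpow hcpos.le (by linarith)]
      congr 1; field_simp; ring
    rw [h2]
    exact mul_le_mul_of_nonneg_left h1 (Real.rpow_nonneg hcpos.le r)
  have hi1 : Integrable (fun x => c ^ r * (1 + r * (Y x / c - 1))) P :=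
    ((integrable_const 1).add (((hi.div_const c).sub (integrable_const 1)).const_mul r)).const_mul _
  have hi2 : Integrable (fun x => Y x ^ r) P := by
    refine hi1.mono' (hi.aemeasurable.pow_const r).aestronglyMeasurable (ae_of_all _ fun x => ?_)
    rw [Real.norm_eq_abs, abs_of_nonneg (Real.rpow_nonneg (hY x).le r)]
    exact hle x
  refine ⟨hi2, (integral_mono hi2 hi1 hle).trans_eq ?_⟩
  have hi3 : Integrable (fun x => r * (Y x / c - 1)) P :=
    ((hi.div_const c).sub (integrable_const 1)).const_mul r
  rw [integral_const_mul, integral_add (integrable_const 1) hi3, integral_const_mul,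
    integral_sub (hi.div_const c) (integrable_const 1), integral_div, ← hc, div_self hcpos.ne']
  simp

section

variable {M : Model} {η θ a γ₀ : ℝ}

lemma Model.Standing.integrableU (hM : M.Standing) : Integrable (fun u : ℝ => u) M.lawU := by
  by_contra h
  have := hM.meanU
  rw [integral_undef h] at this
  norm_num at this

lemma Model.Standing.integrableV (hM : M.Standing) : Integrable (fun v : ℝ => v) M.lawV := by
  by_contra h
  have := hM.meanV
  rw [integral_undef h] at this
  norm_num at this

lemma Model.Standing.lam_pLo_pos (hM : M.Standing) : 0 < M.lam M.pLo :=
  hM.lam_pos _ ⟨le_rfl, hM.p_le⟩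

lemma Model.Standing.muLo_pos (hM : M.Standing) (hS : M.Stable) : 0 < M.muLo :=
  hM.lam_pLo_pos.trans hS.stable

lemma Model.ae_nonneg_prod (hM : M.Standing) :
    ∀ᵐ y ∂(M.lawU.prod M.lawV), 0 ≤ y.1 ∧ 0 ≤ y.2 := by
  have := hM.probU
  have := hM.probV
  have h1 := (measurePreserving_fst (μ := M.lawU) (ν := M.lawV)).quasiMeasurePreserving.ae
    hM.nonnegU
  have h2 := (measurePreserving_snd (μ := M.lawU) (ν := M.lawV)).quasiMeasurePreserving.ae
    hM.nonnegV
  filter_upwards [h1, h2] with y h1 h2 using ⟨h1, h2⟩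

/-- The dominating increment has an exponential moment smaller than one. -/
lemma Model.LightTail.integral_exp_dom_lt_one (hL : M.LightTail η θ a γ₀) (hM : M.Standing)
    (hS : M.Stable) :
    Integrable (fun y => Real.exp (θ * M.lam M.pLo * dom (1 / M.muLo) (1 / M.lam M.pLo) y))
        (M.lawU.prod M.lawV) ∧
      ∫ y, Real.exp (θ * M.lam M.pLo * dom (1 / M.muLo) (1 / M.lam M.pLo) y)
        ∂(M.lawU.prod M.lawV) < 1 := by
  have := hM.probU
  have := hM.probV
  have hl := hM.lam_pLo_pos
  have hmu := hM.muLo_pos hS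
  set l := M.lam M.pLo with hldef
  set r := l / M.muLo with hr
  have hr0 : 0 < r := div_pos hl hmu
  have hr1 : r < 1 := (div_lt_one hmu).2 hS.stable
  have hθ := hL.theta_pos
  have hη := hL.eta_pos
  -- The factor θ λ(p̲) makes the coefficient of U exactly -θ, where the assumption bounds the
  -- cumulant. The coefficient of V is then rθ with r = λ(p̲)/μ̲ < 1, and Jensen's inequality
  -- reduces it to the cumulant at θ.
  have e : (fun y : ℝ × ℝ => Real.exp (θ * l * dom (1 / M.muLo) (1 / l) y))
      = fun y => Real.exp (-θ * y.1) * Real.exp (θ * y.2) ^ r := by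
    funext y
    rw [← Real.exp_mul, ← Real.exp_add]
    congr 1
    unfold dom
    rw [hr]; field_simp; ring
  have hV : Integrable (fun v => Real.exp (θ * v)) M.lawV := by
    refine (hL.expV.add (integrable_const 1)).mono' (by fun_prop) ?_
    filter_upwards [hM.nonnegV] with v hv
    rw [Real.norm_eq_abs, abs_of_pos (Real.exp_pos _)]
    have : Real.exp (θ * v) ≤ Real.exp (η * v) :=
      Real.exp_le_exp.2 (mul_le_mul_of_nonneg_right (by linarith [hL.theta_lt]) hv)
    simp only [Pi.add_apply]; linarith
  have hU : Integrable (fun u => Real.exp (-θ * u)) M.lawU := by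
    refine (integrable_const (1 : ℝ)).mono' (by fun_prop) ?_
    filter_upwards [hM.nonnegU] with u hu
    rw [Real.norm_eq_abs, abs_of_pos (Real.exp_pos _)]
    exact Real.exp_le_one_iff.2 (by nlinarith)
  have hJ := integral_rpow_le (fun v => Real.exp_pos (θ * v)) hV hr0.le hr1.le
  have hmV : 0 < mgf id M.lawV θ := mgf_pos hV
  have hmU : 0 < mgf id M.lawU (-θ) := mgf_pos hU
  rw [e]
  refine ⟨hU.mul_prod hJ.1, ?_⟩
  rw [integral_prod_mul (fun u => Real.exp (-θ * u)) (fun v => Real.exp (θ * v) ^ r)]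
  have h1 : ∫ u, Real.exp (-θ * u) ∂M.lawU = Real.exp (cgf id M.lawU (-θ)) := by
    rw [cgf, Real.exp_log hmU]; rfl
  have h2 : (∫ v, Real.exp (θ * v) ∂M.lawV) = Real.exp (cgf id M.lawV θ) := by
    rw [cgf, Real.exp_log hmV]; rfl
  have hJ2 := hJ.2
  rw [h2, ← Real.exp_mul] at hJ2
  rw [h1]
  refine (mul_le_mul_of_nonneg_left hJ2 (Real.exp_pos _).le).trans_lt ?_
  rw [← Real.exp_add, Real.exp_lt_one_iff]
  -- The upper bound on `a` rearranged. With it the total exponent is below θ (r (1 + a) - (1 - a))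
  -- - γ₀ (1 + r) < 0.
  have h3 : r * (1 + a) < 1 - a := by
    have h4 := hL.a_lt
    rw [lt_div_iff₀ (by linarith)] at h4
    rw [hr, div_mul_eq_mul_div, div_lt_iff₀ hmu]
    linarith
  have h5 := hL.cgfU
  have h6 := mul_le_mul_of_nonneg_right hL.cgfV.le hr0.le
  have h7 := hL.gamma_pos
  have h8 := mul_lt_mul_of_pos_left h3 hθ
  nlinarith [mul_pos h7 hr0]

lemma id_le_inv_mul_exp {c x : ℝ} (hc : 0 < c) : x ≤ 1 / c * Real.exp (c * x) := by
  have := Real.add_one_le_exp (c * x)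
  rw [div_mul_eq_mul_div, one_mul, le_div_iff₀ hc]
  linarith

/-- The light tails provide the exponential moment bounds, with an arbitrarily small exponent. -/
lemma Model.LightTail.exists_tilted (hL : M.LightTail η θ a γ₀) (hM : M.Standing)
    (hS : M.Stable) {ε : ℝ} (hε : 0 < ε) :
    ∃ β ρ σ C, Tilted (M.lawU.prod M.lawV) (1 / M.muLo) (1 / M.lam M.pLo) β ρ σ C ∧
      2 * β ≤ ε := by
  have := hM.probU
  have := hM.probV
  have hl := hM.lam_pLo_pos
  have hmu := hM.muLo_pos hS
  obtain ⟨hYi, hY1⟩ := hL.integral_exp_dom_lt_one hM hS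
  set ν := M.lawU.prod M.lawV with hν
  set X := dom (1 / M.muLo) (1 / M.lam M.pLo) with hX
  have hθ := hL.theta_pos
  have hη := hL.eta_pos
  set b := θ * M.lam M.pLo with hb
  have hb0 : 0 < b := mul_pos hθ hl
  set q := ∫ y, Real.exp (b * X y) ∂ν with hq
  have hq0 : 0 < q := by
    rw [hq, integral_pos_iff_support_of_nonneg (fun x => (Real.exp_pos _).le) hYi]
    have : Function.support (fun y => Real.exp (b * X y)) = Set.univ :=
      Set.eq_univ_of_forall fun x => (Real.exp_pos _).ne'
    rw [this]; simp
  -- With κ ≤ 1/2 both κ and 2κ are admissible powers in Jensen's inequality, for the moments of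
  -- order β = κ b and 2β. The other bound gives 2β ≤ ε, so that the assumed exponential moment of
  -- the initial waiting time suffices.
  set κ := min (1 / 2) (ε / (2 * b)) with hκ
  have hκ0 : 0 < κ := lt_min (by norm_num) (by positivity)
  have hκ1 : κ ≤ 1 / 2 := min_le_left _ _
  have hκ2 : 2 * (κ * b) ≤ ε := by
    have := min_le_right (1 / 2) (ε / (2 * b))
    rw [← hκ, le_div_iff₀ (by positivity)] at this
    linarith
  set ρ := q ^ κ with hρ
  have hρ0 : 0 < ρ := Real.rpow_pos_of_pos hq0 _
  have hρ1 : ρ < 1 := Real.rpow_lt_one hq0.le hY1 hκ0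
  have e1 : (fun y => Real.exp (κ * b * X y)) = fun y => Real.exp (b * X y) ^ κ := by
    funext y; rw [← Real.exp_mul]; congr 1; ring
  have e2 : (fun y => Real.exp (2 * (κ * b) * X y)) = fun y => Real.exp (b * X y) ^ (2 * κ) := by
    funext y; rw [← Real.exp_mul]; congr 1; ring
  have j1 := integral_rpow_le (fun y => Real.exp_pos (b * X y)) hYi hκ0.le (by linarith)
  have j2 := integral_rpow_le (r := 2 * κ) (fun y => Real.exp_pos (b * X y)) hYi (by linarith)
    (by linarith)
  have hXm : Measurable X := measurable_dom _ _
  have hexpV : Integrable (fun v => Real.exp (η / 2 * v)) M.lawV := by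
    refine (hL.expV.add (integrable_const 1)).mono' (by fun_prop) ?_
    filter_upwards [hM.nonnegV] with v hv
    rw [Real.norm_eq_abs, abs_of_pos (Real.exp_pos _)]
    have : Real.exp (η / 2 * v) ≤ Real.exp (η * v) :=
      Real.exp_le_exp.2 (mul_le_mul_of_nonneg_right (by linarith) hv)
    simp only [Pi.add_apply]; linarith
  have hdom : Integrable (fun y : ℝ × ℝ => y.1 * Real.exp (η / 2 * y.2)
      + 1 * (1 / (η / 2) * Real.exp (η * y.2))) ν :=
    (hM.integrableU.mul_prod hexpV).add
      ((integrable_const 1).mul_prod (hL.expV.const_mul _))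
  have hintC : Integrable (fun y => (y.1 + y.2) * Real.exp (κ * b * X y)) ν := by
    refine hdom.mono' (((measurable_fst.add measurable_snd).mul
      (hXm.const_mul _).exp).aestronglyMeasurable) ?_
    filter_upwards [Model.ae_nonneg_prod hM] with y hy
    rw [Real.norm_eq_abs, abs_of_nonneg (mul_nonneg (add_nonneg hy.1 hy.2) (Real.exp_pos _).le)]
    -- Only half of the exponent η is spent here, thanks to θ < η/2; the other half absorbs the
    -- factor `y.2`.
    have h1 : κ * b * X y ≤ η / 2 * y.2 := by
      have h2 : κ * b * X y = κ * (θ * (M.lam M.pLo / M.muLo * y.2 - y.1)) := by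
        rw [hX, hb]; unfold dom; field_simp
      have h3 : M.lam M.pLo / M.muLo ≤ 1 := ((div_lt_one hmu).2 hS.stable).le
      have h4 := mul_le_mul_of_nonneg_right h3 hy.2
      have h5 : θ * (M.lam M.pLo / M.muLo * y.2 - y.1) ≤ θ * y.2 :=
        mul_le_mul_of_nonneg_left (by linarith [hy.1]) hθ.le
      have h6 : κ * (θ * (M.lam M.pLo / M.muLo * y.2 - y.1)) ≤ κ * (θ * y.2) :=
        mul_le_mul_of_nonneg_left h5 hκ0.le
      have h7 : κ * (θ * y.2) ≤ 1 * (θ * y.2) :=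
        mul_le_mul_of_nonneg_right (by linarith) (mul_nonneg hθ.le hy.2)
      have h8 := mul_le_mul_of_nonneg_right hL.theta_lt.le hy.2
      linarith
    have h2 := Real.exp_le_exp.2 h1
    have h3 : y.2 * Real.exp (η / 2 * y.2) ≤ 1 / (η / 2) * Real.exp (η * y.2) := by
      have := mul_le_mul_of_nonneg_right (id_le_inv_mul_exp (x := y.2) (half_pos hη))
        (Real.exp_pos (η / 2 * y.2)).le
      rwa [mul_assoc, ← Real.exp_add, show η / 2 * y.2 + η / 2 * y.2 = η * y.2 by ring] at this
    have h4 := mul_le_mul_of_nonneg_left h2 (add_nonneg hy.1 hy.2)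
    linarith
  refine ⟨κ * b, ρ, (1 + ρ) / 2, |∫ y, (y.1 + y.2) * Real.exp (κ * b * X y) ∂ν| + 1,
    ⟨inferInstance, Model.ae_nonneg_prod hM, ?_, ?_, ?_, ?_, by positivity, by positivity,
      by positivity, hρ0, by linarith, by linarith, by positivity, ?_, ?_, ?_, ?_, hintC, ?_⟩, hκ2⟩
  · exact hM.integrableU.comp_fst _
  · exact hM.integrableV.comp_snd _
  · have := integral_fun_fst (μ := M.lawU) (ν := M.lawV) (fun u : ℝ => u)
    simpa [hM.meanU] using this
  · have := integral_fun_snd (μ := M.lawU) (ν := M.lawV) (fun u : ℝ => u)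
    simpa [hM.meanV] using this
  · rw [e1]; exact j1.1
  · rw [e1]; exact j1.2
  · rw [e2]; exact j2.1
  · rw [e2]
    -- As q < 1, the moment of order 2β is at most q^{2κ} ≤ q^κ = ρ, so one constant serves both
    -- orders.
    refine j2.2.trans (Real.rpow_le_rpow_of_exponent_ge hq0 hY1.le (by linarith))
  · exact (le_abs_self _).trans (by linarith)

end

end GIGIOne

namespace GIGIOne

set_option linter.unusedSectionVars false

/-! ### Little's law -/

lemma ofReal_integral_le_lintegral {α : Type*} [MeasurableSpace α] {P : Measure α} {f : α → ℝ}
    (hf : Integrable f P) : ENNReal.ofReal (∫ x, f x ∂P) ≤ ∫⁻ x, ENNReal.ofReal (f x) ∂P := by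
  have h1 : ∫ x, f x ∂P ≤ ∫ x, max (f x) 0 ∂P :=
    integral_mono hf hf.pos_part fun x => le_max_left _ _
  refine (ENNReal.ofReal_le_ofReal h1).trans ?_
  rw [ofReal_integral_eq_lintegral_ofReal hf.pos_part (ae_of_all _ fun x => le_max_right _ _)]
  refine lintegral_mono fun x => ?_
  rw [ENNReal.ofReal_max]
  simp

lemma lintegral_le_ofReal_integral {α : Type*} [MeasurableSpace α] {P : Measure α}
    {g : α → ℝ≥0∞} {f : α → ℝ} (hf : Integrable f P) (h0 : ∀ᵐ x ∂P, 0 ≤ f x)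
    (hg : ∀ᵐ x ∂P, g x ≤ ENNReal.ofReal (f x)) :
    ∫⁻ x, g x ∂P ≤ ENNReal.ofReal (∫ x, f x ∂P) := by
  rw [ofReal_integral_eq_lintegral_ofReal hf h0]
  exact lintegral_mono_ae hg

lemma abs_sum_meanWait_sub_le {ν : Measure (ℝ × ℝ)} {sHi tLo β ρ σ C : ℝ}
    (H : Tilted ν sHi tLo β ρ σ C) {s t : ℝ} (hx : InBox sHi tLo s t) (m : ℕ) :
    |∑ n ∈ Finset.range m, meanWait ν n s t 0 - m * steadyWait ν s t|
      ≤ sHi * C / (1 - ρ) ^ 2 := by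
  have h1ρ : 0 < 1 - ρ := sub_pos.2 (H.ρ_lt.trans H.σ_lt)
  have hs := H.sHi_pos
  have hC := H.C_pos
  have e : ∑ n ∈ Finset.range m, meanWait ν n s t 0 - m * steadyWait ν s t
      = ∑ n ∈ Finset.range m, (meanWait ν n s t 0 - steadyWait ν s t) := by simp
  rw [e]
  refine (Finset.abs_sum_le_sum_abs _ _).trans ?_
  have h : ∀ n ∈ Finset.range m, |meanWait ν n s t 0 - steadyWait ν s t|
      ≤ sHi * C / (1 - ρ) * ρ ^ n := fun n _ => by
    rw [abs_sub_comm]; exact H.abs_steadyWait_sub_le n hx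
  refine (Finset.sum_le_sum h).trans ?_
  rw [← Finset.mul_sum]
  refine (mul_le_mul_of_nonneg_left
    (geom_sum_range_le H.ρ_pos.le (H.ρ_lt.trans H.σ_lt) m) (by positivity)).trans_eq ?_
  field_simp

lemma sq_le_exp {β x : ℝ} (hβ : 0 < β) (hx : 0 ≤ x) :
    x ^ 2 ≤ 1 / (2 * β ^ 2) * Real.exp (2 * β * x) := by
  have := Real.quadratic_le_exp_of_nonneg (show 0 ≤ 2 * β * x by positivity)
  rw [div_mul_eq_mul_div, one_mul, le_div_iff₀ (by positivity)]
  nlinarith [mul_nonneg hβ.le hx]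

section

variable {Ω : Type*} [mΩ : MeasurableSpace Ω] {P : Measure Ω} [IsProbabilityMeasure P]
  {G : Filtration ℕ mΩ} {ζ : ℕ → Ω → ℝ × ℝ} {ν : Measure (ℝ × ℝ)} {sHi tLo β ρ σ C : ℝ}

lemma arrSum_succ (ζ : ℕ → Ω → ℝ × ℝ) (n : ℕ) (ω : Ω) :
    arrSum ζ (n + 1) ω = arrSum ζ n ω + (ζ n ω).1 := Finset.sum_range_succ _ _

lemma arrSum_nonneg {ω : Ω} (h : ∀ n, 0 ≤ (ζ n ω).1 ∧ 0 ≤ (ζ n ω).2) (n : ℕ) :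
    0 ≤ arrSum ζ n ω := Finset.sum_nonneg fun j _ => (h j).1

/-- Orthogonality of the centred increments: the cross term has mean zero because the new input is
independent of the past sum. -/
lemma arrSum_variance (H : Tilted ν sHi tLo β ρ σ C) (I : Innov P G ζ ν)
    (hU2 : Integrable (fun y : ℝ × ℝ => y.1 ^ 2) ν) (n : ℕ) :
    Integrable (fun ω => arrSum ζ n ω - n) P ∧ Integrable (fun ω => (arrSum ζ n ω - n) ^ 2) P ∧
      ∫ ω, (arrSum ζ n ω - n) ^ 2 ∂P = n * ∫ y : ℝ × ℝ, (y.1 - 1) ^ 2 ∂ν := by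
  have := H.prob
  have hg1 : Measurable fun y : ℝ × ℝ => y.1 - 1 := by fun_prop
  have hg2 : Measurable fun y : ℝ × ℝ => (y.1 - 1) ^ 2 := by fun_prop
  have hi1 : Integrable (fun y : ℝ × ℝ => y.1 - 1) ν := H.intU.sub (integrable_const 1)
  have hi2 : Integrable (fun y : ℝ × ℝ => (y.1 - 1) ^ 2) ν := by
    have e : (fun y : ℝ × ℝ => (y.1 - 1) ^ 2) = fun y => y.1 ^ 2 - 2 * y.1 + 1 := by
      funext y; ring
    rw [e]
    exact (hU2.sub (H.intU.const_mul 2)).add (integrable_const 1)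
  have hm0 : ∫ y : ℝ × ℝ, (y.1 - 1) ∂ν = 0 := by
    rw [integral_sub H.intU (integrable_const 1), H.meanU]; simp
  induction n with
  | zero => simp [arrSum]
  | succ n ih =>
    have hX : Measurable[G n] fun ω => 2 * (arrSum ζ n ω - n) :=
      ((measurable_arrSum I n).sub_const _).const_mul 2
    have e1 : (fun ω => arrSum ζ (n + 1) ω - (n + 1 : ℕ))
        = fun ω => (arrSum ζ n ω - n) + ((ζ n ω).1 - 1) := by
      funext ω; rw [arrSum_succ]; push_cast; ring
    have e2 : (fun ω => (arrSum ζ (n + 1) ω - (n + 1 : ℕ)) ^ 2)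
        = fun ω => (arrSum ζ n ω - n) ^ 2 + 2 * (arrSum ζ n ω - n) * ((ζ n ω).1 - 1)
          + ((ζ n ω).1 - 1) ^ 2 := by
      funext ω; rw [arrSum_succ]; push_cast; ring
    have k1 := I.integrable_mul n hX (ih.1.const_mul 2) hg1 hi1
    have k2 := I.integral_mul n hX hg1
    have k3 := I.integrable_comp n hi2
    have k4 := I.integral_comp n hg2
    have k5 : Integrable (fun ω => (arrSum ζ n ω - n) ^ 2
        + 2 * (arrSum ζ n ω - n) * ((ζ n ω).1 - 1)) P := ih.2.1.add k1
    refine ⟨?_, ?_, ?_⟩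
    · rw [e1]; exact ih.1.add (I.integrable_comp n hi1)
    · rw [e2]; exact k5.add k3
    · rw [e2, integral_add k5 k3, integral_add ih.2.1 k1, k2, k4, hm0, ih.2.2]
      push_cast; ring

lemma integral_exp_neg_arrSum (H : Tilted ν sHi tLo β ρ σ C) (I : Innov P G ζ ν) {x : ℝ}
    (hx : 0 ≤ x) (n : ℕ) :
    Integrable (fun ω => Real.exp (-x * arrSum ζ n ω)) P ∧
      ∫ ω, Real.exp (-x * arrSum ζ n ω) ∂P = (∫ y : ℝ × ℝ, Real.exp (-x * y.1) ∂ν) ^ n := by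
  have := H.prob
  have hg : Measurable fun y : ℝ × ℝ => Real.exp (-x * y.1) := by fun_prop
  have hi : Integrable (fun y : ℝ × ℝ => Real.exp (-x * y.1)) ν := by
    refine (integrable_const (1 : ℝ)).mono' hg.aestronglyMeasurable ?_
    filter_upwards [H.nonneg] with y hy
    rw [Real.norm_eq_abs, abs_of_pos (Real.exp_pos _)]
    exact Real.exp_le_one_iff.2 (by nlinarith [hy.1])
  induction n with
  | zero => simp [arrSum]
  | succ n ih =>
    have hX : Measurable[G n] fun ω => Real.exp (-x * arrSum ζ n ω) :=
      ((measurable_arrSum I n).const_mul _).exp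
    have e : (fun ω => Real.exp (-x * arrSum ζ (n + 1) ω))
        = fun ω => Real.exp (-x * arrSum ζ n ω) * Real.exp (-x * (ζ n ω).1) := by
      funext ω; rw [arrSum_succ, ← Real.exp_add]; congr 1; ring
    rw [e]
    exact ⟨I.integrable_mul n hX ih.1 hg hi, by rw [I.integral_mul n hX hg, ih.2, pow_succ]⟩

lemma exp_neg_le_quadratic {x : ℝ} (hx : 0 ≤ x) : Real.exp (-x) ≤ 1 - x + x ^ 2 / 2 := by
  have h1 := Real.quadratic_le_exp_of_nonneg hx
  rw [Real.exp_neg, inv_le_comm₀ (Real.exp_pos x) (by nlinarith [sq_nonneg (x - 1)])]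
  refine le_trans ?_ h1
  rw [inv_le_iff_one_le_mul₀ (by nlinarith [sq_nonneg (x - 1)])]
  nlinarith [sq_nonneg x, sq_nonneg (x ^ 2)]

/-- Chernoff bound for early arrivals. -/
lemma exists_chernoff (H : Tilted ν sHi tLo β ρ σ C)
    (hU2 : Integrable (fun y : ℝ × ℝ => y.1 ^ 2) ν) {ε : ℝ} (hε : 0 < ε) :
    ∃ x q : ℝ, 0 < x ∧ 0 < q ∧ q < 1 ∧
      Real.exp (x / (1 + ε)) * ∫ y : ℝ × ℝ, Real.exp (-x * y.1) ∂ν ≤ q ^ 2 := by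
  have := H.prob
  set m := ∫ y : ℝ × ℝ, y.1 ^ 2 ∂ν with hm
  have hm0 : 0 ≤ m := integral_nonneg fun y => sq_nonneg _
  -- Chosen so that x m ≤ ε/(1 + ε): the quadratic term then uses at most half of the linear gain x
  -- ε/(1 + ε).
  set x := ε / ((1 + ε) * (m + 1)) with hx
  have hx0 : 0 < x := by positivity
  have h1 : ∫ y : ℝ × ℝ, Real.exp (-x * y.1) ∂ν ≤ 1 - x + x ^ 2 / 2 * m := by
    have hi : Integrable (fun y : ℝ × ℝ => 1 - x * y.1 + x ^ 2 / 2 * y.1 ^ 2) ν :=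
      ((integrable_const 1).sub (H.intU.const_mul x)).add (hU2.const_mul _)
    have hi' : Integrable (fun y : ℝ × ℝ => 1 - x * y.1) ν :=
      (integrable_const 1).sub (H.intU.const_mul x)
    have h2 : ∫ y : ℝ × ℝ, Real.exp (-x * y.1) ∂ν
        ≤ ∫ y : ℝ × ℝ, (1 - x * y.1 + x ^ 2 / 2 * y.1 ^ 2) ∂ν := by
      refine integral_mono_of_nonneg (ae_of_all _ fun y => (Real.exp_pos _).le) hi ?_
      filter_upwards [H.nonneg] with y hy
      have := exp_neg_le_quadratic (mul_nonneg hx0.le hy.1)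
      rw [neg_mul]
      refine this.trans_eq ?_
      ring
    refine h2.trans_eq ?_
    rw [integral_add hi' (hU2.const_mul _), integral_sub (integrable_const 1)
      (H.intU.const_mul x), integral_const_mul, integral_const_mul, H.meanU, ← hm]
    simp
  have h2 : 1 - x + x ^ 2 / 2 * m ≤ Real.exp (-x + x ^ 2 / 2 * m) := by
    have := Real.add_one_le_exp (-x + x ^ 2 / 2 * m)
    linarith
  -- Half the gain is left in the exponent; `q` is defined by a quarter of it, since the bound is
  -- stated as q². One factor q pays later for splitting a product of the sojourn time and an
  -- indicator.
  refine ⟨x, Real.exp (-(x * ε / (1 + ε) / 4)), hx0, Real.exp_pos _, ?_, ?_⟩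
  · rw [Real.exp_lt_one_iff]
    have : 0 < x * ε / (1 + ε) / 4 := by positivity
    linarith
  · refine (mul_le_mul_of_nonneg_left (h1.trans h2) (Real.exp_pos _).le).trans ?_
    rw [← Real.exp_add, ← Real.exp_nat_mul]
    refine Real.exp_le_exp.2 ?_
    have h3 : x * m ≤ ε / (1 + ε) := by
      rw [hx, div_mul_eq_mul_div, div_le_div_iff₀ (by positivity) (by positivity)]
      nlinarith [mul_nonneg hε.le hm0]
    have h4 : 1 / (1 + ε) = 1 - ε / (1 + ε) := by field_simp; ring
    have h5 := mul_le_mul_of_nonneg_left h3 hx0.le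
    have e1 : x / (1 + ε) = x - x * (ε / (1 + ε)) := by
      rw [div_eq_mul_one_div, h4]; ring
    have e2 : x * ε / (1 + ε) = x * (ε / (1 + ε)) := by ring
    rw [e1, e2]
    push_cast
    nlinarith

/-- Time that customer `n` spends in the system. -/
noncomputable def sojourn (ζ : ℕ → Ω → ℝ × ℝ) (s : ℝ) (W : ℕ → Ω → ℝ) (n : ℕ) (ω : Ω) : ℝ :=
  W n ω + s * (ζ n ω).2

/-- Time that customer `n` spends in the system before time `x`. -/
noncomputable def sojournUpTo (ζ : ℕ → Ω → ℝ × ℝ) (s t : ℝ) (W : ℕ → Ω → ℝ) (x : ℝ) (n : ℕ)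
    (ω : Ω) : ℝ≥0∞ :=
  volume (Set.Ico (t * arrSum ζ n ω) (t * arrSum ζ n ω + sojourn ζ s W n ω) ∩ Set.Ioc 0 x)

variable {s t : ℝ} {W : ℕ → Ω → ℝ}

/-- For an empty start and constant parameters `meanWait` is the mean along the path. The uniform
moment of order 2β bounds the second moments independently of the customer. -/
lemma sojourn_moments (H : Tilted ν sHi tLo β ρ σ C) (I : Innov P G ζ ν)
    (L : IsLindley G ζ sHi tLo (fun _ _ => s) (fun _ _ => t) W) (hW0 : ∀ ω, W 0 ω = 0)
    (hV2 : Integrable (fun y : ℝ × ℝ => y.2 ^ 2) ν) :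
    (∀ n, Integrable (sojourn ζ s W n) P ∧ ∫ ω, sojourn ζ s W n ω ∂P = meanWait ν n s t 0 + s) ∧
    ∃ K, 0 ≤ K ∧ ∀ n, Integrable (fun ω => sojourn ζ s W n ω ^ 2) P ∧
      ∫ ω, sojourn ζ s W n ω ^ 2 ∂P ≤ K := by
  have h1ρ : 0 < 1 - ρ := sub_pos.2 (H.ρ_lt.trans H.σ_lt)
  have hβ := H.β_pos
  have hρ := H.ρ_pos
  have hexp := fun n => L.exp_moment I H (m := 1 / (1 - ρ)) (by field_simp; linarith)
    (by simp [hW0]) (by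
      simp only [hW0, mul_zero, Real.exp_zero, integral_const, probReal_univ, smul_eq_mul, mul_one]
      rw [le_div_iff₀ h1ρ]; linarith) n
  have hW : ∀ n, Integrable (W n) P := by
    intro n
    refine ((hexp n).1.const_mul (1 / (2 * β))).mono' (L.measurable' I n).aestronglyMeasurable
      (ae_of_all _ fun ω => ?_)
    rw [Real.norm_eq_abs, abs_of_nonneg (L.nonneg n ω)]
    exact id_le_inv_mul_exp (by positivity)
  have hmean : ∀ n, ∫ ω, W n ω ∂P = meanWait ν n s t 0 := by
    intro n
    have := L.integral_mul_meanWait (s := fun _ => s) (t := fun _ => t) H I hW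
      (b := fun _ => 1) measurable_const (K := 1) (by simp) 0 n
    simpa [meanWait, hW0] using this
  refine ⟨fun n => ⟨(hW n).add ((I.integrable_comp n H.intV).const_mul s), ?_⟩, ?_⟩
  · unfold sojourn
    rw [integral_add (hW n) ((I.integrable_comp n H.intV).const_mul s), hmean, integral_const_mul,
      I.integral_comp n measurable_snd, H.meanV, mul_one]
  · set m2 := ∫ y : ℝ × ℝ, y.2 ^ 2 ∂ν with hm2
    have hm20 : 0 ≤ m2 := integral_nonneg fun y => sq_nonneg _
    refine ⟨2 * (1 / (2 * β ^ 2)) * (1 / (1 - ρ)) + 2 * s ^ 2 * m2, by positivity, fun n => ?_⟩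
    have hmeas : Measurable (sojourn ζ s W n) :=
      (L.measurable' I n).add ((I.measurable n).snd.const_mul s)
    have hi := (((hexp n).1.const_mul (2 * (1 / (2 * β ^ 2)))).add
      ((I.integrable_comp n hV2).const_mul (2 * s ^ 2)))
    have hle : ∀ ω, sojourn ζ s W n ω ^ 2 ≤ 2 * (1 / (2 * β ^ 2)) * Real.exp (2 * β * W n ω)
        + 2 * s ^ 2 * (ζ n ω).2 ^ 2 := by
      intro ω
      have h1 := sq_le_exp hβ (L.nonneg n ω)
      unfold sojourn
      nlinarith [sq_nonneg (W n ω - s * (ζ n ω).2)]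
    have hint : Integrable (fun ω => sojourn ζ s W n ω ^ 2) P := by
      refine hi.mono' (hmeas.pow_const 2).aestronglyMeasurable (ae_of_all _ fun ω => ?_)
      rw [Real.norm_eq_abs, abs_of_nonneg (sq_nonneg _)]
      exact hle ω
    refine ⟨hint, (integral_mono hint hi hle).trans ?_⟩
    have e := integral_add ((hexp n).1.const_mul (2 * (1 / (2 * β ^ 2))))
      ((I.integrable_comp n hV2).const_mul (2 * s ^ 2))
    refine e.trans_le ?_
    rw [integral_const_mul, integral_const_mul, I.integral_comp n (measurable_snd.pow_const 2)]
    have := mul_le_mul_of_nonneg_left (hexp n).2 (show 0 ≤ 2 * (1 / (2 * β ^ 2)) by positivity)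
    linarith

lemma sojourn_nonneg (L : IsLindley G ζ sHi tLo (fun _ _ => s) (fun _ _ => t) W) {ω : Ω}
    (hω : ∀ n, 0 ≤ (ζ n ω).1 ∧ 0 ≤ (ζ n ω).2) (n : ℕ) : 0 ≤ sojourn ζ s W n ω :=
  add_nonneg (L.nonneg n ω) (mul_nonneg (L.box 0 ω).1 (hω n).2)

/-- The total time in system up to time `x` is asymptotically at most the arrival rate times the
mean sojourn time. -/
lemma eventually_tsum_sojourn_le (H : Tilted ν sHi tLo β ρ σ C) (I : Innov P G ζ ν)
    (L : IsLindley G ζ sHi tLo (fun _ _ => s) (fun _ _ => t) W) (hW0 : ∀ ω, W 0 ω = 0)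
    (hU2 : Integrable (fun y : ℝ × ℝ => y.1 ^ 2) ν)
    (hV2 : Integrable (fun y : ℝ × ℝ => y.2 ^ 2) ν) (hx : InBox sHi tLo s t)
    (hL0 : 0 ≤ steadyWait ν s t + s) {δ : ℝ} (hδ : 0 < δ) :
    ∀ᶠ x : ℝ in atTop, ∑' n, ∫⁻ ω, sojournUpTo ζ s t W x n ω ∂P
      ≤ ENNReal.ofReal (((steadyWait ν s t + s) / t + δ) * x) := by
  have ht : 0 < t := H.tLo_pos.trans_le hx.2.2
  set ℓ := steadyWait ν s t + s with hℓ
  obtain ⟨hmean, K, hK0, hK⟩ := sojourn_moments H I L hW0 hV2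
  -- Makes the relative error ε in the number of arrivals cost at most δ/2 per unit of time; `ℓ + 1`
  -- avoids a division by zero.
  set ε := δ * t / (2 * (ℓ + 1)) with hε
  have hε0 : 0 < ε := by positivity
  obtain ⟨x₀, q, hx0, hq0, hq1, hq⟩ := exists_chernoff H hU2 hε0
  have h1q : 0 < 1 - q := sub_pos.2 hq1
  set K' := (K + 1) / 2 with hK'
  have hK'0 : 0 ≤ K' := by positivity
  set c := sHi * C / (1 - ρ) ^ 2 with hc
  filter_upwards [eventually_gt_atTop 0,
    eventually_ge_atTop (2 * (ℓ + c + K' / (1 - q)) / δ)] with x hxpos hxbig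
  -- Customers expected after (1 + ε) x count only if they arrive too early. The product of their
  -- sojourn time Y with that indicator is split as Y ≤ q^n Y²/2 + q^{-n}/2, and the indicator has
  -- an exponential bound with mean at most q^{2n}.
  have hlate : ∀ n : ℕ, (1 + ε) * x / t ≤ n →
      ∫⁻ ω, sojournUpTo ζ s t W x n ω ∂P ≤ ENNReal.ofReal (K' * q ^ n) := by
    intro n hn
    have hexp := integral_exp_neg_arrSum H I hx0.le n
    set c1 := (q ^ n)⁻¹ * Real.exp (x₀ / (1 + ε)) ^ n / 2 with hc1
    have hc10 : 0 ≤ c1 := by positivity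
    have hi : Integrable (fun ω => q ^ n / 2 * sojourn ζ s W n ω ^ 2
        + c1 * Real.exp (-x₀ * arrSum ζ n ω)) P :=
      ((hK n).1.const_mul _).add (hexp.1.const_mul _)
    refine (lintegral_le_ofReal_integral hi (ae_of_all _ fun ω => by positivity) ?_).trans ?_
    · filter_upwards [I.ae_nonneg H.nonneg] with ω hω
      unfold sojournUpTo
      by_cases hA : t * arrSum ζ n ω ≤ x
      · refine (measure_mono Set.inter_subset_left).trans ?_
        rw [Real.volume_Ico, add_sub_cancel_left]
        refine ENNReal.ofReal_le_ofReal ?_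
        have h1 : arrSum ζ n ω ≤ n / (1 + ε) := by
          rw [le_div_iff₀ (by positivity)]
          rw [div_le_iff₀ ht] at hn
          have h2 := mul_le_mul_of_nonneg_left hA (show 0 ≤ 1 + ε by positivity)
          have h3 : t * (arrSum ζ n ω * (1 + ε)) ≤ t * n := by linarith
          exact le_of_mul_le_mul_left h3 ht
        have h2 : (q ^ n)⁻¹ / 2 ≤ c1 * Real.exp (-x₀ * arrSum ζ n ω) := by
          rw [hc1, ← Real.exp_nat_mul]
          have h3 : 1 ≤ Real.exp (n * (x₀ / (1 + ε))) * Real.exp (-x₀ * arrSum ζ n ω) := by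
            rw [← Real.exp_add]
            refine Real.one_le_exp ?_
            have := mul_le_mul_of_nonneg_left h1 hx0.le
            have e : (n : ℝ) * (x₀ / (1 + ε)) = x₀ * (n / (1 + ε)) := by ring
            rw [e]; linarith
          have h4 := mul_le_mul_of_nonneg_left h3 (show 0 ≤ (q ^ n)⁻¹ / 2 by positivity)
          linarith
        have h5 : sojourn ζ s W n ω ≤ q ^ n / 2 * sojourn ζ s W n ω ^ 2 + (q ^ n)⁻¹ / 2 := by
          have hqn : 0 < q ^ n := by positivity
          have := sq_nonneg (q ^ n * sojourn ζ s W n ω - 1)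
          have e : q ^ n / 2 * sojourn ζ s W n ω ^ 2 + (q ^ n)⁻¹ / 2 - sojourn ζ s W n ω
              = (q ^ n)⁻¹ / 2 * (q ^ n * sojourn ζ s W n ω - 1) ^ 2 := by
            field_simp; ring
          have : 0 ≤ (q ^ n)⁻¹ / 2 * (q ^ n * sojourn ζ s W n ω - 1) ^ 2 := by positivity
          linarith
        linarith
      · have : Set.Ico (t * arrSum ζ n ω) (t * arrSum ζ n ω + sojourn ζ s W n ω) ∩ Set.Ioc 0 x
            = ∅ := by
          ext y; simp only [Set.mem_inter_iff, Set.mem_Ico, Set.mem_Ioc, Set.mem_empty_iff_false,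
            iff_false]
          intro h; exact hA (h.1.1.trans h.2.2)
        rw [this]; simp
    · refine ENNReal.ofReal_le_ofReal ?_
      rw [integral_add ((hK n).1.const_mul _) (hexp.1.const_mul _), integral_const_mul,
        integral_const_mul, hexp.2]
      have h1 := mul_le_mul_of_nonneg_left (hK n).2 (show 0 ≤ q ^ n / 2 by positivity)
      have h2 : c1 * (∫ y : ℝ × ℝ, Real.exp (-x₀ * y.1) ∂ν) ^ n ≤ q ^ n / 2 := by
        have h3 : (Real.exp (x₀ / (1 + ε)) * ∫ y : ℝ × ℝ, Real.exp (-x₀ * y.1) ∂ν) ^ n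
            ≤ (q ^ 2) ^ n := pow_le_pow_left₀ (mul_nonneg (Real.exp_pos _).le
              (integral_nonneg fun y => (Real.exp_pos _).le)) hq n
        rw [mul_pow] at h3
        have h4 := mul_le_mul_of_nonneg_left h3 (show 0 ≤ (q ^ n)⁻¹ / 2 by positivity)
        have e : (q ^ n)⁻¹ / 2 * (q ^ 2) ^ n = q ^ n / 2 := by
          rw [← pow_mul, mul_comm 2 n, pow_mul]; field_simp
        rw [e] at h4
        rw [hc1]; linarith
      rw [hK']; linarith
  -- For the other customers the cut at time `x` is simply dropped.
  have hearly : ∀ n : ℕ, ∫⁻ ω, sojournUpTo ζ s t W x n ω ∂P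
      ≤ ENNReal.ofReal (meanWait ν n s t 0 + s) := by
    intro n
    rw [← (hmean n).2]
    refine lintegral_le_ofReal_integral (hmean n).1 ?_ (ae_of_all _ fun ω => ?_)
    · filter_upwards [I.ae_nonneg H.nonneg] with ω hω using sojourn_nonneg L hω n
    · refine (measure_mono Set.inter_subset_left).trans ?_
      rw [Real.volume_Ico, add_sub_cancel_left]
  set m := ⌈(1 + ε) * x / t⌉₊ with hm
  have hm1 : (m : ℝ) ≤ (1 + ε) * x / t + 1 := (Nat.ceil_lt_add_one (by positivity)).le
  have hmean0 : ∀ n, 0 ≤ meanWait ν n s t 0 + s := by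
    intro n
    rw [← (hmean n).2]
    refine integral_nonneg_of_ae ?_
    filter_upwards [I.ae_nonneg H.nonneg] with ω hω using sojourn_nonneg L hω n
  have hsum : ∑ n ∈ Finset.range m, (meanWait ν n s t 0 + s) ≤ m * ℓ + c := by
    have := (abs_le.1 (abs_sum_meanWait_sub_le H hx m)).2
    rw [Finset.sum_add_distrib]
    simp only [Finset.sum_const, Finset.card_range, nsmul_eq_mul]
    rw [hℓ]; linarith
  have hg : HasSum (fun i : ℕ => K' * q ^ m * q ^ i) (K' * q ^ m * (1 - q)⁻¹) :=
    (hasSum_geometric_of_lt_one hq0.le hq1).mul_left _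
  calc ∑' n, ∫⁻ ω, sojournUpTo ζ s t W x n ω ∂P
      = ∑ n ∈ Finset.range m, ∫⁻ ω, sojournUpTo ζ s t W x n ω ∂P
        + ∑' n, ∫⁻ ω, sojournUpTo ζ s t W x (n + m) ω ∂P :=
        (ENNReal.summable.sum_add_tsum_nat_add' (f := fun n =>
          ∫⁻ ω, sojournUpTo ζ s t W x n ω ∂P)).symm
    _ ≤ ∑ n ∈ Finset.range m, ENNReal.ofReal (meanWait ν n s t 0 + s)
        + ∑' i : ℕ, ENNReal.ofReal (K' * q ^ m * q ^ i) := by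
        refine add_le_add (Finset.sum_le_sum fun n _ => hearly n) (ENNReal.tsum_le_tsum fun i => ?_)
        refine (hlate (i + m) ?_).trans_eq ?_
        · refine (Nat.le_ceil _).trans ?_
          exact_mod_cast Nat.le_add_left m i
        · rw [pow_add]; congr 1; ring
    _ = ENNReal.ofReal (∑ n ∈ Finset.range m, (meanWait ν n s t 0 + s)
        + K' * q ^ m * (1 - q)⁻¹) := by
        rw [← ENNReal.ofReal_sum_of_nonneg fun n _ => hmean0 n,
          ← ENNReal.ofReal_tsum_of_nonneg (fun i => by positivity) hg.summable, hg.tsum_eq,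
          ENNReal.ofReal_add (Finset.sum_nonneg fun n _ => hmean0 n) (by positivity)]
    _ ≤ ENNReal.ofReal ((ℓ / t + δ) * x) := by
        refine ENNReal.ofReal_le_ofReal ?_
        have h1 : K' * q ^ m * (1 - q)⁻¹ ≤ K' / (1 - q) := by
          rw [div_eq_mul_inv]
          have : K' * q ^ m ≤ K' * 1 := by
            gcongr; exact pow_le_one₀ hq0.le hq1.le
          rw [mul_one] at this
          gcongr
        have h2 := mul_le_mul_of_nonneg_right hm1 hL0
        rw [div_le_iff₀ hδ] at hxbig
        have h3 : ε * x / t * ℓ ≤ δ * x / 2 := by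
          have h4 : ε * ℓ ≤ δ * t / 2 := by
            rw [hε, div_mul_eq_mul_div, div_le_div_iff₀ (by positivity) (by positivity)]
            nlinarith [mul_pos hδ ht]
          have h5 := mul_le_mul_of_nonneg_left h4 (show 0 ≤ x / t by positivity)
          have e1 : ε * x / t * ℓ = x / t * (ε * ℓ) := by ring
          have e2 : x / t * (δ * t / 2) = δ * x / 2 := by field_simp
          rw [e1, ← e2]; exact h5
        have e : ((1 + ε) * x / t + 1) * ℓ = ℓ / t * x + ε * x / t * ℓ + ℓ := by ring
        rw [e] at h2
        linarith

/-- A customer expected before (1 - ε) x that departs after x has a deviation b = t (A - n) + Y of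
at least ε x, whence Y ≤ Y b/(ε x). Splitting the product with a free weight `r` leaves only second
moments. -/
lemma le_of_late_departure {ε r x t n A Y : ℝ} (hε : 0 < ε) (hr : 0 < r) (hx : 0 < x) (hY : 0 ≤ Y)
    (hn : t * n ≤ (1 - ε) * x) (h : x < t * A + Y) :
    Y ≤ r / (2 * ε * x) * Y ^ 2
      + 1 / (2 * ε * x * r) * (2 * t ^ 2 * (A - n) ^ 2 + 2 * Y ^ 2) := by
  set b := t * (A - n) + Y with hb
  have hb1 : ε * x ≤ b := by
    have : b = t * A - t * n + Y := by rw [hb]; ring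
    rw [this]; linarith
  have hb2 : b ^ 2 ≤ 2 * t ^ 2 * (A - n) ^ 2 + 2 * Y ^ 2 := by
    have e : 2 * t ^ 2 * (A - n) ^ 2 + 2 * Y ^ 2 - b ^ 2 = (t * (A - n) - Y) ^ 2 := by
      rw [hb]; ring
    have := sq_nonneg (t * (A - n) - Y)
    linarith
  have hb3 : Y * b ≤ r / 2 * Y ^ 2 + 1 / (2 * r) * b ^ 2 := by
    have e : r / 2 * Y ^ 2 + 1 / (2 * r) * b ^ 2 - Y * b = 1 / (2 * r) * (r * Y - b) ^ 2 := by
      field_simp; ring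
    have : 0 ≤ 1 / (2 * r) * (r * Y - b) ^ 2 := by positivity
    linarith
  have hb4 : Y * (ε * x) ≤ Y * b := mul_le_mul_of_nonneg_left hb1 hY
  have hb5 := mul_le_mul_of_nonneg_left hb2 (show 0 ≤ 1 / (2 * r) by positivity)
  refine le_of_mul_le_mul_right ?_ (show 0 < ε * x by positivity)
  have e : (r / (2 * ε * x) * Y ^ 2
      + 1 / (2 * ε * x * r) * (2 * t ^ 2 * (A - n) ^ 2 + 2 * Y ^ 2)) * (ε * x) = r / 2 * Y ^ 2
      + 1 / (2 * r) * (2 * t ^ 2 * (A - n) ^ 2 + 2 * Y ^ 2) := by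
    field_simp
  rw [e]; linarith

set_option maxHeartbeats 800000 in
/-- The total time in system up to time `x` is asymptotically at least the arrival rate times the
mean sojourn time. -/
lemma eventually_le_tsum_sojourn (H : Tilted ν sHi tLo β ρ σ C) (I : Innov P G ζ ν)
    (L : IsLindley G ζ sHi tLo (fun _ _ => s) (fun _ _ => t) W) (hW0 : ∀ ω, W 0 ω = 0)
    (hU2 : Integrable (fun y : ℝ × ℝ => y.1 ^ 2) ν)
    (hV2 : Integrable (fun y : ℝ × ℝ => y.2 ^ 2) ν) (hx : InBox sHi tLo s t)
    (hL0 : 0 ≤ steadyWait ν s t + s) {δ : ℝ} (hδ : 0 < δ) :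
    ∀ᶠ x : ℝ in atTop, ENNReal.ofReal (((steadyWait ν s t + s) / t - δ) * x)
      ≤ ∑' n, ∫⁻ ω, sojournUpTo ζ s t W x n ω ∂P := by
  have ht : 0 < t := H.tLo_pos.trans_le hx.2.2
  set ℓ := steadyWait ν s t + s with hℓ
  obtain ⟨hmean, K, hK0, hK⟩ := sojourn_moments H I L hW0 hV2
  set ε := δ * t / (2 * (ℓ + 1)) with hε
  have hε0 : 0 < ε := by positivity
  set vU := ∫ y : ℝ × ℝ, (y.1 - 1) ^ 2 ∂ν with hvU
  have hvU0 : 0 ≤ vU := integral_nonneg fun y => sq_nonneg _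
  set c := sHi * C / (1 - ρ) ^ 2 with hc
  have h1ρ : 0 < 1 - ρ := sub_pos.2 (H.ρ_lt.trans H.σ_lt)
  have hc0 : 0 ≤ c := by have := H.sHi_pos; have := H.C_pos; positivity
  set K' := (K + (2 * t * vU + 2 * K)) / (2 * ε) with hK'
  have hK'0 : 0 ≤ K' := by positivity
  filter_upwards [eventually_ge_atTop 1, eventually_ge_atTop (4 * (ℓ + c) / δ),
    eventually_ge_atTop ((4 * (K' / t) / δ) ^ 2)] with x hx1 hxbig hxbig2
  have hxpos : 0 < x := by linarith
  -- The second moment of the arrival deviation grows like x. With weight √x both halves of the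
  -- split product are of order 1/√x, which is the loss K'/r per customer.
  set r := Real.sqrt x with hr
  have hr0 : 0 < r := Real.sqrt_pos.2 hxpos
  have hrr : r * r = x := Real.mul_self_sqrt hxpos.le
  have hr1 : 1 ≤ r := by rw [hr]; exact Real.one_le_sqrt.2 hx1
  have hrbig : 4 * (K' / t) / δ ≤ r := Real.le_sqrt_of_sq_le hxbig2
  have hterm : ∀ n : ℕ, (n : ℝ) ≤ (1 - ε) * x / t →
      ENNReal.ofReal (meanWait ν n s t 0 + s - K' / r)
        ≤ ∫⁻ ω, sojournUpTo ζ s t W x n ω ∂P := by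
    intro n hn
    have hvar := arrSum_variance H I hU2 n
    set D := fun ω => r / (2 * ε * x) * sojourn ζ s W n ω ^ 2
      + 1 / (2 * ε * x * r) * (2 * t ^ 2 * (arrSum ζ n ω - n) ^ 2
        + 2 * sojourn ζ s W n ω ^ 2) with hD
    have hD1 : Integrable (fun ω => 2 * t ^ 2 * (arrSum ζ n ω - n) ^ 2
        + 2 * sojourn ζ s W n ω ^ 2) P := (hvar.2.1.const_mul _).add ((hK n).1.const_mul _)
    have hDi : Integrable D P := ((hK n).1.const_mul _).add (hD1.const_mul _)
    have hnx : t * n ≤ (1 - ε) * x := by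
      rw [le_div_iff₀ ht] at hn; linarith
    have hDint : ∫ ω, D ω ∂P ≤ K' / r := by
      rw [hD, integral_add ((hK n).1.const_mul _) (hD1.const_mul _), integral_const_mul,
        integral_const_mul, integral_add (hvar.2.1.const_mul _) ((hK n).1.const_mul _),
        integral_const_mul, integral_const_mul, hvar.2.2, ← hvU]
      have h1 := mul_le_mul_of_nonneg_left (hK n).2 (show 0 ≤ r / (2 * ε * x) by positivity)
      have h2 : 2 * t ^ 2 * (n * vU) + 2 * ∫ ω, sojourn ζ s W n ω ^ 2 ∂P
          ≤ (2 * t * vU + 2 * K) * x := by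
        have h3 : t * n * (2 * t * vU) ≤ x * (2 * t * vU) :=
          mul_le_mul_of_nonneg_right (by nlinarith) (by positivity)
        have h4 : K ≤ K * x := by nlinarith
        have := (hK n).2
        nlinarith
      have h5 := mul_le_mul_of_nonneg_left h2 (show 0 ≤ 1 / (2 * ε * x * r) by positivity)
      have e : r / (2 * ε * x) * K + 1 / (2 * ε * x * r) * ((2 * t * vU + 2 * K) * x) = K' / r := by
        rw [hK']
        have e1 : r / (2 * ε * x) = 1 / (2 * ε * r) := by
          rw [← hrr]; field_simp
        rw [e1]; field_simp
      linarith
    have h1 : ENNReal.ofReal (meanWait ν n s t 0 + s - K' / r)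
        ≤ ENNReal.ofReal (∫ ω, (sojourn ζ s W n ω - D ω) ∂P) := by
      refine ENNReal.ofReal_le_ofReal ?_
      rw [integral_sub (hmean n).1 hDi, (hmean n).2]
      linarith
    refine h1.trans ((ofReal_integral_le_lintegral ((hmean n).1.sub hDi)).trans ?_)
    refine lintegral_mono_ae ?_
    filter_upwards [I.ae_nonneg H.nonneg] with ω hω
    have hA := mul_nonneg ht.le (arrSum_nonneg hω n)
    have hY := sojourn_nonneg L hω n
    have hD0 : 0 ≤ D ω := by
      simp only [hD]
      have := hr0.le
      have := hε0.le
      have := hxpos.le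
      positivity
    by_cases hB : t * arrSum ζ n ω + sojourn ζ s W n ω ≤ x
    · have hsub : Set.Ioo (t * arrSum ζ n ω) (t * arrSum ζ n ω + sojourn ζ s W n ω)
          ⊆ Set.Ico (t * arrSum ζ n ω) (t * arrSum ζ n ω + sojourn ζ s W n ω) ∩ Set.Ioc 0 x :=
        fun y hy => ⟨⟨hy.1.le, hy.2⟩, hA.trans_lt hy.1, hy.2.le.trans hB⟩
      have := measure_mono (μ := volume) hsub
      rw [Real.volume_Ioo, add_sub_cancel_left] at this
      exact le_trans (ENNReal.ofReal_le_ofReal (sub_le_self _ hD0)) this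
    · have : sojourn ζ s W n ω - D ω ≤ 0 := by
        have := le_of_late_departure hε0 hr0 hxpos (n := n) hY hnx (not_le.1 hB)
        simp only [hD]
        linarith
      rw [ENNReal.ofReal_of_nonpos (by simpa using this)]
      exact zero_le
  -- A nonpositive target is trivial. A positive one forces δ t < ℓ and hence ε < 1, without which
  -- there would be no customers to count.
  rcases le_or_gt ((ℓ / t - δ) * x) 0 with hneg | hposi
  · rw [ENNReal.ofReal_of_nonpos hneg]; exact zero_le
  have hε1 : ε < 1 := by
    have h1 : 0 < ℓ / t - δ := by
      by_contra h
      push Not at h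
      nlinarith
    have h2 : δ * t < ℓ := by
      rw [sub_pos, lt_div_iff₀ ht] at h1; exact h1
    rw [hε, div_lt_one (by positivity)]
    nlinarith
  set y := (1 - ε) * x / t with hy
  have hy0 : 0 ≤ y := by
    have : 0 ≤ 1 - ε := by linarith
    positivity
  set m := ⌊y⌋₊ with hm
  have hm1 : y - 1 ≤ m := (Nat.sub_one_lt_floor y).le
  have hm2 : (m : ℝ) ≤ y := Nat.floor_le hy0
  have hsum : m * ℓ - c - m * (K' / r) ≤ ∑ n ∈ Finset.range m, (meanWait ν n s t 0 + s - K' / r) := by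
    have := (abs_le.1 (abs_sum_meanWait_sub_le H hx m)).1
    rw [Finset.sum_sub_distrib, Finset.sum_add_distrib]
    simp only [Finset.sum_const, Finset.card_range, nsmul_eq_mul]
    rw [hℓ]; linarith
  calc ENNReal.ofReal ((ℓ / t - δ) * x)
      ≤ ENNReal.ofReal (∑ n ∈ Finset.range m, (meanWait ν n s t 0 + s - K' / r)) := by
        refine ENNReal.ofReal_le_ofReal (le_trans ?_ hsum)
        have h1 := mul_le_mul_of_nonneg_right hm1 hL0
        have hyx : y ≤ x / t := by
          rw [hy]
          exact div_le_div_of_nonneg_right (by linarith [mul_pos hε0 hxpos]) ht.le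
        have h2 : m * (K' / r) ≤ x / t * (K' / r) :=
          mul_le_mul_of_nonneg_right (hm2.trans hyx) (by positivity)
        have h3 : x / t * (K' / r) ≤ δ * x / 4 := by
          rw [div_le_iff₀ hδ] at hrbig
          have e : x / t * (K' / r) = r * (K' / t) := by rw [← hrr]; field_simp
          rw [e]
          have := mul_le_mul_of_nonneg_left hrbig hr0.le
          have e2 : r * (r * δ) = δ * x := by rw [← hrr]; ring
          linarith
        rw [div_le_iff₀ hδ] at hxbig
        have h4 : ε * x / t * ℓ ≤ δ * x / 2 := by
          have h4 : ε * ℓ ≤ δ * t / 2 := by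
            rw [hε, div_mul_eq_mul_div, div_le_div_iff₀ (by positivity) (by positivity)]
            nlinarith [mul_pos hδ ht]
          have h5 := mul_le_mul_of_nonneg_left h4 (show 0 ≤ x / t by positivity)
          have e1 : ε * x / t * ℓ = x / t * (ε * ℓ) := by ring
          have e2 : x / t * (δ * t / 2) = δ * x / 2 := by field_simp
          rw [e1, ← e2]; exact h5
        have e : (y - 1) * ℓ = ℓ / t * x - ε * x / t * ℓ - ℓ := by rw [hy]; ring
        rw [e] at h1
        linarith
    _ ≤ ∑ n ∈ Finset.range m, ENNReal.ofReal (meanWait ν n s t 0 + s - K' / r) := by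
        -- The summands may be negative, so `ENNReal.ofReal` is only subadditive on the sum.
        generalize Finset.range m = S
        induction S using Finset.induction_on with
        | empty => simp
        | insert a S ha ih =>
          rw [Finset.sum_insert ha, Finset.sum_insert ha]
          exact ENNReal.ofReal_add_le.trans (add_le_add le_rfl ih)
    _ ≤ ∑ n ∈ Finset.range m, ∫⁻ ω, sojournUpTo ζ s t W x n ω ∂P := by
        refine Finset.sum_le_sum fun n hn => hterm n (le_trans ?_ hm2)
        exact_mod_cast (Finset.mem_range.1 hn).le
    _ ≤ _ := ENNReal.sum_le_tsum _

end

end GIGIOne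

/-! ### Little's law for the model with a fixed decision -/

namespace GIGIOne

section

variable {M : Model}

lemma integrable_sq_of_exp {μ : Measure ℝ} {η : ℝ} (hη : 0 < η) (h0 : ∀ᵐ x ∂μ, 0 ≤ x)
    (h : Integrable (fun x => Real.exp (η * x)) μ) : Integrable (fun x => x ^ 2) μ := by
  refine (h.const_mul (1 / (2 * (η / 2) ^ 2))).mono' (by fun_prop) ?_
  filter_upwards [h0] with x hx
  rw [Real.norm_eq_abs, abs_of_nonneg (sq_nonneg _)]
  have := sq_le_exp (half_pos hη) hx
  rwa [show 2 * (η / 2) = η by ring] at this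

lemma Model.arrival_eq (l : ℝ) (z : ℕ → ℝ × ℝ) (n : ℕ) :
    arrival l z n = 1 / l * arrSum (fun n (z : ℕ → ℝ × ℝ) => z n) n z := by
  unfold arrival arrSum
  rw [Finset.mul_sum]
  exact Finset.sum_congr rfl fun j _ => by ring

lemma Model.wait_succ (mu l : ℝ) (z : ℕ → ℝ × ℝ) (n : ℕ) :
    wait mu l z (n + 1) = lindley (1 / mu) (1 / l) (wait mu l z n) (z n) := by
  simp only [wait, lindley]
  congr 1; ring

lemma Model.departure_eq (mu l : ℝ) (z : ℕ → ℝ × ℝ) (n : ℕ) :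
    departure mu l z n = 1 / l * arrSum (fun n (z : ℕ → ℝ × ℝ) => z n) n z
      + sojourn (fun n (z : ℕ → ℝ × ℝ) => z n) (1 / mu) (fun n z => wait mu l z n) n z := by
  unfold departure sojourn
  rw [Model.arrival_eq]; ring

/-- Path space with the trivial history is an instance of the adapted setting, so the estimates for
adapted recursions apply to the definition of `meanQueue`. -/
lemma innov_inputLaw (ν : Measure (ℝ × ℝ)) [IsProbabilityMeasure ν] :
    Innov (Measure.infinitePi fun _ : ℕ => ν)
      (inputFiltration ⊥ bot_le (fun n (z : ℕ → ℝ × ℝ) => z n) fun n => measurable_pi_apply n)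
      (fun n z => z n) ν :=
  innov_inputFiltration bot_le _ (fun n => Measure.infinitePi_map_eval _ n)
    (iIndepFun_infinitePi fun _ => measurable_id) (indep_bot_right _)

lemma measurable_wait (mu l : ℝ) (n : ℕ) : Measurable fun z : ℕ → ℝ × ℝ => wait mu l z n := by
  induction n with
  | zero => exact measurable_const
  | succ n ih => simp only [wait]; fun_prop

lemma measurable_arrival (l : ℝ) (n : ℕ) : Measurable fun z : ℕ → ℝ × ℝ => arrival l z n := by
  unfold arrival; fun_prop

lemma measurable_departure (mu l : ℝ) (n : ℕ) :
    Measurable fun z : ℕ → ℝ × ℝ => departure mu l z n := by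
  have := measurable_wait mu l n
  have := measurable_arrival l n
  unfold departure; fun_prop

/-- The accumulated queue length is the total time in system of all customers. -/
lemma lintegral_queueLength (mu l : ℝ) (P : Measure (ℕ → ℝ × ℝ)) [SFinite P] (x : ℝ) :
    ∫⁻ r in Set.Ioc 0 x, ∫⁻ z, queueLength mu l z r ∂P
      = ∑' n, ∫⁻ z, sojournUpTo (fun n (z : ℕ → ℝ × ℝ) => z n) (1 / mu) (1 / l)
          (fun n z => wait mu l z n) x n z ∂P := by
  have hm : ∀ n, Measurable fun q : ℝ × (ℕ → ℝ × ℝ) =>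
      (Set.Ico (arrival l q.2 n) (departure mu l q.2 n)).indicator (1 : ℝ → ℝ≥0∞) q.1 := by
    intro n
    have hset : MeasurableSet {q : ℝ × (ℕ → ℝ × ℝ) |
        q.1 ∈ Set.Ico (arrival l q.2 n) (departure mu l q.2 n)} :=
      (measurableSet_le ((measurable_arrival l n).comp measurable_snd) measurable_fst).inter
        (measurableSet_lt measurable_fst ((measurable_departure mu l n).comp measurable_snd))
    have h := (measurable_const (a := (1 : ℝ≥0∞)) : Measurable fun _ : ℝ × (ℕ → ℝ × ℝ) => (1 : ℝ≥0∞)).indicator hset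
    convert h using 1
    ext q
    simp only [Set.indicator, Set.mem_ofPred_eq, Pi.one_apply]
  have h1 : ∀ r, ∫⁻ z, queueLength mu l z r ∂P = ∑' n, ∫⁻ z,
      (Set.Ico (arrival l z n) (departure mu l z n)).indicator (1 : ℝ → ℝ≥0∞) r ∂P := by
    intro r
    unfold queueLength
    exact lintegral_tsum fun n => ((hm n).comp measurable_prodMk_left).aemeasurable
  simp_rw [h1]
  rw [lintegral_tsum fun n => ((hm n).lintegral_prod_right').aemeasurable]
  refine tsum_congr fun n => ?_
  rw [lintegral_lintegral_swap (hm n).aemeasurable]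
  refine lintegral_congr fun z => ?_
  unfold sojournUpTo
  rw [← Model.departure_eq, ← Model.arrival_eq, ← Measure.restrict_apply measurableSet_Ico]
  have h := lintegral_indicator_one (μ := volume.restrict (Set.Ioc 0 x))
    (measurableSet_Ico (a := arrival l z n) (b := departure mu l z n))
  exact h

lemma Model.inBox (hM : M.Standing) (hS : M.Stable) {mu p : ℝ}
    (hmu : mu ∈ Set.Icc M.muLo M.muHi) (hp : p ∈ Set.Icc M.pLo M.pHi) :
    InBox (1 / M.muLo) (1 / M.lam M.pLo) (1 / mu) (1 / M.lam p) := by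
  have h0 := hM.muLo_pos hS
  have h1 : 0 < mu := h0.trans_le hmu.1
  refine ⟨by positivity, one_div_le_one_div_of_le h0 hmu.1,
    one_div_le_one_div_of_le (hM.lam_pos p hp) ?_⟩
  exact hS.lam_anti ⟨le_rfl, hM.p_le⟩ hp hp.1

/-- **Little's law** for the steady-state mean queue length. -/
lemma Model.meanQueue_eq {η θ a γ₀ : ℝ} (hL : M.LightTail η θ a γ₀) (hM : M.Standing)
    (hS : M.Stable) {mu p : ℝ} (hmu : mu ∈ Set.Icc M.muLo M.muHi)
    (hp : p ∈ Set.Icc M.pLo M.pHi) :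
    M.meanQueue mu p
      = M.lam p * (steadyWait (M.lawU.prod M.lawV) (1 / mu) (1 / M.lam p) + 1 / mu) := by
  have := hM.probU
  have := hM.probV
  -- Any exponent will do here, since the empty start requires no moment assumption.
  obtain ⟨β, ρ, σ, C, H, -⟩ := hL.exists_tilted hM hS one_pos
  set ν := M.lawU.prod M.lawV with hν
  have hx := Model.inBox hM hS hmu hp
  have I := innov_inputLaw ν
  have hlp := hM.lam_pos p hp
  have hmu0 : 0 < mu := (hM.muLo_pos hS).trans_le hmu.1
  have L : IsLindley (inputFiltration ⊥ bot_le (fun n (z : ℕ → ℝ × ℝ) => z n)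
      fun n => measurable_pi_apply n) (fun n z => z n) (1 / M.muLo) (1 / M.lam M.pLo)
      (fun _ _ => 1 / mu) (fun _ _ => 1 / M.lam p) (fun n z => wait mu (M.lam p) z n) :=
    { meas_s := fun n => measurable_const
      meas_t := fun n => measurable_const
      meas_zero := measurable_const
      nonneg_zero := fun ω => le_rfl
      box := fun n ω => hx
      step := fun n ω => Model.wait_succ mu (M.lam p) ω n }
  have hU2 : Integrable (fun y : ℝ × ℝ => y.1 ^ 2) ν :=
    (integrable_sq_of_exp hL.eta_pos hM.nonnegU hL.expU).comp_fst _
  have hV2 : Integrable (fun y : ℝ × ℝ => y.2 ^ 2) ν :=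
    (integrable_sq_of_exp hL.eta_pos hM.nonnegV hL.expV).comp_snd _
  have hL0 : 0 ≤ steadyWait ν (1 / mu) (1 / M.lam p) + 1 / mu := by
    have hm := (sojourn_moments H I L (fun _ => rfl) hV2).1
    refine ge_of_tendsto ((H.tendsto_meanWait hx).add_const (1 / mu)) (Eventually.of_forall ?_)
    intro n
    rw [← (hm n).2]
    refine integral_nonneg_of_ae ?_
    filter_upwards [I.ae_nonneg H.nonneg] with ω hω using sojourn_nonneg L hω n
  set c := (steadyWait ν (1 / mu) (1 / M.lam p) + 1 / mu) / (1 / M.lam p) with hc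
  have hc0 : 0 ≤ c := by positivity
  have hlim : limsup (fun T : ℝ => (∫⁻ s in Set.Ioc 0 T, ∫⁻ z, queueLength mu (M.lam p) z s
      ∂M.inputLaw) / ENNReal.ofReal T) atTop = ENNReal.ofReal c := by
    have hup : ∀ δ : ℝ, 0 < δ → ∀ᶠ T : ℝ in atTop, (∫⁻ s in Set.Ioc 0 T,
        ∫⁻ z, queueLength mu (M.lam p) z s ∂M.inputLaw) / ENNReal.ofReal T
          ≤ ENNReal.ofReal (c + δ) := by
      intro δ hδ
      filter_upwards [eventually_tsum_sojourn_le H I L (fun _ => rfl) hU2 hV2 hx hL0 hδ,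
        eventually_gt_atTop 0] with T hT hT0
      unfold Model.inputLaw
      rw [lintegral_queueLength]
      refine ENNReal.div_le_of_le_mul ?_
      rw [← ENNReal.ofReal_mul (by positivity)]
      exact hT
    have hlo : ∀ δ : ℝ, 0 < δ → ∀ᶠ T : ℝ in atTop, ENNReal.ofReal (c - δ) ≤ (∫⁻ s in Set.Ioc 0 T,
        ∫⁻ z, queueLength mu (M.lam p) z s ∂M.inputLaw) / ENNReal.ofReal T := by
      intro δ hδ
      filter_upwards [eventually_le_tsum_sojourn H I L (fun _ => rfl) hU2 hV2 hx hL0 hδ,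
        eventually_gt_atTop 0] with T hT hT0
      unfold Model.inputLaw
      rw [lintegral_queueLength]
      rw [ENNReal.le_div_iff_mul_le (Or.inl (by simpa using hT0)) (Or.inl ENNReal.ofReal_ne_top),
        ← ENNReal.ofReal_mul' hT0.le]
      exact hT
    refine le_antisymm ?_ ?_
    · refine ENNReal.le_of_forall_pos_le_add fun δ hδ _ => ?_
      refine (limsup_le_of_le (h := hup δ hδ)).trans ?_
      exact ENNReal.ofReal_add_le.trans_eq (by simp)
    · refine ENNReal.le_of_forall_pos_le_add fun δ hδ _ => ?_
      have h1 := le_limsup_of_frequently_le (hlo δ hδ).frequently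
      refine le_trans ?_ (add_le_add h1 (le_refl (δ : ℝ≥0∞)))
      have : ENNReal.ofReal c ≤ ENNReal.ofReal (c - δ) + ENNReal.ofReal δ := by
        refine le_trans ?_ ENNReal.ofReal_add_le
        exact ENNReal.ofReal_le_ofReal (by linarith)
      simpa using this
  unfold Model.meanQueue
  rw [hlim, ENNReal.toReal_ofReal hc0, hc]
  field_simp

end

end GIGIOne

namespace GIGIOne

set_option linter.unusedSectionVars false

/-! ### The controlled queue as a family of adapted Lindley recursions -/

lemma measurable_comp_of_continuousOn {Ω : Type*} {m : MeasurableSpace Ω} {f : ℝ → ℝ} {a b : ℝ}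
    (hf : ContinuousOn f (Set.Icc a b)) {g : Ω → ℝ} (hg : Measurable[m] g)
    (hgm : ∀ ω, g ω ∈ Set.Icc a b) : Measurable[m] fun ω => f (g ω) := by
  classical
  have h1 : Measurable ((Set.Icc a b).piecewise f fun _ => 0) :=
    hf.measurable_piecewise continuousOn_const measurableSet_Icc
  have h2 : (fun ω => f (g ω)) = fun ω => (Set.Icc a b).piecewise f (fun _ => 0) (g ω) := by
    funext ω; rw [Set.piecewise_eq_of_mem _ _ _ (hgm ω)]
  rw [h2]
  exact h1.comp hg

/-- For nonnegative interarrival times, customer `n + 1` is a leftover customer iff customer `n`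
arrived within the waiting time. -/
lemma succ_le_leftover_iff {l w : ℝ} {u : ℕ → ℝ} (hl : 0 < l) (hu : ∀ n, 0 ≤ u n) (n : ℕ) :
    ((n + 1 : ℕ) : ℕ∞) ≤ leftover l w u ↔ ∑ j ∈ Finset.range n, u j / l ≤ w := by
  have hmono : Monotone fun n => ∑ j ∈ Finset.range n, u j / l :=
    monotone_nat_of_le_succ fun n => by
      rw [Finset.sum_range_succ]
      exact le_add_of_nonneg_right (div_nonneg (hu n) hl.le)
  unfold leftover
  constructor
  · intro h
    by_contra hn
    have hsub : {n : ℕ | ∑ j ∈ Finset.range n, u j / l ≤ w} ⊆ (Finset.range n : Set ℕ) := by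
      intro i hi
      rw [Finset.coe_range, Set.mem_Iio]
      by_contra hin
      exact hn ((hmono (not_lt.1 hin)).trans hi)
    have h2 := h.trans (Set.encard_le_encard hsub)
    rw [Set.encard_coe_eq_coe_finsetCard, Finset.card_range] at h2
    have h3 : n + 1 ≤ n := by exact_mod_cast h2
    omega
  · intro h
    have hsub : (Finset.range (n + 1) : Set ℕ) ⊆ {n : ℕ | ∑ j ∈ Finset.range n, u j / l ≤ w} := by
      intro i hi
      rw [Finset.coe_range, Set.mem_Iio] at hi
      exact (hmono (Nat.lt_succ_iff.1 hi)).trans h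
    have h2 := Set.encard_le_encard hsub
    rwa [Set.encard_coe_eq_coe_finsetCard, Finset.card_range] at h2

section

variable {Ω : Type*}

/-- The Lindley recursion with parameters `s n`, `t n` from `w`. -/
noncomputable def lindleyProc (ζ : ℕ → Ω → ℝ × ℝ) (s t : ℕ → Ω → ℝ) (w : Ω → ℝ) : ℕ → Ω → ℝ
  | 0 => w
  | n + 1 => fun ω => lindley (s n ω) (t n ω) (lindleyProc ζ s t w n ω) (ζ n ω)

lemma measurable_lindleyProc {m : MeasurableSpace Ω} {ζ : ℕ → Ω → ℝ × ℝ} {s t : ℕ → Ω → ℝ}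
    {w : Ω → ℝ} (hw : Measurable[m] w) (n : ℕ)
    (h : ∀ i < n, Measurable[m] (s i) ∧ Measurable[m] (t i) ∧ Measurable[m] (ζ i)) :
    Measurable[m] (lindleyProc ζ s t w n) := by
  induction n with
  | zero => exact hw
  | succ n ih =>
    have h1 := h n (Nat.lt_succ_self n)
    exact measurable_lindley_comp h1.1 h1.2.1 (ih fun i hi => h i (hi.trans (Nat.lt_succ_self n)))
      h1.2.2

namespace Controlled

variable (S : Controlled Ω) (M : Model)

/-- Inputs of cycle `k`. -/
def input (k n : ℕ) (ω : Ω) : ℝ × ℝ := (S.U k n ω, S.V k n ω)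

/-- Mean service time in cycle `k`. -/
noncomputable def svc (k : ℕ) (ω : Ω) : ℝ := 1 / S.mu k ω

/-- Mean interarrival time under the price of cycle `k`. -/
noncomputable def iat (k : ℕ) (ω : Ω) : ℝ := 1 / M.lam (S.p k ω)

/-- The initial waiting time of cycle `k`, with the leftover customers identified by the
arrival times. -/
noncomputable def start : ℕ → Ω → ℝ
  | 0 => S.W0
  | 1 => S.W0
  | k + 2 => lindleyProc (S.input (k + 1)) (fun _ => S.svc (k + 1))
      (mixRate (S.input (k + 1)) (start (k + 1)) (S.iat M k) (S.iat M (k + 1)))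
      (start (k + 1)) (S.D (k + 1))

/-- The waiting times in cycle `k`. -/
noncomputable def proc (k : ℕ) : ℕ → Ω → ℝ :=
  lindleyProc (S.input k) (fun _ => S.svc k)
    (mixRate (S.input k) (S.start M k) (S.iat M (k - 1)) (S.iat M k)) (S.start M k)

lemma start_succ {k : ℕ} (hk : 1 ≤ k) : S.start M (k + 1) = S.proc M k (S.D k) := by
  obtain ⟨k, rfl⟩ := Nat.exists_eq_add_of_le' hk
  rfl

lemma proc_zero (k : ℕ) : S.proc M k 0 = S.start M k := rfl

lemma start_nonneg (h0 : ∀ ω, 0 ≤ S.W0 ω) (k : ℕ) (ω : Ω) : 0 ≤ S.start M k ω := by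
  induction k using Nat.strong_induction_on with
  | _ k ih =>
    match k with
    | 0 => exact h0 ω
    | 1 => exact h0 ω
    | k + 2 =>
      rw [start_succ S M (Nat.succ_le_succ (Nat.zero_le k))]
      unfold proc
      cases S.D (k + 1) with
      | zero => exact ih (k + 1) (by omega)
      | succ n => exact lindley_nonneg _ _ _ _

variable {S M}

section path

variable {ω : Ω}

/-- The number of leftover customers is defined through the whole input path of the cycle, whereas
`oldInd` with index `n` uses only the first `n` inputs. For nonnegative interarrival times the two
agree, and this makes the interarrival rate predictable. The shift by one arises because customer 0
is counted. -/
lemma cond_iff_oldInd (hlam : ∀ k, 0 < M.lam (S.p k ω)) {k : ℕ}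
    (hu : ∀ n, 0 ≤ S.U k n ω) (n : ℕ) :
    ((n + 1 : ℕ) : ℕ∞) ≤ leftover (M.lam (S.p (k - 1) ω)) (S.start M k ω) (fun n => S.U k n ω)
      ↔ oldInd (S.input k) (S.start M k) (S.iat M (k - 1)) n ω = 1 := by
  rw [succ_le_leftover_iff (hlam _) hu]
  have e : ∑ j ∈ Finset.range n, S.U k j ω / M.lam (S.p (k - 1) ω)
      = S.iat M (k - 1) ω * arrSum (S.input k) n ω := by
    unfold iat arrSum input
    rw [Finset.mul_sum]
    exact Finset.sum_congr rfl fun j _ => by ring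
  rw [e]
  rcases oldInd_cases (S.input k) (S.start M k) (S.iat M (k - 1)) n ω with h | h <;> simp [h]

lemma waitFrom_eq (hlam : ∀ k, 0 < M.lam (S.p k ω)) {k : ℕ}
    (hu : ∀ n, 0 ≤ S.U k n ω) (n : ℕ) :
    S.waitFrom M k ω (S.start M k ω) n = S.proc M k n ω := by
  induction n with
  | zero => rfl
  | succ n ih =>
    have h1 : S.waitFrom M k ω (S.start M k ω) (n + 1)
        = max (S.waitFrom M k ω (S.start M k ω) n + S.V k n ω / S.mu k ω - S.U k n ω
          / (open Classical in if ((n + 1 : ℕ) : ℕ∞) ≤ leftover (M.lam (S.p (k - 1) ω))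
            (S.start M k ω) (fun n => S.U k n ω)
            then M.lam (S.p (k - 1) ω) else M.lam (S.p k ω))) 0 := rfl
    have h2 : S.proc M k (n + 1) ω = lindley (S.svc k ω)
      (mixRate (S.input k) (S.start M k) (S.iat M (k - 1)) (S.iat M k) n ω)
      (S.proc M k n ω) (S.input k n ω) := rfl
    rw [h1, h2, ih]
    unfold lindley
    congr 2
    · unfold svc input; ring
    · have hc := cond_iff_oldInd hlam hu (M := M) n
      rcases oldInd_cases (S.input k) (S.start M k) (S.iat M (k - 1)) n ω with h | h
      · rw [if_pos (hc.2 h.1)]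
        unfold mixRate
        rw [h.1]
        unfold iat input
        simp only; ring
      · rw [if_neg (fun h' => by rw [hc.1 h'] at h; exact one_ne_zero h.1)]
        unfold mixRate
        rw [h.1]
        unfold iat input
        simp only; ring

lemma startWait_eq (hlam : ∀ k, 0 < M.lam (S.p k ω))
    (hu : ∀ k, 1 ≤ k → ∀ n, 0 ≤ S.U k n ω) (k : ℕ) : S.startWait M ω k = S.start M k ω := by
  induction k using Nat.strong_induction_on with
  | _ k ih =>
    match k with
    | 0 => rfl
    | 1 => rfl
    | k + 2 =>
      have h1 : S.startWait M ω (k + 2)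
          = S.waitFrom M (k + 1) ω (S.startWait M ω (k + 1)) (S.D (k + 1)) := rfl
      rw [h1, ih (k + 1) (by omega), waitFrom_eq hlam (hu (k + 1) (by omega)),
        start_succ S M (by omega)]

lemma W_eq (hlam : ∀ k, 0 < M.lam (S.p k ω)) (hu : ∀ k, 1 ≤ k → ∀ n, 0 ≤ S.U k n ω) {k : ℕ}
    (hk : 1 ≤ k) (n : ℕ) : S.W M k n ω = S.proc M k n ω := by
  unfold W
  rw [startWait_eq hlam hu, waitFrom_eq hlam (hu k hk)]

/-- Indicator that the customer with index `n + 1` of cycle `k` belongs to the previous price. -/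
noncomputable def old (S : Controlled Ω) (M : Model) (k n : ℕ) (ω : Ω) : ℝ :=
  oldInd (S.input k) (S.start M k) (S.iat M (k - 1)) n ω

lemma fee_eq (hlam : ∀ k, 0 < M.lam (S.p k ω)) (hu : ∀ k, 1 ≤ k → ∀ n, 0 ≤ S.U k n ω) {k : ℕ}
    (hk : 1 ≤ k) (n : ℕ) :
    S.fee M k (n + 1) ω = S.p k ω + S.old M k n ω * (S.p (k - 1) ω - S.p k ω) ∧
      S.interarrival M k (n + 1) ω
        = S.U k n ω * (S.iat M k ω + S.old M k n ω * (S.iat M (k - 1) ω - S.iat M k ω)) := by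
  unfold interarrival fee Q old
  rw [startWait_eq hlam hu]
  have hc := cond_iff_oldInd hlam (hu k hk) (M := M) n
  rcases oldInd_cases (S.input k) (S.start M k) (S.iat M (k - 1)) n ω with h | h
  · rw [if_pos (hc.2 h.1), h.1]
    refine ⟨by ring, ?_⟩
    unfold iat; simp only [Nat.add_sub_cancel]; ring
  · rw [if_neg (fun h' => by rw [hc.1 h'] at h; exact one_ne_zero h.1), h.1]
    refine ⟨by ring, ?_⟩
    unfold iat; simp only [Nat.add_sub_cancel]; ring

end path

end Controlled

variable [mΩ : MeasurableSpace Ω]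

/-- The standing assumptions on the model, the tilting constants, and the controlled queue. -/
structure Regime (S : Controlled Ω) (M : Model) (P : Measure Ω) (ℱ : Filtration ℕ mΩ)
    (β ρ σ C m : ℝ) : Prop where
  std : M.Standing
  stable : M.Stable
  tilted : Tilted (M.lawU.prod M.lawV) (1 / M.muLo) (1 / M.lam M.pLo) β ρ σ C
  adm : S.IsAdmissible M P ℱ
  m_le : 1 + ρ * m ≤ m
  one_le : 1 ≤ m
  int0 : Integrable (fun ω => Real.exp (2 * β * S.W0 ω)) P
  le0 : ∫ ω, Real.exp (2 * β * S.W0 ω) ∂P ≤ m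

namespace Regime

variable {S : Controlled Ω} {M : Model} {P : Measure Ω} [IsProbabilityMeasure P]
  {ℱ : Filtration ℕ mΩ} {β ρ σ C m : ℝ}

lemma lam_pos (h : Regime S M P ℱ β ρ σ C m) (k : ℕ) (ω : Ω) : 0 < M.lam (S.p k ω) :=
  h.std.lam_pos _ (h.adm.p_mem k ω)

lemma measurable_input (h : Regime S M P ℱ β ρ σ C m) {k : ℕ} (hk : 1 ≤ k) (n : ℕ) :
    Measurable (S.input k n) := (h.adm.measU k hk n).prodMk (h.adm.measV k hk n)

/-- The filtration inside cycle `k`. -/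
def filt (h : Regime S M P ℱ β ρ σ C m) {k : ℕ} (hk : 1 ≤ k) : Filtration ℕ mΩ :=
  inputFiltration (ℱ k) (ℱ.le k) (S.input k) (h.measurable_input hk)

lemma innov (h : Regime S M P ℱ β ρ σ C m) {k : ℕ} (hk : 1 ≤ k) :
    Innov P (h.filt hk) (S.input k) (M.lawU.prod M.lawV) :=
  innov_inputFiltration (ℱ.le k) (h.measurable_input hk) (h.adm.law k hk) (h.adm.indep k hk)
    (h.adm.indep_past k hk)

lemma le_filt (h : Regime S M P ℱ β ρ σ C m) {k : ℕ} (hk : 1 ≤ k) (n : ℕ) :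
    ℱ k ≤ h.filt hk n := le_inputFiltration _ _ _ _ _

lemma measurable_p (h : Regime S M P ℱ β ρ σ C m) {k i : ℕ} (hk : 1 ≤ k) (hi : i ≤ k) :
    Measurable[ℱ k] (S.p i) := by
  rcases Nat.eq_zero_or_pos i with rfl | hi0
  · exact h.adm.hist_p0.mono (ℱ.mono hk) le_rfl
  · exact (h.adm.hist_p i hi0).mono (ℱ.mono hi) le_rfl

lemma measurable_iat (h : Regime S M P ℱ β ρ σ C m) {k i : ℕ} (hk : 1 ≤ k) (hi : i ≤ k) :
    Measurable[ℱ k] (S.iat M i) :=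
  (measurable_comp_of_continuousOn h.stable.lam_contDiff.continuousOn (h.measurable_p hk hi)
    (h.adm.p_mem i)).const_div 1

lemma measurable_svc (h : Regime S M P ℱ β ρ σ C m) {k i : ℕ} (hi0 : 1 ≤ i) (hi : i ≤ k) :
    Measurable[ℱ k] (S.svc i) :=
  ((h.adm.hist_mu i hi0).mono (ℱ.mono hi) le_rfl).const_div 1

lemma inBox (h : Regime S M P ℱ β ρ σ C m) {i : ℕ} (hi : 1 ≤ i) (i' : ℕ) (ω : Ω) :
    InBox (1 / M.muLo) (1 / M.lam M.pLo) (S.svc i ω) (S.iat M i' ω) :=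
  Model.inBox h.std h.stable (h.adm.mu_mem i hi ω) (h.adm.p_mem i' ω)

lemma iat_ge (h : Regime S M P ℱ β ρ σ C m) (i : ℕ) (ω : Ω) :
    1 / M.lam M.pLo ≤ S.iat M i ω := (h.inBox le_rfl i ω).2.2

lemma measurable_past_input (h : Regime S M P ℱ β ρ σ C m) {k : ℕ} (hk : 1 ≤ k) {n : ℕ}
    (hn : n < S.D k) : Measurable[ℱ (k + 1)] (S.input k n) :=
  (h.adm.histU k hk n hn).prodMk (h.adm.histV k hk n hn)

lemma measurable_start (h : Regime S M P ℱ β ρ σ C m) {k : ℕ} (hk : 1 ≤ k) :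
    Measurable[ℱ k] (S.start M k) := by
  induction k, hk using Nat.le_induction with
  | base => exact h.adm.hist_W0
  | succ k hk ih =>
    rw [Controlled.start_succ S M hk]
    have hm := ℱ.mono (Nat.le_succ k)
    refine measurable_lindleyProc (ih.mono hm le_rfl) _ fun i hi => ⟨?_, ?_, ?_⟩
    · exact (h.measurable_svc hk (Nat.le_succ k))
    · have ht := h.measurable_iat (k := k + 1) (i := k) (by omega) (by omega)
      have ht' := h.measurable_iat (k := k + 1) (i := k - 1) (by omega) (by omega)
      have ha : Measurable[ℱ (k + 1)] (arrSum (S.input k) i) := by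
        unfold arrSum
        refine Finset.measurable_fun_sum _ fun j hj => ?_
        exact (h.measurable_past_input hk ((Finset.mem_range.1 hj).trans hi)).fst
      refine ht.add (Measurable.mul ?_ (ht'.sub ht))
      exact Measurable.ite (measurableSet_le (ht'.mul ha) (ih.mono hm le_rfl)) measurable_const
        measurable_const
    · exact h.measurable_past_input hk hi

lemma start_nonneg (h : Regime S M P ℱ β ρ σ C m) (k : ℕ) (ω : Ω) : 0 ≤ S.start M k ω :=
  Controlled.start_nonneg S M h.adm.W0_nonneg k ω

lemma isMixed (h : Regime S M P ℱ β ρ σ C m) {k : ℕ} (hk : 1 ≤ k) :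
    IsMixed (h.filt hk) (S.input k) (1 / M.muLo) (1 / M.lam M.pLo) (S.svc k) (S.iat M (k - 1))
      (S.iat M k) (S.proc M k) := by
  have hw : Measurable[h.filt hk 0] (S.start M k) :=
    (h.measurable_start hk).mono (h.le_filt hk 0) le_rfl
  have hto : Measurable[h.filt hk 0] (S.iat M (k - 1)) :=
    (h.measurable_iat hk (Nat.sub_le k 1)).mono (h.le_filt hk 0) le_rfl
  have ht : Measurable[h.filt hk 0] (S.iat M k) :=
    (h.measurable_iat hk le_rfl).mono (h.le_filt hk 0) le_rfl
  refine ⟨⟨fun n => ?_, fun n => ?_, hw, h.start_nonneg k, fun n ω => ?_, fun n ω => rfl⟩,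
    hto, ht, fun ω => ⟨h.iat_ge _ ω, h.iat_ge _ ω⟩⟩
  · exact (h.measurable_svc hk le_rfl).mono (h.le_filt hk n) le_rfl
  · exact measurable_mixRate (h.innov hk) hw hto ht n
  · have hb := h.inBox hk k ω
    exact ⟨hb.1, hb.2.1, mixRate_ge (h.iat_ge _ ω) (h.iat_ge _ ω)⟩

/-- Each step preserves the level `m`, and a cycle begins where the previous one ended; hence the
bound does not deteriorate with the number or the length of the cycles. -/
lemma exp_proc (h : Regime S M P ℱ β ρ σ C m) {k : ℕ} (hk : 1 ≤ k) (n : ℕ) :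
    Integrable (fun ω => Real.exp (2 * β * S.proc M k n ω)) P ∧
      ∫ ω, Real.exp (2 * β * S.proc M k n ω) ∂P ≤ m := by
  induction k, hk using Nat.le_induction generalizing n with
  | base =>
    exact (h.isMixed le_rfl).1.exp_moment (h.innov le_rfl) h.tilted h.m_le h.int0 h.le0 n
  | succ k hk ih =>
    have e : S.proc M (k + 1) 0 = S.proc M k (S.D k) := Controlled.start_succ S M hk
    exact (h.isMixed _).1.exp_moment (h.innov (by omega)) h.tilted h.m_le
      (by rw [e]; exact (ih (S.D k)).1) (by rw [e]; exact (ih (S.D k)).2) n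

lemma ae_nonneg (h : Regime S M P ℱ β ρ σ C m) :
    ∀ᵐ ω ∂P, ∀ k, 1 ≤ k → ∀ n, 0 ≤ S.U k n ω ∧ 0 ≤ S.V k n ω := by
  rw [ae_all_iff]
  intro k
  rw [eventually_imp_distrib_left]
  intro hk
  exact (h.innov hk).ae_nonneg h.tilted.nonneg

end Regime

/-! ### The reference process with a frozen decision -/

namespace Controlled

/-- Initial waiting time of cycle `j + l` of the queue that starts empty in cycle `j` and is
operated under the decision of cycle `j` throughout. -/
noncomputable def ref (S : Controlled Ω) (M : Model) (j : ℕ) : ℕ → Ω → ℝ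
  | 0 => fun _ => 0
  | l + 1 => lindleyProc (S.input (j + l)) (fun _ => S.svc j) (fun _ => S.iat M j)
      (ref S M j l) (S.D (j + l))

/-- Waiting times in cycle `j + l` of the reference process. -/
noncomputable def refProc (S : Controlled Ω) (M : Model) (j l : ℕ) : ℕ → Ω → ℝ :=
  lindleyProc (S.input (j + l)) (fun _ => S.svc j) (fun _ => S.iat M j) (S.ref M j l)

/-- Number of customers in the cycles `j, …, j + l - 1`. -/
def customers (S : Controlled Ω) (j l : ℕ) : ℕ := ∑ i ∈ Finset.range l, S.D (j + i)

lemma ref_succ (S : Controlled Ω) (M : Model) (j l : ℕ) :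
    S.ref M j (l + 1) = S.refProc M j l (S.D (j + l)) := rfl

lemma ref_nonneg (S : Controlled Ω) (M : Model) (j l : ℕ) (ω : Ω) : 0 ≤ S.ref M j l ω := by
  induction l with
  | zero => exact le_rfl
  | succ l ih =>
    rw [ref_succ]
    unfold refProc
    cases S.D (j + l) with
    | zero => exact ih
    | succ n => exact lindley_nonneg _ _ _ _

end Controlled

namespace Regime

variable {S : Controlled Ω} {M : Model} {P : Measure Ω} [IsProbabilityMeasure P]
  {ℱ : Filtration ℕ mΩ} {β ρ σ C m : ℝ}

lemma measurable_ref (h : Regime S M P ℱ β ρ σ C m) {j : ℕ} (hj : 1 ≤ j) (l : ℕ) :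
    Measurable[ℱ (j + l)] (S.ref M j l) := by
  induction l with
  | zero => exact measurable_const
  | succ l ih =>
    refine measurable_lindleyProc (ih.mono (ℱ.mono (by omega)) le_rfl) _ fun i hi => ⟨?_, ?_, ?_⟩
    · exact h.measurable_svc hj (by omega)
    · exact h.measurable_iat (by omega) (by omega)
    · exact h.measurable_past_input (by omega) hi

lemma isLindley_ref (h : Regime S M P ℱ β ρ σ C m) {j l : ℕ} (hj : 1 ≤ j) (hk : 1 ≤ j + l) :
    IsLindley (h.filt hk) (S.input (j + l)) (1 / M.muLo) (1 / M.lam M.pLo) (fun _ => S.svc j)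
      (fun _ => S.iat M j) (S.refProc M j l) where
  meas_s n := (h.measurable_svc hj (by omega)).mono (h.le_filt hk n) le_rfl
  meas_t n := (h.measurable_iat hk (by omega)).mono (h.le_filt hk n) le_rfl
  meas_zero := (h.measurable_ref hj l).mono (h.le_filt hk 0) le_rfl
  nonneg_zero := S.ref_nonneg M j l
  box _ ω := h.inBox hj j ω
  step _ _ := rfl

lemma exp_ref (h : Regime S M P ℱ β ρ σ C m) {j : ℕ} (hj : 1 ≤ j) (l n : ℕ) :
    Integrable (fun ω => Real.exp (2 * β * S.refProc M j l n ω)) P ∧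
      ∫ ω, Real.exp (2 * β * S.refProc M j l n ω) ∂P ≤ m := by
  induction l generalizing n with
  | zero =>
    have e : S.refProc M j 0 0 = fun _ => 0 := rfl
    refine (h.isLindley_ref (l := 0) hj (by omega)).exp_moment (h.innov (by omega)) h.tilted
      h.m_le (by simp [e]) ?_ n
    simpa [e] using h.one_le
  | succ l ih =>
    have e : S.refProc M j (l + 1) 0 = S.refProc M j l (S.D (j + l)) := rfl
    exact (h.isLindley_ref (l := l + 1) hj (by omega)).exp_moment (h.innov (by omega)) h.tilted
      h.m_le (by rw [e]; exact (ih (S.D (j + l))).1) (by rw [e]; exact (ih (S.D (j + l))).2) n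

lemma integrable_of_exp (h : Regime S M P ℱ β ρ σ C m) {X : Ω → ℝ} (hX : Measurable X)
    (h0 : ∀ ω, 0 ≤ X ω) (hi : Integrable (fun ω => Real.exp (2 * β * X ω)) P) :
    Integrable X P := by
  have := h.tilted.β_pos
  refine (hi.const_mul (1 / (2 * β))).mono' hX.aestronglyMeasurable (ae_of_all _ fun ω => ?_)
  rw [Real.norm_eq_abs, abs_of_nonneg (h0 ω)]
  exact id_le_inv_mul_exp (by positivity)

lemma integrable_proc (h : Regime S M P ℱ β ρ σ C m) {k : ℕ} (hk : 1 ≤ k) (n : ℕ) :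
    Integrable (S.proc M k n) P :=
  h.integrable_of_exp ((h.isMixed hk).1.measurable' (h.innov hk) n)
    (fun ω => (h.isMixed hk).1.nonneg n ω) (h.exp_proc hk n).1

lemma integrable_refProc (h : Regime S M P ℱ β ρ σ C m) {j : ℕ} (hj : 1 ≤ j) (l n : ℕ) :
    Integrable (S.refProc M j l n) P :=
  h.integrable_of_exp ((h.isLindley_ref hj (by omega)).measurable' (h.innov (by omega)) n)
    (fun ω => (h.isLindley_ref hj (by omega)).nonneg n ω) (h.exp_ref hj l n).1

/-- The reference process has the mean waiting times of the frozen decision. -/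
lemma integral_mul_ref (h : Regime S M P ℱ β ρ σ C m) {j : ℕ} (hj : 1 ≤ j) {b : Ω → ℝ}
    (hb : Measurable[ℱ j] b) {K : ℝ} (hbK : ∀ ω, |b ω| ≤ K) (l q : ℕ) :
    ∫ ω, b ω * meanWait (M.lawU.prod M.lawV) q (S.svc j ω) (S.iat M j ω) (S.ref M j l ω) ∂P
      = ∫ ω, b ω * meanWait (M.lawU.prod M.lawV) (q + S.customers j l) (S.svc j ω) (S.iat M j ω)
          0 ∂P := by
  induction l generalizing q with
  | zero => simp [Controlled.ref, Controlled.customers]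
  | succ l ih =>
    have hk : 1 ≤ j + l := by omega
    have hb' : Measurable[h.filt hk 0] b :=
      hb.mono ((ℱ.mono (Nat.le_add_right j l)).trans (h.le_filt hk 0)) le_rfl
    have h1 := (h.isLindley_ref hj hk).integral_mul_meanWait h.tilted (h.innov hk)
      (fun n => h.integrable_refProc hj l n) hb' hbK q (S.D (j + l))
    rw [Controlled.ref_succ, h1]
    have h2 := ih (q + S.D (j + l))
    have e : q + S.customers j (l + 1) = q + S.D (j + l) + S.customers j l := by
      unfold Controlled.customers; rw [Finset.sum_range_succ]; ring
    rw [e]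
    exact h2

end Regime

end

end GIGIOne

/-! ### Distance of the controlled queue from the reference queue -/

namespace GIGIOne

set_option linter.unusedSectionVars false

section

variable {Ω : Type*}

namespace Controlled

/-- Distance of the decisions of the cycles `i` and `j`. -/
noncomputable def dd (S : Controlled Ω) (M : Model) (i j : ℕ) (ω : Ω) : ℝ :=
  |S.svc i ω - S.svc j ω| + |S.iat M i ω - S.iat M j ω| + |S.p i ω - S.p j ω|

/-- Size of the price change at the beginning of cycle `i`. -/
noncomputable def jump (S : Controlled Ω) (M : Model) (i : ℕ) (ω : Ω) : ℝ :=
  |S.iat M (i - 1) ω - S.iat M i ω| + |S.p (i - 1) ω - S.p i ω|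

lemma dd_nonneg (S : Controlled Ω) (M : Model) (i j : ℕ) (ω : Ω) : 0 ≤ S.dd M i j ω := by
  unfold dd; positivity

lemma jump_nonneg (S : Controlled Ω) (M : Model) (i : ℕ) (ω : Ω) : 0 ≤ S.jump M i ω := by
  unfold jump; positivity

end Controlled

variable [mΩ : MeasurableSpace Ω]

/-- The decisions of the cycles `j, …, j + l + 1` are close in mean square, at scale `κ⁻¹`. -/
structure Close (S : Controlled Ω) (M : Model) (P : Measure Ω) (j l : ℕ) (κ b : ℝ) : Prop where
  dd_le : ∀ i ≤ l + 1, Integrable (fun ω => S.dd M (j + i) j ω ^ 2) P ∧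
    ∫ ω, S.dd M (j + i) j ω ^ 2 ∂P ≤ b / κ ^ 2
  jump_le : ∀ i ≤ l, Integrable (fun ω => S.jump M (j + i) ω ^ 2) P ∧
    ∫ ω, S.jump M (j + i) ω ^ 2 ∂P ≤ b / κ ^ 2
  next_le : Integrable (fun ω => S.dd M (j + l + 1) (j + l) ω ^ 2) P ∧
    ∫ ω, S.dd M (j + l + 1) (j + l) ω ^ 2 ∂P ≤ b / κ ^ 2

/-- The product is split as y E ≤ κ y²/2 + E²/(2κ). A mean square of order κ^{-2} thus yields order
κ^{-1} despite the weight, and E² is the reason for requiring moments of order 2β. -/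
lemma mul_exp_moment_le {P : Measure Ω} [IsProbabilityMeasure P] {y X X' : Ω → ℝ} {κ b m β : ℝ}
    (hκ : 0 < κ) (hy : Measurable y) (hy0 : ∀ ω, 0 ≤ y ω) (hX : Measurable X)
    (hX' : Measurable X')
    (hyi : Integrable (fun ω => y ω ^ 2) P) (hyb : ∫ ω, y ω ^ 2 ∂P ≤ b / κ ^ 2)
    (hi : Integrable (fun ω => Real.exp (2 * β * X ω)) P ∧
      ∫ ω, Real.exp (2 * β * X ω) ∂P ≤ m)
    (hi' : Integrable (fun ω => Real.exp (2 * β * X' ω)) P ∧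
      ∫ ω, Real.exp (2 * β * X' ω) ∂P ≤ m) :
    Integrable (fun ω => y ω * Real.exp (β * max (X ω) (X' ω))) P ∧
      ∫ ω, y ω * Real.exp (β * max (X ω) (X' ω)) ∂P ≤ (b / 2 + m) / κ := by
  have h1 : Integrable (fun ω => Real.exp (2 * β * X ω) + Real.exp (2 * β * X' ω)) P :=
    hi.1.add hi'.1
  have h2 : Integrable (fun ω => κ / 2 * y ω ^ 2
      + 1 / (2 * κ) * (Real.exp (2 * β * X ω) + Real.exp (2 * β * X' ω))) P :=
    (hyi.const_mul _).add (h1.const_mul _)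
  have hle : ∀ ω, y ω * Real.exp (β * max (X ω) (X' ω)) ≤ κ / 2 * y ω ^ 2
      + 1 / (2 * κ) * (Real.exp (2 * β * X ω) + Real.exp (2 * β * X' ω)) := by
    intro ω
    set E := Real.exp (β * max (X ω) (X' ω)) with hE
    have h3 : E ^ 2 ≤ Real.exp (2 * β * X ω) + Real.exp (2 * β * X' ω) := by
      rw [hE, ← Real.exp_nat_mul]
      rcases max_choice (X ω) (X' ω) with h | h <;> rw [h]
      · refine le_trans (le_of_eq ?_) (le_add_of_nonneg_right (Real.exp_pos _).le)
        congr 1; push_cast; ring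
      · refine le_trans (le_of_eq ?_) (le_add_of_nonneg_left (Real.exp_pos _).le)
        congr 1; push_cast; ring
    have h4 : κ / 2 * y ω ^ 2 + 1 / (2 * κ) * E ^ 2 - y ω * E
        = 1 / (2 * κ) * (κ * y ω - E) ^ 2 := by field_simp; ring
    have h5 : 0 ≤ 1 / (2 * κ) * (κ * y ω - E) ^ 2 := by positivity
    have h6 := mul_le_mul_of_nonneg_left h3 (show 0 ≤ 1 / (2 * κ) by positivity)
    linarith
  have hint : Integrable (fun ω => y ω * Real.exp (β * max (X ω) (X' ω))) P := by
    refine h2.mono' (hy.mul ((hX.max hX').const_mul β).exp).aestronglyMeasurable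
      (ae_of_all _ fun ω => ?_)
    rw [Real.norm_eq_abs, abs_of_nonneg (mul_nonneg (hy0 ω) (Real.exp_pos _).le)]
    exact hle ω
  refine ⟨hint, (integral_mono hint h2 hle).trans ?_⟩
  rw [integral_add (hyi.const_mul _) (h1.const_mul _), integral_const_mul, integral_const_mul,
    integral_add hi.1 hi'.1]
  have h7 := mul_le_mul_of_nonneg_left hyb (show 0 ≤ κ / 2 by positivity)
  have h8 := mul_le_mul_of_nonneg_left (add_le_add hi.2 hi'.2) (show 0 ≤ 1 / (2 * κ) by positivity)
  have e : κ / 2 * (b / κ ^ 2) + 1 / (2 * κ) * (m + m) = (b / 2 + m) / κ := by field_simp; ring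
  linarith

lemma sq_add_moment_le {P : Measure Ω} {x y : Ω → ℝ} {a : ℝ} (hx : Measurable x)
    (hy : Measurable y) (hxi : Integrable (fun ω => x ω ^ 2) P ∧ ∫ ω, x ω ^ 2 ∂P ≤ a)
    (hyi : Integrable (fun ω => y ω ^ 2) P ∧ ∫ ω, y ω ^ 2 ∂P ≤ a) :
    Integrable (fun ω => (x ω + y ω) ^ 2) P ∧ ∫ ω, (x ω + y ω) ^ 2 ∂P ≤ 4 * a := by
  have h1 : Integrable (fun ω => 2 * x ω ^ 2 + 2 * y ω ^ 2) P :=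
    (hxi.1.const_mul 2).add (hyi.1.const_mul 2)
  have hle : ∀ ω, (x ω + y ω) ^ 2 ≤ 2 * x ω ^ 2 + 2 * y ω ^ 2 := fun ω => by
    nlinarith [sq_nonneg (x ω - y ω)]
  have hint : Integrable (fun ω => (x ω + y ω) ^ 2) P := by
    refine h1.mono' ((hx.add hy).pow_const 2).aestronglyMeasurable (ae_of_all _ fun ω => ?_)
    rw [Real.norm_eq_abs, abs_of_nonneg (sq_nonneg _)]
    exact hle ω
  refine ⟨hint, (integral_mono hint h1 hle).trans ?_⟩
  rw [integral_add (hxi.1.const_mul 2) (hyi.1.const_mul 2), integral_const_mul,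
    integral_const_mul]
  linarith [hxi.2, hyi.2]

namespace Regime

variable {S : Controlled Ω} {M : Model} {P : Measure Ω} [IsProbabilityMeasure P]
  {ℱ : Filtration ℕ mΩ} {β ρ σ C m : ℝ}

lemma measurable_dd (h : Regime S M P ℱ β ρ σ C m) {i j k : ℕ} (hi0 : 1 ≤ i) (hj0 : 1 ≤ j)
    (hi : i ≤ k) (hj : j ≤ k) : Measurable[ℱ k] (S.dd M i j) :=
  ((measurable_abs_comp ((h.measurable_svc hi0 hi).sub (h.measurable_svc hj0 hj))).add
    (measurable_abs_comp ((h.measurable_iat (hi0.trans hi) hi).sub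
      (h.measurable_iat (hi0.trans hi) hj)))).add
    (measurable_abs_comp ((h.measurable_p (hi0.trans hi) hi).sub
      (h.measurable_p (hi0.trans hi) hj)))

lemma measurable_jump (h : Regime S M P ℱ β ρ σ C m) {i k : ℕ} (hk : 1 ≤ k) (hi : i ≤ k) :
    Measurable[ℱ k] (S.jump M i) :=
  (measurable_abs_comp ((h.measurable_iat hk ((Nat.sub_le i 1).trans hi)).sub
      (h.measurable_iat hk hi))).add
    (measurable_abs_comp ((h.measurable_p hk ((Nat.sub_le i 1).trans hi)).sub
      (h.measurable_p hk hi)))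

/-- Bound for expectations of small factors with exponential weights. -/
noncomputable def small (m κ b : ℝ) : ℝ := (2 * b + m) / κ

lemma small_nonneg {κ b : ℝ} (h : Regime S M P ℱ β ρ σ C m) (hκ : 0 < κ) (hb : 0 ≤ b) :
    0 ≤ small m κ b := by
  have := h.one_le
  unfold small; positivity

lemma measurable_start' (h : Regime S M P ℱ β ρ σ C m) {k : ℕ} (hk : 1 ≤ k) :
    Measurable (S.start M k) := (h.measurable_start hk).mono (ℱ.le k) le_rfl

lemma measurable_ref' (h : Regime S M P ℱ β ρ σ C m) {j : ℕ} (hj : 1 ≤ j) (l : ℕ) :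
    Measurable (S.ref M j l) := (h.measurable_ref hj l).mono (ℱ.le _) le_rfl

lemma exp_start (h : Regime S M P ℱ β ρ σ C m) {k : ℕ} (hk : 1 ≤ k) :
    Integrable (fun ω => Real.exp (2 * β * S.start M k ω)) P ∧
      ∫ ω, Real.exp (2 * β * S.start M k ω) ∂P ≤ m := h.exp_proc hk 0

lemma exp_refStart (h : Regime S M P ℱ β ρ σ C m) {j : ℕ} (hj : 1 ≤ j) (l : ℕ) :
    Integrable (fun ω => Real.exp (2 * β * S.ref M j l ω)) P ∧
      ∫ ω, Real.exp (2 * β * S.ref M j l ω) ∂P ≤ m := h.exp_ref hj l 0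

/-- Bound for the weighted distance to the reference process. -/
noncomputable def gap (β ρ C m κ b : ℝ) (l N : ℕ) : ℝ :=
  ρ ^ N * (m / β) + l * (C * small m κ b / (1 - ρ))

variable {j l : ℕ} {κ b : ℝ}

/-- The sum dominates the difference between the parameters of the queue and those of the reference,
whether a customer still belongs to the old price or not. -/
lemma dd_add_jump (h : Regime S M P ℱ β ρ σ C m) (hc : Close S M P j l κ b) (hj : 1 ≤ j)
    (hκ : 0 < κ) {i : ℕ} (hi : i ≤ l) {X X' : Ω → ℝ} (hX : Measurable X)
    (hX' : Measurable X') (hi1 : Integrable (fun ω => Real.exp (2 * β * X ω)) P ∧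
      ∫ ω, Real.exp (2 * β * X ω) ∂P ≤ m)
    (hi2 : Integrable (fun ω => Real.exp (2 * β * X' ω)) P ∧
      ∫ ω, Real.exp (2 * β * X' ω) ∂P ≤ m) :
    Integrable (fun ω => (S.dd M (j + i) j ω + S.jump M (j + i) ω)
        * Real.exp (β * max (X ω) (X' ω))) P ∧
      ∫ ω, (S.dd M (j + i) j ω + S.jump M (j + i) ω) * Real.exp (β * max (X ω) (X' ω)) ∂P
        ≤ small m κ b := by
  have m1 : Measurable (S.dd M (j + i) j) :=
    (h.measurable_dd (by omega) hj le_rfl (by omega)).mono (ℱ.le (j + i)) le_rfl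
  have m2 : Measurable (S.jump M (j + i)) :=
    (h.measurable_jump (by omega) le_rfl).mono (ℱ.le (j + i)) le_rfl
  have hs := sq_add_moment_le m1 m2 (hc.dd_le i (by omega)) (hc.jump_le i hi)
  have := mul_exp_moment_le (b := 4 * b) hκ (m1.add m2)
    (fun ω => add_nonneg (S.dd_nonneg M _ _ ω) (S.jump_nonneg M _ ω)) hX hX' hs.1
    (hs.2.trans_eq (by ring)) hi1 hi2
  refine ⟨this.1, this.2.trans_eq ?_⟩
  unfold small; ring

/-- The queue is close to the reference process. -/
lemma dist_ref_le (h : Regime S M P ℱ β ρ σ C m) (hc : Close S M P j l κ b) (hj : 1 ≤ j)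
    (hκ : 0 < κ) (hb : 0 ≤ b) {i : ℕ} (hi : i ≤ l + 1) :
    Integrable (fun ω => |S.start M (j + i) ω - S.ref M j i ω|
        * Real.exp (β * max (S.start M (j + i) ω) (S.ref M j i ω))) P ∧
      ∫ ω, |S.start M (j + i) ω - S.ref M j i ω|
        * Real.exp (β * max (S.start M (j + i) ω) (S.ref M j i ω)) ∂P
        ≤ gap β ρ C m κ b i (S.customers j i) := by
  have H := h.tilted
  have hβ := H.β_pos
  have h1ρ : 0 < 1 - ρ := sub_pos.2 (H.ρ_lt.trans H.σ_lt)
  have hsm := h.small_nonneg hκ hb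
  induction i with
  | zero =>
    -- The reference starts empty, so the weighted distance is w e^{βw} ≤ e^{2βw}/β, which has mean
    -- at most m/β.
    have hle : ∀ ω, |S.start M (j + 0) ω - S.ref M j 0 ω|
        * Real.exp (β * max (S.start M (j + 0) ω) (S.ref M j 0 ω))
        ≤ 1 / β * Real.exp (2 * β * S.start M j ω) := by
      intro ω
      have h0 := h.start_nonneg j ω
      have e : S.ref M j 0 ω = 0 := rfl
      rw [Nat.add_zero, e, sub_zero, abs_of_nonneg h0, max_eq_left h0]
      have h1 := mul_le_mul_of_nonneg_right (id_le_inv_mul_exp (x := S.start M j ω) hβ)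
        (Real.exp_pos (β * S.start M j ω)).le
      rwa [mul_assoc, ← Real.exp_add, show β * S.start M j ω + β * S.start M j ω
        = 2 * β * S.start M j ω by ring] at h1
    have hi := ((h.exp_start hj).1.const_mul (1 / β))
    have hint : Integrable (fun ω => |S.start M (j + 0) ω - S.ref M j 0 ω|
        * Real.exp (β * max (S.start M (j + 0) ω) (S.ref M j 0 ω))) P := by
      have hm1 := h.measurable_start' hj
      have hm2 := h.measurable_ref' hj 0
      refine hi.mono' ((measurable_abs_comp (hm1.sub hm2)).mul
        ((hm1.max hm2).const_mul β).exp).aestronglyMeasurable (ae_of_all _ fun ω => ?_)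
      rw [Real.norm_eq_abs, abs_of_nonneg (by positivity)]
      exact hle ω
    refine ⟨hint, (integral_mono hint hi hle).trans ?_⟩
    rw [integral_const_mul]
    unfold gap Controlled.customers
    simp only [Finset.range_zero, Finset.sum_empty, pow_zero, one_mul, Nat.cast_zero, zero_mul,
      add_zero]
    have := mul_le_mul_of_nonneg_left (h.exp_start hj).2 (show 0 ≤ 1 / β by positivity)
    refine this.trans_eq (by ring)
  | succ i ih =>
    have hk : 1 ≤ j + i := by omega
    obtain ⟨ih1, ih2⟩ := ih (by omega)
    have hL := h.isMixed hk
    have hL' := h.isLindley_ref (l := i) hj hk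
    have I := h.innov hk
    have hδ : Measurable[h.filt hk 0] fun ω => S.dd M (j + i) j ω + S.jump M (j + i) ω :=
      ((h.measurable_dd hk hj le_rfl (by omega)).add (h.measurable_jump hk le_rfl)).mono
        (h.le_filt hk 0) le_rfl
    have hdist := hL.1.dist_le hL' I H hδ (B := small m κ b) (fun n ω => ?_)
      (fun n => h.dd_add_jump hc hj hκ (by omega) (hL.1.measurable' I n) (hL'.measurable' I n)
        (h.exp_proc hk n) (h.exp_ref hj i n)) ih1 ih2 (S.D (j + i))
    · have e1 : S.start M (j + (i + 1)) = S.proc M (j + i) (S.D (j + i)) :=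
        Controlled.start_succ S M hk
      have e2 : S.ref M j (i + 1) = S.refProc M j i (S.D (j + i)) := rfl
      rw [e1, e2]
      refine ⟨hdist.1, hdist.2.trans ?_⟩
      unfold gap
      have e3 : S.customers j (i + 1) = S.customers j i + S.D (j + i) := by
        unfold Controlled.customers; rw [Finset.sum_range_succ]
      rw [e3, pow_add]
      -- Only the initial distance keeps its geometric factor. The errors added by earlier cycles
      -- are not discounted, since there are at most `l + 1` of them.
      have hp : ρ ^ S.D (j + i) ≤ 1 := pow_le_one₀ H.ρ_pos.le (H.ρ_lt.trans H.σ_lt).le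
      have hq : 0 ≤ (i : ℝ) * (C * small m κ b / (1 - ρ)) := by
        have := H.C_pos; positivity
      have hr := mul_le_mul_of_nonneg_right hp hq
      push_cast
      linarith
    · have h1 : mixRate (S.input (j + i)) (S.proc M (j + i) 0) (S.iat M (j + i - 1))
          (S.iat M (j + i)) n ω - S.iat M j ω = (S.iat M (j + i) ω - S.iat M j ω)
          + oldInd (S.input (j + i)) (S.proc M (j + i) 0) (S.iat M (j + i - 1)) n ω
            * (S.iat M (j + i - 1) ω - S.iat M (j + i) ω) := by unfold mixRate; ring
      have h2 := abs_add_le (S.iat M (j + i) ω - S.iat M j ω)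
        (oldInd (S.input (j + i)) (S.proc M (j + i) 0) (S.iat M (j + i - 1)) n ω
            * (S.iat M (j + i - 1) ω - S.iat M (j + i) ω))
      rw [← h1, abs_mul, abs_of_nonneg (oldInd_mem _ _ _ _ _).1] at h2
      have h3 := mul_le_of_le_one_left (abs_nonneg (S.iat M (j + i - 1) ω - S.iat M (j + i) ω))
        (oldInd_mem (S.input (j + i)) (S.proc M (j + i) 0) (S.iat M (j + i - 1)) n ω).2
      have h4 := abs_nonneg (S.p (j + i) ω - S.p j ω)
      have h5 := abs_nonneg (S.p (j + i - 1) ω - S.p (j + i) ω)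
      unfold Controlled.dd Controlled.jump
      linarith

lemma integrable_meanWait (h : Regime S M P ℱ β ρ σ C m) {i : ℕ} (hi : 1 ≤ i) {w : Ω → ℝ}
    (hw : Measurable w) (hw0 : ∀ ω, 0 ≤ w ω) (hwi : Integrable w P) (n : ℕ) :
    Integrable (fun ω => meanWait (M.lawU.prod M.lawV) n (S.svc i ω) (S.iat M i ω) (w ω)) P := by
  have := h.tilted.prob
  refine (hwi.add (integrable_const (n * (1 / M.muLo)))).mono'
    (measurable_meanWait_comp n ((h.measurable_svc hi le_rfl).mono (ℱ.le i) le_rfl)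
      ((h.measurable_iat hi le_rfl).mono (ℱ.le i) le_rfl) hw).aestronglyMeasurable
    (ae_of_all _ fun ω => ?_)
  rw [Real.norm_eq_abs]
  exact h.tilted.abs_meanWait_le n (h.inBox hi i ω) (hw0 ω)

lemma measurable_steadyWait (h : Regime S M P ℱ β ρ σ C m) {i k : ℕ} (hi : 1 ≤ i) (hik : i ≤ k) :
    Measurable[ℱ k] fun ω => steadyWait (M.lawU.prod M.lawV) (S.svc i ω) (S.iat M i ω) := by
  have := h.tilted.prob
  refine @measurable_of_tendsto_metrizable Ω ℝ (ℱ k) _ _ _ _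
    (fun n ω => meanWait (M.lawU.prod M.lawV) n (S.svc i ω) (S.iat M i ω) 0) _
    (fun n => measurable_meanWait_comp n (h.measurable_svc hi hik)
      (h.measurable_iat (hi.trans hik) hik) measurable_const) ?_
  rw [tendsto_pi_nhds]
  exact fun ω => h.tilted.tendsto_meanWait (h.inBox hi i ω)

lemma integrable_steadyWait (h : Regime S M P ℱ β ρ σ C m) {i : ℕ} (hi : 1 ≤ i) :
    Integrable (fun ω => steadyWait (M.lawU.prod M.lawV) (S.svc i ω) (S.iat M i ω)) P := by
  refine (integrable_const (1 / M.muLo * C / (1 - ρ))).mono'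
    ((h.measurable_steadyWait hi le_rfl).mono (ℱ.le i) le_rfl).aestronglyMeasurable
    (ae_of_all _ fun ω => ?_)
  exact h.tilted.abs_steadyWait_le (h.inBox hi i ω)

lemma integrable_start (h : Regime S M P ℱ β ρ σ C m) {k : ℕ} (hk : 1 ≤ k) :
    Integrable (S.start M k) P := h.integrable_proc hk 0

lemma integrable_refStart (h : Regime S M P ℱ β ρ σ C m) {j : ℕ} (hj : 1 ≤ j) (l : ℕ) :
    Integrable (S.ref M j l) P := h.integrable_refProc hj l 0

/-- The waiting times of a cycle deviate little from their steady-state means. -/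
lemma abs_integral_wait_sub_le (h : Regime S M P ℱ β ρ σ C m) (hc : Close S M P j l κ b)
    (hj : 1 ≤ j) (hκ : 0 < κ) (hb : 0 ≤ b) (D : ℕ) :
    |∫ ω, ∑ i ∈ Finset.range D, (S.proc M (j + l) (i + 1) ω
        - steadyWait (M.lawU.prod M.lawV) (S.svc (j + l) ω) (S.iat M (j + l) ω)) ∂P|
      ≤ sens ρ σ C / (1 - σ) * small m κ b
        + transLip ρ σ C * (gap β ρ C m κ b l (S.customers j l) + small m κ b)
        + 1 / M.muLo * C / (1 - ρ) ^ 2 * ρ ^ S.customers j l := by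
  have H := h.tilted
  have hprob := H.prob
  have hk : 1 ≤ j + l := by omega
  have hσ := H.σ_pos
  have h1σ : 0 < 1 - σ := sub_pos.2 H.σ_lt
  have hsm := h.small_nonneg hκ hb
  have I := h.innov hk
  have L := h.isMixed hk
  set k := j + l with hkdef
  set ν := M.lawU.prod M.lawV with hν
  set N := S.customers j l with hN
  have hsteady := h.integrable_steadyWait hk
  have hsteadyj := h.integrable_steadyWait hj
  -- comparison with the mean waiting times under the current decision
  have hjump : Integrable (fun ω => |S.iat M (k - 1) ω - S.iat M k ω|
        * Real.exp (β * S.proc M k 0 ω)) P ∧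
      ∫ ω, |S.iat M (k - 1) ω - S.iat M k ω| * Real.exp (β * S.proc M k 0 ω) ∂P
        ≤ small m κ b := by
    have h1 := h.dd_add_jump hc hj hκ le_rfl (h.measurable_start' hk) (h.measurable_start' hk)
      (h.exp_start hk) (h.exp_start hk)
    have hle : ∀ ω, |S.iat M (k - 1) ω - S.iat M k ω| * Real.exp (β * S.proc M k 0 ω)
        ≤ (S.dd M (j + l) j ω + S.jump M (j + l) ω)
          * Real.exp (β * max (S.start M k ω) (S.start M k ω)) := by
      intro ω
      rw [max_self]
      refine mul_le_mul_of_nonneg_right ?_ (Real.exp_pos _).le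
      have h2 := S.dd_nonneg M (j + l) j ω
      have h3 := abs_nonneg (S.p (j + l - 1) ω - S.p (j + l) ω)
      unfold Controlled.jump
      linarith
    have hm1 : Measurable fun ω => |S.iat M (k - 1) ω - S.iat M k ω|
        * Real.exp (β * S.proc M k 0 ω) :=
      (measurable_abs_comp (((h.measurable_iat hk (Nat.sub_le k 1)).mono (ℱ.le k) le_rfl).sub
        ((h.measurable_iat hk le_rfl).mono (ℱ.le k) le_rfl))).mul
        ((h.measurable_start' hk).const_mul β).exp
    have hint := h1.1.mono' hm1.aestronglyMeasurable (ae_of_all _ fun ω => by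
      rw [Real.norm_eq_abs, abs_of_nonneg (by positivity)]; exact hle ω)
    exact ⟨hint, (integral_mono hint h1.1 hle).trans h1.2⟩
  -- Replaces the path with leftover customers at the old rate by the mean waiting times at the new
  -- rate; the factor σ^i keeps the sum over the cycle bounded.
  have hstep : ∀ i, |∫ ω, S.proc M k (i + 1) ω ∂P
      - ∫ ω, meanWait ν (i + 1) (S.svc k ω) (S.iat M k ω) (S.start M k ω) ∂P|
      ≤ sens ρ σ C * small m κ b * σ ^ i := by
    intro i
    have h1 := L.abs_integral_meanWait_sub_le H I (h.integrable_proc hk) hjump.1 0 (i + 1)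
    rw [Nat.zero_add] at h1
    refine h1.trans ?_
    have hA := H.sens_pos
    have h2 : σ ^ (i + 1) ≤ σ ^ i := pow_le_pow_of_le_one hσ.le H.σ_lt.le (Nat.le_succ i)
    rw [pow_zero, mul_one]
    calc sens ρ σ C * σ ^ (i + 1) * _ ≤ sens ρ σ C * σ ^ i * small m κ b := by
          gcongr; exact hjump.2
      _ = _ := by ring
  have hmwi := fun i => h.integrable_meanWait hk (h.measurable_start' hk) (h.start_nonneg k)
    (h.integrable_start hk) i
  have hmwj := fun i => h.integrable_meanWait hj (h.measurable_ref' hj l) (S.ref_nonneg M j l)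
    (h.integrable_refStart hj l) i
  have hmw0 := fun i => h.integrable_meanWait hj (measurable_const (a := (0 : ℝ)))
    (fun _ => le_rfl) (integrable_const _) i
  have htk : Integrable (fun ω => transient ν D (S.svc k ω) (S.iat M k ω) (S.start M k ω)) P :=
    integrable_finsetSum _ fun i _ => (hmwi (i + 1)).sub hsteady
  have htj : Integrable (fun ω => transient ν D (S.svc j ω) (S.iat M j ω) (S.ref M j l ω)) P :=
    integrable_finsetSum _ fun i _ => (hmwj (i + 1)).sub hsteadyj
  have p1 : |∫ ω, ∑ i ∈ Finset.range D, (S.proc M k (i + 1) ω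
        - steadyWait ν (S.svc k ω) (S.iat M k ω)) ∂P
      - ∫ ω, transient ν D (S.svc k ω) (S.iat M k ω) (S.start M k ω) ∂P|
      ≤ sens ρ σ C / (1 - σ) * small m κ b := by
    unfold transient
    have q1 : ∀ i, Integrable (fun ω => S.proc M k (i + 1) ω
        - steadyWait ν (S.svc k ω) (S.iat M k ω)) P :=
      fun i => (h.integrable_proc hk (i + 1)).sub hsteady
    have q2 : ∀ i, Integrable (fun ω => meanWait ν (i + 1) (S.svc k ω) (S.iat M k ω)
        (S.start M k ω) - steadyWait ν (S.svc k ω) (S.iat M k ω)) P :=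
      fun i => (hmwi (i + 1)).sub hsteady
    rw [integral_finsetSum _ fun i _ => q1 i, integral_finsetSum _ fun i _ => q2 i,
      ← Finset.sum_sub_distrib]
    refine (Finset.abs_sum_le_sum_abs _ _).trans ?_
    have h3 : ∀ i ∈ Finset.range D, |∫ ω, (S.proc M k (i + 1) ω
        - steadyWait ν (S.svc k ω) (S.iat M k ω)) ∂P
        - ∫ ω, (meanWait ν (i + 1) (S.svc k ω) (S.iat M k ω) (S.start M k ω)
        - steadyWait ν (S.svc k ω) (S.iat M k ω)) ∂P| ≤ sens ρ σ C * small m κ b * σ ^ i := by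
      intro i _
      rw [integral_sub (h.integrable_proc hk (i + 1)) hsteady,
        integral_sub (hmwi (i + 1)) hsteady, sub_sub_sub_cancel_right]
      exact hstep i
    refine (Finset.sum_le_sum h3).trans ?_
    rw [← Finset.mul_sum]
    have hA := H.sens_pos
    refine (mul_le_mul_of_nonneg_left (geom_sum_range_le hσ.le H.σ_lt D)
      (by positivity)).trans_eq ?_
    field_simp
  -- Decision and initial state of cycle `k` are replaced together by the frozen decision and the
  -- reference state. The Lipschitz bound for `transient` carries the same weight as the distance
  -- bound.
  have p2 : |∫ ω, transient ν D (S.svc k ω) (S.iat M k ω) (S.start M k ω) ∂P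
      - ∫ ω, transient ν D (S.svc j ω) (S.iat M j ω) (S.ref M j l ω) ∂P|
      ≤ transLip ρ σ C * (gap β ρ C m κ b l N + small m κ b) := by
    have d1 := h.dist_ref_le hc hj hκ hb (Nat.le_succ l)
    have d2 := h.dd_add_jump hc hj hκ le_rfl (h.measurable_start' hk) (h.measurable_ref' hj l)
      (h.exp_start hk) (h.exp_refStart hj l)
    rw [← integral_sub htk htj, ← Real.norm_eq_abs]
    refine (norm_integral_le_of_norm_le ((d1.1.add d2.1).const_mul (transLip ρ σ C))
      (ae_of_all _ fun ω => ?_)).trans ?_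
    · rw [Real.norm_eq_abs]
      refine (H.abs_transient_sub_le D (h.inBox hk k ω) (h.inBox hj j ω) (h.start_nonneg k ω)
        (S.ref_nonneg M j l ω)).trans ?_
      have hT := H.transLip_pos
      simp only [Pi.add_apply]
      rw [mul_assoc, ← add_mul]
      refine mul_le_mul_of_nonneg_left (mul_le_mul_of_nonneg_right ?_ (Real.exp_pos _).le) hT.le
      have h2 := S.jump_nonneg M (j + l) ω
      have h3 := abs_nonneg (S.p (j + l) ω - S.p j ω)
      unfold Controlled.dd
      linarith
    · rw [integral_const_mul]
      refine mul_le_mul_of_nonneg_left ?_ H.transLip_pos.le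
      exact (integral_add d1.1 d2.1).trans_le (add_le_add d1.2 d2.2)
  -- The frozen decision belongs to the history of cycle `j`, so starting from the reference state
  -- only shifts the index of the mean waiting times by `N`.
  have p3 : |∫ ω, transient ν D (S.svc j ω) (S.iat M j ω) (S.ref M j l ω) ∂P|
      ≤ 1 / M.muLo * C / (1 - ρ) ^ 2 * ρ ^ N := by
    have e : ∫ ω, transient ν D (S.svc j ω) (S.iat M j ω) (S.ref M j l ω) ∂P
        = ∫ ω, ∑ i ∈ Finset.range D, (meanWait ν (i + 1 + N) (S.svc j ω) (S.iat M j ω) 0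
          - steadyWait ν (S.svc j ω) (S.iat M j ω)) ∂P := by
      unfold transient
      have q1 : ∀ i, Integrable (fun ω => meanWait ν (i + 1) (S.svc j ω) (S.iat M j ω)
          (S.ref M j l ω) - steadyWait ν (S.svc j ω) (S.iat M j ω)) P :=
        fun i => (hmwj (i + 1)).sub hsteadyj
      have q2 : ∀ i, Integrable (fun ω => meanWait ν (i + 1 + N) (S.svc j ω) (S.iat M j ω) 0
          - steadyWait ν (S.svc j ω) (S.iat M j ω)) P :=
        fun i => (hmw0 (i + 1 + N)).sub hsteadyj
      rw [integral_finsetSum _ fun i _ => q1 i, integral_finsetSum _ fun i _ => q2 i]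
      refine Finset.sum_congr rfl fun i _ => ?_
      rw [integral_sub (hmwj (i + 1)) hsteadyj, integral_sub (hmw0 (i + 1 + N)) hsteadyj]
      congr 1
      have := h.integral_mul_ref hj (b := fun _ => 1) measurable_const (K := 1) (by simp) l (i + 1)
      simpa using this
    rw [e]
    have h5 := norm_integral_le_of_norm_le_const (μ := P) (C := 1 / M.muLo * C / (1 - ρ) ^ 2 * ρ ^ N)
      (f := fun ω => ∑ i ∈ Finset.range D, (meanWait ν (i + 1 + N) (S.svc j ω) (S.iat M j ω) 0
          - steadyWait ν (S.svc j ω) (S.iat M j ω))) (ae_of_all _ fun ω =>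
        H.sum_abs_meanWait_sub_steadyWait_le D N (h.inBox hj j ω))
    simpa using h5
  rw [abs_le] at p1 p2 p3 ⊢
  constructor <;> linarith

end Regime

end

end GIGIOne

namespace GIGIOne

set_option linter.unusedSectionVars false

lemma sum_Icc_one_eq (f : ℕ → ℝ) (D : ℕ) :
    ∑ n ∈ Finset.Icc 1 D, f n = ∑ i ∈ Finset.range D, f (i + 1) := by
  rw [Finset.range_eq_Ico, Finset.sum_Ico_add' f 0 D 1]; rfl

section

variable {Ω : Type*}

/-! ### Decomposition of the regret of nonstationarity -/

namespace Controlled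

variable (S : Controlled Ω) (M : Model)

/-- Steady-state mean waiting time under the decision of cycle `k`. -/
noncomputable def steady (k : ℕ) (ω : Ω) : ℝ :=
  steadyWait (M.lawU.prod M.lawV) (S.svc k ω) (S.iat M k ω)

/-- Steady-state mean of holding cost minus fee of a customer. -/
noncomputable def net (k : ℕ) (ω : Ω) : ℝ :=
  M.h0 * (S.steady M k ω + S.svc k ω) - S.p k ω

/-- Steady-state rate of holding cost minus fees. -/
noncomputable def netRate (k : ℕ) (ω : Ω) : ℝ := S.net M k ω / S.iat M k ω

/-- The contribution of the leftover customer with index `i + 1` to the regret. -/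
noncomputable def oldTerm (k i : ℕ) (ω : Ω) : ℝ :=
  S.old M k i ω * (S.p (k - 1) ω - S.p k ω)
    + S.old M k i ω * (S.netRate M k ω * (S.iat M (k - 1) ω - S.iat M k ω)) * S.U k i ω

/-- Excess of the cycle cost over the steady-state cost. -/
noncomputable def excess (k : ℕ) (ω : Ω) : ℝ :=
  M.h0 * (∑ i ∈ Finset.range (S.D k), (S.proc M k (i + 1) ω - S.steady M k ω))
    + M.h0 * (∑ i ∈ Finset.range (S.D k), (S.service k (i + 1) ω - S.svc k ω))
    + (∑ i ∈ Finset.range (S.D k), S.net M k ω * (1 - S.U k i ω))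
    - (∑ i ∈ Finset.range (S.D k), S.oldTerm M k i ω)
    - S.netRate M k ω * (S.start M (k + 1) ω - S.start M k ω)

variable {S M}

section path

variable {ω : Ω}

lemma T_eq (hlam : ∀ k, 0 < M.lam (S.p k ω)) (hu : ∀ k, 1 ≤ k → ∀ n, 0 ≤ S.U k n ω) {k : ℕ}
    (hk : 1 ≤ k) : S.T M k ω = (∑ i ∈ Finset.range (S.D k),
        S.U k i ω * (S.iat M k ω + S.old M k i ω * (S.iat M (k - 1) ω - S.iat M k ω)))
      + S.start M (k + 1) ω - S.start M k ω := by
  unfold T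
  rw [W_eq hlam hu hk, W_eq hlam hu hk, proc_zero, start_succ S M hk, sum_Icc_one_eq]
  congr 2
  exact Finset.sum_congr rfl fun i _ => (fee_eq hlam hu hk i).2

/-- The staffing cost cancels. The cycle length is the sum of the interarrival times plus the change
of the waiting time, and `netRate` times the mean interarrival time is `net`. Charging `netRate`
over the cycle therefore reproduces `net` per customer, up to centred interarrival times, the
corrections for leftover customers and a terminal term. -/
lemma cycleCost_eq (hlam : ∀ k, 0 < M.lam (S.p k ω)) (hu : ∀ k, 1 ≤ k → ∀ n, 0 ≤ S.U k n ω)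
    {k : ℕ} (hk : 1 ≤ k)
    (hf : M.f (S.mu k ω) (S.p k ω) = S.netRate M k ω + M.cost (S.mu k ω)) :
    S.cycleCost M k ω = S.steadyCost M k ω + S.excess M k ω := by
  have h1 : S.cycleCost M k ω = (∑ i ∈ Finset.range (S.D k),
      (M.h0 * (S.proc M k (i + 1) ω + S.service k (i + 1) ω)
        - (S.p k ω + S.old M k i ω * (S.p (k - 1) ω - S.p k ω))))
      + M.cost (S.mu k ω) * S.T M k ω := by
    unfold cycleCost
    rw [sum_Icc_one_eq]
    congr 1
    exact Finset.sum_congr rfl fun i _ => by rw [W_eq hlam hu hk, (fee_eq hlam hu hk i).1]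
  have ht : S.iat M k ω ≠ 0 := (one_div_pos.2 (hlam k)).ne'
  have h2 : S.netRate M k ω * S.iat M k ω = S.net M k ω := div_mul_cancel₀ _ ht
  have h3 : (∑ i ∈ Finset.range (S.D k),
      (M.h0 * (S.proc M k (i + 1) ω + S.service k (i + 1) ω)
        - (S.p k ω + S.old M k i ω * (S.p (k - 1) ω - S.p k ω))))
      = S.netRate M k ω * (∑ i ∈ Finset.range (S.D k),
        S.U k i ω * (S.iat M k ω + S.old M k i ω * (S.iat M (k - 1) ω - S.iat M k ω)))
      + (M.h0 * (∑ i ∈ Finset.range (S.D k), (S.proc M k (i + 1) ω - S.steady M k ω))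
        + M.h0 * (∑ i ∈ Finset.range (S.D k), (S.service k (i + 1) ω - S.svc k ω))
        + (∑ i ∈ Finset.range (S.D k), S.net M k ω * (1 - S.U k i ω))
        - (∑ i ∈ Finset.range (S.D k), S.oldTerm M k i ω)) := by
    rw [Finset.mul_sum, Finset.mul_sum, Finset.mul_sum, ← Finset.sum_add_distrib,
      ← Finset.sum_add_distrib, ← Finset.sum_sub_distrib, ← Finset.sum_add_distrib]
    refine Finset.sum_congr rfl fun i _ => ?_
    have h4 : S.net M k ω = M.h0 * (S.steady M k ω + S.svc k ω) - S.p k ω := rfl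
    unfold oldTerm
    linear_combination -(S.U k i ω) * h2 - h4
  have h5 : S.steadyCost M k ω = (S.netRate M k ω + M.cost (S.mu k ω)) * S.T M k ω := by
    unfold steadyCost; rw [hf]
  rw [h1, h3, h5, T_eq hlam hu hk]
  unfold excess
  ring

end path

/-- By Little's law both the holding cost and the revenue are the arrival rate times an amount per
customer. -/
lemma f_eq {η θ a γ₀ : ℝ} (hL : M.LightTail η θ a γ₀) (hM : M.Standing) (hS : M.Stable)
    {k : ℕ} {ω : Ω} (hmu : S.mu k ω ∈ Set.Icc M.muLo M.muHi)
    (hp : S.p k ω ∈ Set.Icc M.pLo M.pHi) :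
    M.f (S.mu k ω) (S.p k ω) = S.netRate M k ω + M.cost (S.mu k ω) := by
  unfold Model.f
  rw [M.meanQueue_eq hL hM hS hmu hp]
  unfold netRate net steady svc iat
  have := (hM.lam_pos _ hp).ne'
  field_simp
  ring

end Controlled

end

end GIGIOne

/-! ### Bounds for the steady-state cost per customer and for the simple terms of the decomposition
-/

namespace GIGIOne

set_option linter.unusedSectionVars false

/-- Bound of the steady-state mean waiting times. -/
noncomputable def Model.waitBound (M : Model) (ρ C : ℝ) : ℝ := 1 / M.muLo * C / (1 - ρ)

/-- Bound of the steady-state means of holding cost minus fee. -/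
noncomputable def Model.netBound (M : Model) (ρ C : ℝ) : ℝ :=
  M.h0 * (M.waitBound ρ C + 1 / M.muLo) + max |M.pLo| |M.pHi|

/-- Bound of the steady-state rates of holding cost minus fees. -/
noncomputable def Model.netRateBound (M : Model) (ρ C : ℝ) : ℝ :=
  M.netBound ρ C / (1 / M.lam M.pLo)

/-- Lipschitz constant of the steady-state rates of holding cost minus fees. -/
noncomputable def Model.netRateLip (M : Model) (ρ σ C : ℝ) : ℝ :=
  (M.h0 * (sensIncr ρ σ C / (1 - σ) + 1) + 1) / (1 / M.lam M.pLo)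
    + M.netBound ρ C / (1 / M.lam M.pLo) ^ 2

section

variable {Ω : Type*} [mΩ : MeasurableSpace Ω]

namespace Regime

variable {S : Controlled Ω} {M : Model} {P : Measure Ω} [IsProbabilityMeasure P]
  {ℱ : Filtration ℕ mΩ} {β ρ σ C m : ℝ}

lemma waitBound_nonneg (h : Regime S M P ℱ β ρ σ C m) : 0 ≤ M.waitBound ρ C := by
  have H := h.tilted
  have h1ρ : 0 < 1 - ρ := sub_pos.2 (H.ρ_lt.trans H.σ_lt)
  exact div_nonneg (mul_nonneg H.sHi_pos.le H.C_pos.le) h1ρ.le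

lemma netBound_nonneg (h : Regime S M P ℱ β ρ σ C m) : 0 ≤ M.netBound ρ C :=
  add_nonneg (mul_nonneg h.std.h0_pos.le (add_nonneg h.waitBound_nonneg h.tilted.sHi_pos.le))
    ((abs_nonneg _).trans (le_max_left _ _))

lemma netRateBound_nonneg (h : Regime S M P ℱ β ρ σ C m) : 0 ≤ M.netRateBound ρ C :=
  div_nonneg h.netBound_nonneg h.tilted.tLo_pos.le

lemma netRateLip_nonneg (h : Regime S M P ℱ β ρ σ C m) : 0 ≤ M.netRateLip ρ σ C := by
  have H := h.tilted
  have h1 := H.sensIncr_pos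
  have h2 : 0 < 1 - σ := sub_pos.2 H.σ_lt
  have h3 := h.std.h0_pos
  have h4 := H.tLo_pos
  have h5 := h.netBound_nonneg
  unfold Model.netRateLip
  positivity

lemma abs_net_le (h : Regime S M P ℱ β ρ σ C m) {k : ℕ} (hk : 1 ≤ k) (ω : Ω) :
    |S.net M k ω| ≤ M.netBound ρ C := by
  have h1 : |S.steady M k ω| ≤ M.waitBound ρ C := h.tilted.abs_steadyWait_le (h.inBox hk k ω)
  have h2 := h.inBox hk k ω
  have h3 : |S.p k ω| ≤ max |M.pLo| |M.pHi| :=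
    abs_le_max_abs_abs (h.adm.p_mem k ω).1 (h.adm.p_mem k ω).2
  have h4 : |S.steady M k ω + S.svc k ω| ≤ M.waitBound ρ C + 1 / M.muLo :=
    (abs_add_le _ _).trans (add_le_add h1 (by rw [abs_of_nonneg h2.1]; exact h2.2.1))
  unfold Controlled.net Model.netBound
  refine (abs_sub _ _).trans (add_le_add ?_ h3)
  rw [abs_mul, abs_of_nonneg h.std.h0_pos.le]
  exact mul_le_mul_of_nonneg_left h4 h.std.h0_pos.le

lemma abs_netRate_le (h : Regime S M P ℱ β ρ σ C m) {k : ℕ} (hk : 1 ≤ k) (ω : Ω) :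
    |S.netRate M k ω| ≤ M.netRateBound ρ C := by
  have h1 := h.tilted.tLo_pos
  have h2 := h.iat_ge k ω
  unfold Controlled.netRate Model.netRateBound
  rw [abs_div, abs_of_pos (h1.trans_le h2)]
  exact div_le_div₀ h.netBound_nonneg (h.abs_net_le hk ω) h1 h2

lemma abs_net_sub_le (h : Regime S M P ℱ β ρ σ C m) {j k : ℕ} (hj : 1 ≤ j) (hk : 1 ≤ k) (ω : Ω) :
    |S.net M k ω - S.net M j ω|
      ≤ (M.h0 * (sensIncr ρ σ C / (1 - σ) + 1) + 1) * S.dd M k j ω := by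
  have H := h.tilted
  have h1 : |S.steady M k ω - S.steady M j ω| ≤ _ :=
    H.abs_steadyWait_sub_steadyWait_le (h.inBox hk k ω) (h.inBox hj j ω)
  have h0 := h.std.h0_pos
  have hA := H.sensIncr_pos
  have h2 : 0 < 1 - σ := sub_pos.2 H.σ_lt
  set A := sensIncr ρ σ C / (1 - σ) with hAdef
  have hA0 : 0 < A := by positivity
  have e : S.net M k ω - S.net M j ω = M.h0 * ((S.steady M k ω - S.steady M j ω)
      + (S.svc k ω - S.svc j ω)) - (S.p k ω - S.p j ω) := by
    unfold Controlled.net; ring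
  rw [e]
  refine (abs_sub _ _).trans ?_
  rw [abs_mul, abs_of_pos h0]
  have h3 := abs_add_le (S.steady M k ω - S.steady M j ω) (S.svc k ω - S.svc j ω)
  unfold Controlled.dd
  set x := |S.svc k ω - S.svc j ω|
  set y := |S.iat M k ω - S.iat M j ω|
  set z := |S.p k ω - S.p j ω|
  have hx : 0 ≤ x := abs_nonneg _
  have hy : 0 ≤ y := abs_nonneg _
  have hz : 0 ≤ z := abs_nonneg _
  calc M.h0 * |S.steady M k ω - S.steady M j ω + (S.svc k ω - S.svc j ω)| + z
      ≤ M.h0 * ((A + 1) * (x + y + z)) + (x + y + z) := by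
        refine add_le_add (mul_le_mul_of_nonneg_left ?_ h0.le) (by linarith)
        nlinarith [mul_nonneg hA0.le hz]
    _ = _ := by ring

lemma abs_netRate_sub_le (h : Regime S M P ℱ β ρ σ C m) {j k : ℕ} (hj : 1 ≤ j) (hk : 1 ≤ k)
    (ω : Ω) : |S.netRate M k ω - S.netRate M j ω| ≤ M.netRateLip ρ σ C * S.dd M k j ω := by
  have h1 := h.tilted.tLo_pos
  have hk2 := h.iat_ge k ω
  have hj2 := h.iat_ge j ω
  have hk0 := h1.trans_le hk2
  have hj0 := h1.trans_le hj2
  set τ := 1 / M.lam M.pLo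
  set A := M.h0 * (sensIncr ρ σ C / (1 - σ) + 1) + 1 with hA
  have e : S.netRate M k ω - S.netRate M j ω
      = (S.net M k ω - S.net M j ω) / S.iat M k ω
        - S.net M j ω * (S.iat M k ω - S.iat M j ω) / (S.iat M k ω * S.iat M j ω) := by
    unfold Controlled.netRate
    field_simp
    ring
  have hd := S.dd_nonneg M k j ω
  have h3 : |(S.net M k ω - S.net M j ω) / S.iat M k ω| ≤ A / τ * S.dd M k j ω := by
    rw [abs_div, abs_of_pos hk0]
    have := h.abs_net_sub_le hj hk ω
    calc |S.net M k ω - S.net M j ω| / S.iat M k ω ≤ A * S.dd M k j ω / τ :=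
          div_le_div₀ ((abs_nonneg _).trans this) this h1 hk2
      _ = _ := by ring
  have h4 : |S.net M j ω * (S.iat M k ω - S.iat M j ω) / (S.iat M k ω * S.iat M j ω)|
      ≤ M.netBound ρ C / τ ^ 2 * S.dd M k j ω := by
    rw [abs_div, abs_mul, abs_of_pos (mul_pos hk0 hj0)]
    have h5 : |S.iat M k ω - S.iat M j ω| ≤ S.dd M k j ω := by
      have := abs_nonneg (S.svc k ω - S.svc j ω)
      have := abs_nonneg (S.p k ω - S.p j ω)
      unfold Controlled.dd
      linarith
    calc _ ≤ M.netBound ρ C * S.dd M k j ω / τ ^ 2 := by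
          refine div_le_div₀ (mul_nonneg h.netBound_nonneg hd)
            (mul_le_mul (h.abs_net_le hj ω) h5 (abs_nonneg _) h.netBound_nonneg)
            (by positivity) ?_
          rw [sq]
          exact mul_le_mul hk2 hj2 h1.le hk0.le
      _ = _ := by ring
  rw [e]
  refine (abs_sub _ _).trans ((add_le_add h3 h4).trans_eq ?_)
  unfold Model.netRateLip
  ring

lemma measurable_net (h : Regime S M P ℱ β ρ σ C m) {i k : ℕ} (hi : 1 ≤ i) (hik : i ≤ k) :
    Measurable[ℱ k] (S.net M i) :=
  (((h.measurable_steadyWait hi hik).add (h.measurable_svc hi hik)).const_mul M.h0).sub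
    (h.measurable_p (hi.trans hik) hik)

lemma measurable_netRate (h : Regime S M P ℱ β ρ σ C m) {i k : ℕ} (hi : 1 ≤ i) (hik : i ≤ k) :
    Measurable[ℱ k] (S.netRate M i) :=
  (h.measurable_net hi hik).div (h.measurable_iat (hi.trans hik) hik)

lemma integrable_of_abs_le {f : Ω → ℝ} {K : ℝ} (hf : Measurable f) (h : ∀ ω, |f ω| ≤ K) :
    Integrable f P :=
  (integrable_const K).mono' hf.aestronglyMeasurable (ae_of_all _ h)

lemma integrable_net (h : Regime S M P ℱ β ρ σ C m) {k : ℕ} (hk : 1 ≤ k) :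
    Integrable (S.net M k) P :=
  integrable_of_abs_le ((h.measurable_net hk le_rfl).mono (ℱ.le k) le_rfl) (h.abs_net_le hk)

lemma abs_svc_le (h : Regime S M P ℱ β ρ σ C m) {k : ℕ} (hk : 1 ≤ k) (ω : Ω) :
    |S.svc k ω| ≤ 1 / M.muLo := by
  rw [abs_of_nonneg (h.inBox hk k ω).1]
  exact (h.inBox hk k ω).2.1

lemma integrable_svc (h : Regime S M P ℱ β ρ σ C m) {k : ℕ} (hk : 1 ≤ k) :
    Integrable (S.svc k) P :=
  integrable_of_abs_le ((h.measurable_svc hk le_rfl).mono (ℱ.le k) le_rfl) (h.abs_svc_le hk)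

/-! ### Services -/

lemma service_moment (h : Regime S M P ℱ β ρ σ C m) {i k : ℕ} (hk : 1 ≤ k) (n : ℕ) (hi : i ≤ k)
    (hi1 : 1 ≤ i) : Integrable (fun ω => S.V k n ω / S.mu i ω) P ∧
      ∫ ω, S.V k n ω / S.mu i ω ∂P = ∫ ω, S.svc i ω ∂P := by
  have hm : Measurable[h.filt hk n] (S.svc i) :=
    (h.measurable_svc hi1 hi).mono (h.le_filt hk n) le_rfl
  have e : (fun ω => S.V k n ω / S.mu i ω) = fun ω => S.svc i ω * (S.input k n ω).2 := by
    funext ω; unfold Controlled.svc Controlled.input; ring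
  rw [e]
  refine ⟨(h.innov hk).integrable_mul n hm (h.integrable_svc hi1) measurable_snd h.tilted.intV, ?_⟩
  rw [(h.innov hk).integral_mul n hm measurable_snd, h.tilted.meanV, mul_one]

lemma integrable_service (h : Regime S M P ℱ β ρ σ C m) {k : ℕ} (hk : 1 ≤ k) (n : ℕ) :
    Integrable (S.service k n) P := by
  unfold Controlled.service
  split_ifs
  · exact (h.service_moment hk n le_rfl hk).1
  · exact (h.service_moment (k := k + 1) (by omega) 0 le_rfl (by omega)).1

lemma integrable_service_sub (h : Regime S M P ℱ β ρ σ C m) {k : ℕ} (hk : 1 ≤ k) (n : ℕ) :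
    Integrable (fun ω => S.service k n ω - S.svc k ω) P :=
  (h.integrable_service hk n).sub (h.integrable_svc hk)

/-- Service variables are independent of the decisions that scale them. Only the last customer is
served under the next decision, so a single term of the sum has nonzero mean, regardless of the
cycle length. -/
lemma abs_integral_service_le (h : Regime S M P ℱ β ρ σ C m) {k : ℕ} (hk : 1 ≤ k) {B : ℝ}
    (hB : |∫ ω, S.svc (k + 1) ω ∂P - ∫ ω, S.svc k ω ∂P| ≤ B) :
    |∫ ω, ∑ i ∈ Finset.range (S.D k), (S.service k (i + 1) ω - S.svc k ω) ∂P| ≤ B := by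
  have h1 : ∀ n, ∫ ω, (S.service k n ω - S.svc k ω) ∂P
      = if n < S.D k then 0 else ∫ ω, S.svc (k + 1) ω ∂P - ∫ ω, S.svc k ω ∂P := by
    intro n
    rw [integral_sub (h.integrable_service hk n) (h.integrable_svc hk)]
    unfold Controlled.service
    split_ifs
    · rw [(h.service_moment hk n le_rfl hk).2, sub_self]
    · rw [(h.service_moment (k := k + 1) (by omega) 0 le_rfl (by omega)).2]
  rw [integral_finsetSum _ fun i _ => h.integrable_service_sub hk (i + 1)]
  simp_rw [h1]
  cases S.D k with
  | zero => simpa using (abs_nonneg _).trans hB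
  | succ d =>
    rw [Finset.sum_range_succ, Finset.sum_eq_zero, zero_add, if_neg (lt_irrefl _)]
    · exact hB
    · intro i hi
      rw [if_pos (Nat.succ_lt_succ (Finset.mem_range.1 hi))]

/-! ### Interarrival times -/

lemma integrable_net_mul (h : Regime S M P ℱ β ρ σ C m) {k : ℕ} (hk : 1 ≤ k) (n : ℕ) :
    Integrable (fun ω => S.net M k ω * (1 - S.U k n ω)) P :=
  have := h.tilted.prob
  (h.innov hk).integrable_mul n ((h.measurable_net hk le_rfl).mono (h.le_filt hk n) le_rfl)
    (h.integrable_net hk) (g := fun y => 1 - y.1) (measurable_fst.const_sub 1)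
    ((integrable_const 1).sub h.tilted.intU)

lemma integral_net_mul (h : Regime S M P ℱ β ρ σ C m) {k : ℕ} (hk : 1 ≤ k) :
    ∫ ω, ∑ i ∈ Finset.range (S.D k), S.net M k ω * (1 - S.U k i ω) ∂P = 0 := by
  have := h.tilted.prob
  rw [integral_finsetSum _ fun i _ => h.integrable_net_mul hk i]
  refine Finset.sum_eq_zero fun i _ => ?_
  have := (h.innov hk).integral_mul i ((h.measurable_net hk le_rfl).mono (h.le_filt hk i) le_rfl)
    (g := fun y => 1 - y.1) (measurable_fst.const_sub 1)
  refine this.trans ?_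
  rw [integral_sub (integrable_const 1) h.tilted.intU, h.tilted.meanU]
  simp

/-! ### Leftover customers -/

lemma measurable_old (h : Regime S M P ℱ β ρ σ C m) {k : ℕ} (hk : 1 ≤ k) (n : ℕ) :
    Measurable[h.filt hk n] (S.old M k n) :=
  measurable_oldInd (h.innov hk) ((h.measurable_start hk).mono (h.le_filt hk 0) le_rfl)
    ((h.measurable_iat hk (Nat.sub_le k 1)).mono (h.le_filt hk 0) le_rfl) n

lemma old_mem (S : Controlled Ω) (M : Model) (k n : ℕ) (ω : Ω) :
    0 ≤ S.old M k n ω ∧ S.old M k n ω ≤ 1 := oldInd_mem _ _ _ _ _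

/-- Bound of the interarrival times' means. -/
lemma iat_le (h : Regime S M P ℱ β ρ σ C m) (i : ℕ) (ω : Ω) : |S.iat M i ω| ≤ 1 / M.lam M.pHi := by
  have h1 := h.adm.p_mem i ω
  have h2 := h.std.lam_pos _ (Set.right_mem_Icc.2 h.std.p_le)
  unfold Controlled.iat
  rw [abs_of_pos (one_div_pos.2 (h.lam_pos i ω))]
  exact one_div_le_one_div_of_le h2 (h.stable.lam_anti h1 (Set.right_mem_Icc.2 h.std.p_le) h1.2)

/-- The exponential weight in `old_moment` is at least 1 and can be dropped on the left. The price
change is kept inside the expectation, as it may depend on the initial waiting time. -/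
lemma old_jump_le (h : Regime S M P ℱ β ρ σ C m) {k : ℕ} (hk : 1 ≤ k) {B : ℝ}
    (hi : Integrable (fun ω => S.jump M k ω * Real.exp (β * S.start M k ω)) P)
    (hB : ∫ ω, S.jump M k ω * Real.exp (β * S.start M k ω) ∂P ≤ B) (n : ℕ) :
    Integrable (fun ω => S.jump M k ω * S.old M k n ω) P ∧
      ∫ ω, S.jump M k ω * S.old M k n ω ∂P ≤ ρ ^ n * B := by
  have hm : Measurable[h.filt hk 0] (S.jump M k) :=
    (h.measurable_jump hk le_rfl).mono (h.le_filt hk 0) le_rfl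
  have h1 := (h.isMixed hk).old_moment h.tilted (h.innov hk) hm (S.jump_nonneg M k) hi n
  have hle : ∀ ω, S.jump M k ω * S.old M k n ω
      ≤ S.jump M k ω * (S.old M k n ω * Real.exp (β * S.proc M k n ω)) := fun ω =>
    mul_le_mul_of_nonneg_left (le_mul_of_one_le_right (old_mem S M k n ω).1
      (Real.one_le_exp (mul_nonneg h.tilted.β_pos.le ((h.isMixed hk).1.nonneg n ω))))
      (S.jump_nonneg M k ω)
  have hmeas : Measurable fun ω => S.jump M k ω * S.old M k n ω :=
    (hm.mono ((h.filt hk).le 0) le_rfl).mul ((h.measurable_old hk n).mono ((h.filt hk).le n) le_rfl)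
  have hint : Integrable (fun ω => S.jump M k ω * S.old M k n ω) P := by
    refine h1.1.mono' hmeas.aestronglyMeasurable (ae_of_all _ fun ω => ?_)
    rw [Real.norm_eq_abs, abs_of_nonneg (mul_nonneg (S.jump_nonneg M k ω) (old_mem S M k n ω).1)]
    exact hle ω
  refine ⟨hint, (integral_mono hint h1.1 hle).trans (h1.2.trans ?_)⟩
  exact mul_le_mul_of_nonneg_left hB (pow_nonneg h.tilted.ρ_pos.le n)

lemma oldTerm_moment (h : Regime S M P ℱ β ρ σ C m) {k : ℕ} (hk : 1 ≤ k) {B : ℝ}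
    (hi : Integrable (fun ω => S.jump M k ω * Real.exp (β * S.start M k ω)) P)
    (hB : ∫ ω, S.jump M k ω * Real.exp (β * S.start M k ω) ∂P ≤ B) (n : ℕ) :
    Integrable (S.oldTerm M k n) P ∧
      |∫ ω, S.oldTerm M k n ω ∂P| ≤ (1 + M.netRateBound ρ C) * B * ρ ^ n := by
  have hj := h.old_jump_le hk hi hB n
  have hm : ∀ {f : Ω → ℝ}, Measurable[ℱ k] f → Measurable[h.filt hk n] f :=
    fun hf => hf.mono (h.le_filt hk n) le_rfl
  have hup : ∀ {f : Ω → ℝ}, Measurable[h.filt hk n] f → Measurable f :=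
    fun hf => hf.mono ((h.filt hk).le n) le_rfl
  have mp := hm ((h.measurable_p hk (Nat.sub_le k 1)).sub (h.measurable_p hk le_rfl))
  have mt := hm ((h.measurable_netRate hk le_rfl).mul
    ((h.measurable_iat hk (Nat.sub_le k 1)).sub (h.measurable_iat hk le_rfl)))
  have mo := h.measurable_old hk n
  have m1 : Measurable[h.filt hk n] fun ω => S.old M k n ω * (S.p (k - 1) ω - S.p k ω) :=
    mo.mul mp
  have m2 : Measurable[h.filt hk n] fun ω => S.old M k n ω
      * (S.netRate M k ω * (S.iat M (k - 1) ω - S.iat M k ω)) := mo.mul mt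
  have hK := h.netRateBound_nonneg
  have b1 : ∀ ω, |S.old M k n ω * (S.p (k - 1) ω - S.p k ω)| ≤ S.jump M k ω * S.old M k n ω := by
    intro ω
    rw [abs_mul, abs_of_nonneg (old_mem S M k n ω).1, mul_comm]
    refine mul_le_mul_of_nonneg_right ?_ (old_mem S M k n ω).1
    unfold Controlled.jump
    linarith [abs_nonneg (S.iat M (k - 1) ω - S.iat M k ω)]
  have b2 : ∀ ω, |S.old M k n ω * (S.netRate M k ω * (S.iat M (k - 1) ω - S.iat M k ω))|
      ≤ M.netRateBound ρ C * (S.jump M k ω * S.old M k n ω) := by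
    intro ω
    rw [abs_mul, abs_mul, abs_of_nonneg (old_mem S M k n ω).1, mul_comm, ← mul_assoc]
    refine mul_le_mul_of_nonneg_right (mul_le_mul (h.abs_netRate_le hk ω) ?_ (abs_nonneg _) hK)
      (old_mem S M k n ω).1
    unfold Controlled.jump
    linarith [abs_nonneg (S.p (k - 1) ω - S.p k ω)]
  have i1 : Integrable (fun ω => S.old M k n ω * (S.p (k - 1) ω - S.p k ω)) P :=
    hj.1.mono' (hup m1).aestronglyMeasurable (ae_of_all _ b1)
  have i2 : Integrable (fun ω => S.old M k n ω
      * (S.netRate M k ω * (S.iat M (k - 1) ω - S.iat M k ω))) P :=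
    (hj.1.const_mul _).mono' (hup m2).aestronglyMeasurable (ae_of_all _ b2)
  have i3 : Integrable (fun ω => S.old M k n ω
      * (S.netRate M k ω * (S.iat M (k - 1) ω - S.iat M k ω)) * S.U k n ω) P :=
    -- Whether the interarrival time with index `n` is old is known before it is drawn, so its
    -- factor has conditional mean 1 and drops out below.
    (h.innov hk).integrable_mul n m2 i2 measurable_fst h.tilted.intU
  refine ⟨i1.add i3, ?_⟩
  have e : ∫ ω, S.oldTerm M k n ω ∂P = ∫ ω, S.old M k n ω * (S.p (k - 1) ω - S.p k ω) ∂P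
      + ∫ ω, S.old M k n ω * (S.netRate M k ω * (S.iat M (k - 1) ω - S.iat M k ω)) ∂P := by
    unfold Controlled.oldTerm
    rw [integral_add i1 i3]
    congr 1
    refine ((h.innov hk).integral_mul n m2 measurable_fst).trans ?_
    rw [h.tilted.meanU, mul_one]
  rw [e]
  have c1 : |∫ ω, S.old M k n ω * (S.p (k - 1) ω - S.p k ω) ∂P| ≤ ρ ^ n * B := by
    rw [← Real.norm_eq_abs]
    exact (norm_integral_le_of_norm_le hj.1 (ae_of_all _ b1)).trans hj.2
  have c2 : |∫ ω, S.old M k n ω * (S.netRate M k ω * (S.iat M (k - 1) ω - S.iat M k ω)) ∂P|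
      ≤ M.netRateBound ρ C * (ρ ^ n * B) := by
    rw [← Real.norm_eq_abs]
    refine (norm_integral_le_of_norm_le (hj.1.const_mul _) (ae_of_all _ b2)).trans ?_
    rw [integral_const_mul]
    exact mul_le_mul_of_nonneg_left hj.2 hK
  refine (abs_add_le _ _).trans ((add_le_add c1 c2).trans_eq ?_)
  ring

lemma abs_integral_oldTerm_le (h : Regime S M P ℱ β ρ σ C m) {k : ℕ} (hk : 1 ≤ k) {B : ℝ}
    (hB0 : 0 ≤ B)
    (hi : Integrable (fun ω => S.jump M k ω * Real.exp (β * S.start M k ω)) P)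
    (hB : ∫ ω, S.jump M k ω * Real.exp (β * S.start M k ω) ∂P ≤ B) (D : ℕ) :
    |∫ ω, ∑ i ∈ Finset.range D, S.oldTerm M k i ω ∂P|
      ≤ (1 + M.netRateBound ρ C) * B / (1 - ρ) := by
  have hK := h.netRateBound_nonneg
  rw [integral_finsetSum _ fun i _ => (h.oldTerm_moment hk hi hB i).1]
  refine (Finset.abs_sum_le_sum_abs _ _).trans
    ((Finset.sum_le_sum fun i _ => (h.oldTerm_moment hk hi hB i).2).trans ?_)
  rw [← Finset.mul_sum, div_eq_mul_one_div]
  exact mul_le_mul_of_nonneg_left (geom_sum_range_le h.tilted.ρ_pos.le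
    (h.tilted.ρ_lt.trans h.tilted.σ_lt) D) (by positivity)

end Regime

end

end GIGIOne

namespace GIGIOne

set_option linter.unusedSectionVars false

section

variable {Ω : Type*} [mΩ : MeasurableSpace Ω]

namespace Regime

variable {S : Controlled Ω} {M : Model} {P : Measure Ω} [IsProbabilityMeasure P]
  {ℱ : Filtration ℕ mΩ} {β ρ σ C m : ℝ}

lemma integrable_bdd_mul {f g : Ω → ℝ} {K : ℝ} (hf : Measurable f) (h : ∀ ω, |f ω| ≤ K)
    (hg : Integrable g P) : Integrable (fun ω => f ω * g ω) P := by
  refine (hg.norm.const_mul K).mono' (hf.aestronglyMeasurable.mul hg.1) (ae_of_all _ fun ω => ?_)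
  rw [norm_mul]
  exact mul_le_mul_of_nonneg_right (h ω) (norm_nonneg _)

/-! ### The terminal term -/

variable {j l : ℕ} {κ b : ℝ}

lemma gap_le_gap (h : Regime S M P ℱ β ρ σ C m) (hκ : 0 < κ) (hb : 0 ≤ b) {l l' N N' : ℕ}
    (hl : l ≤ l') (hN : N' ≤ N) : gap β ρ C m κ b l N ≤ gap β ρ C m κ b l' N' := by
  have H := h.tilted
  have h1ρ : 0 < 1 - ρ := sub_pos.2 (H.ρ_lt.trans H.σ_lt)
  have h1 := h.small_nonneg hκ hb
  have h2 := H.C_pos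
  have h3 := H.β_pos
  have h4 := h.one_le
  have h5 : ρ ^ N ≤ ρ ^ N' := pow_le_pow_of_le_one H.ρ_pos.le (H.ρ_lt.trans H.σ_lt).le hN
  have h6 : (l : ℝ) ≤ l' := by exact_mod_cast hl
  unfold gap
  gcongr

/-- The waiting time at the start of a cycle, weighted with an earlier bounded factor, is
close to its steady-state mean. -/
lemma abs_integral_start_sub_le (h : Regime S M P ℱ β ρ σ C m) (hc : Close S M P j l κ b)
    (hj : 1 ≤ j) (hκ : 0 < κ) (hb : 0 ≤ b) {i : ℕ} (hi : i ≤ l + 1) {f : Ω → ℝ}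
    (hf : Measurable[ℱ j] f) {K : ℝ} (hK : 0 ≤ K) (hfK : ∀ ω, |f ω| ≤ K) :
    |∫ ω, f ω * S.start M (j + i) ω ∂P - ∫ ω, f ω * S.steady M j ω ∂P|
      ≤ K * (gap β ρ C m κ b i (S.customers j i) + M.waitBound ρ C * ρ ^ S.customers j i) := by
  have H := h.tilted
  have hprob := H.prob
  have hf' : Measurable f := hf.mono (ℱ.le j) le_rfl
  have i1 := integrable_bdd_mul hf' hfK (h.integrable_start (k := j + i) (by omega))
  have i2 := integrable_bdd_mul hf' hfK (h.integrable_refStart hj i)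
  have i3 := integrable_bdd_mul hf' hfK (h.integrable_steadyWait hj)
  set N := S.customers j i with hN
  have i4 := integrable_bdd_mul hf' hfK (h.integrable_meanWait hj
    (measurable_const (a := (0 : ℝ))) (fun _ => le_rfl) (integrable_const _) N)
  have a1 : |∫ ω, f ω * S.start M (j + i) ω ∂P - ∫ ω, f ω * S.ref M j i ω ∂P|
      ≤ K * gap β ρ C m κ b i N := by
    have d := h.dist_ref_le hc hj hκ hb hi
    rw [← integral_sub i1 i2, ← Real.norm_eq_abs]
    refine (norm_integral_le_of_norm_le (d.1.const_mul K) (ae_of_all _ fun ω => ?_)).trans ?_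
    · rw [← mul_sub, Real.norm_eq_abs, abs_mul]
      refine mul_le_mul (hfK ω) (le_mul_of_one_le_right (abs_nonneg _) (Real.one_le_exp
        (mul_nonneg H.β_pos.le ((h.start_nonneg _ ω).trans (le_max_left _ _)))))
        (abs_nonneg _) hK
    · rw [integral_const_mul]
      exact mul_le_mul_of_nonneg_left d.2 hK
  -- The factor `f` is bounded and known at cycle `j`, so the reference waiting time may be replaced
  -- by its mean under the frozen decision inside the product.
  have a2 : ∫ ω, f ω * S.ref M j i ω ∂P
      = ∫ ω, f ω * meanWait (M.lawU.prod M.lawV) N (S.svc j ω) (S.iat M j ω) 0 ∂P := by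
    have := h.integral_mul_ref hj hf hfK i 0
    rwa [Nat.zero_add] at this
  have a3 : |∫ ω, f ω * meanWait (M.lawU.prod M.lawV) N (S.svc j ω) (S.iat M j ω) 0 ∂P
      - ∫ ω, f ω * S.steady M j ω ∂P| ≤ K * (M.waitBound ρ C * ρ ^ N) := by
    unfold Controlled.steady
    rw [← integral_sub i4 i3, ← Real.norm_eq_abs]
    have := norm_integral_le_of_norm_le_const (μ := P) (C := K * (M.waitBound ρ C * ρ ^ N))
      (f := fun ω => f ω * meanWait (M.lawU.prod M.lawV) N (S.svc j ω) (S.iat M j ω) 0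
        - f ω * steadyWait (M.lawU.prod M.lawV) (S.svc j ω) (S.iat M j ω))
      (ae_of_all _ fun ω => by
        rw [← mul_sub, Real.norm_eq_abs, abs_mul]
        refine mul_le_mul (hfK ω) ?_ (abs_nonneg _) hK
        rw [abs_sub_comm]
        exact H.abs_steadyWait_sub_le N (h.inBox hj j ω))
    simpa using this
  rw [a2] at a1
  rw [abs_le] at a1 a3 ⊢
  constructor <;> linarith

/-- The rate of cycle `k` is correlated with the waiting times at both ends. It is replaced by the
rate of cycle `j`, at a cost controlled by its Lipschitz constant. With this earlier factor both
waiting times are close to the same steady mean, which cancels in the difference; this avoids a loss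
of constant order. -/
lemma abs_integral_terminal_le (h : Regime S M P ℱ β ρ σ C m) (hc : Close S M P j l κ b)
    (hj : 1 ≤ j) (hκ : 0 < κ) (hb : 0 ≤ b) :
    Integrable (fun ω => S.netRate M (j + l) ω
        * (S.start M (j + l + 1) ω - S.start M (j + l) ω)) P ∧
    |∫ ω, S.netRate M (j + l) ω * (S.start M (j + l + 1) ω - S.start M (j + l) ω) ∂P|
      ≤ M.netRateLip ρ σ C / β * small m κ b
        + 2 * (M.netRateBound ρ C * (gap β ρ C m κ b (l + 1) (S.customers j l)
          + M.waitBound ρ C * ρ ^ S.customers j l)) := by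
  have H := h.tilted
  have hβ := H.β_pos
  have hk : 1 ≤ j + l := by omega
  set k := j + l with hkdef
  set N := S.customers j l with hN
  have hK := h.netRateBound_nonneg
  have hLF := h.netRateLip_nonneg
  have mk : Measurable (S.netRate M k) := (h.measurable_netRate hk le_rfl).mono (ℱ.le k) le_rfl
  have mj : Measurable (S.netRate M j) := (h.measurable_netRate hj le_rfl).mono (ℱ.le j) le_rfl
  have is1 := h.integrable_start (k := k + 1) (by omega)
  have is0 := h.integrable_start hk
  have hdiff : Integrable (fun ω => S.start M (k + 1) ω - S.start M k ω) P := is1.sub is0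
  have i1 := integrable_bdd_mul mk (h.abs_netRate_le hk) hdiff
  have i2 := integrable_bdd_mul mj (h.abs_netRate_le hj) hdiff
  have d := h.dd_add_jump hc hj hκ (le_refl l) (h.measurable_start' (k := k + 1) (by omega))
    (h.measurable_start' hk) (h.exp_start (by omega)) (h.exp_start hk)
  have b1 : |∫ ω, S.netRate M k ω * (S.start M (k + 1) ω - S.start M k ω) ∂P
      - ∫ ω, S.netRate M j ω * (S.start M (k + 1) ω - S.start M k ω) ∂P|
      ≤ M.netRateLip ρ σ C / β * small m κ b := by
    rw [← integral_sub i1 i2, ← Real.norm_eq_abs]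
    refine (norm_integral_le_of_norm_le (d.1.const_mul (M.netRateLip ρ σ C / β))
      (ae_of_all _ fun ω => ?_)).trans ?_
    · rw [← sub_mul, Real.norm_eq_abs, abs_mul]
      set X := S.start M (k + 1) ω with hX
      set Y := S.start M k ω with hY
      have hX0 : 0 ≤ X := h.start_nonneg _ ω
      have hY0 : 0 ≤ Y := h.start_nonneg _ ω
      have e1 : |X - Y| ≤ 1 / β * Real.exp (β * max X Y) := by
        refine (abs_le.2 ⟨?_, ?_⟩).trans (id_le_inv_mul_exp hβ)
        · linarith [le_max_right X Y]
        · linarith [le_max_left X Y]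
      have e2 : |S.netRate M k ω - S.netRate M j ω|
          ≤ M.netRateLip ρ σ C * (S.dd M (j + l) j ω + S.jump M (j + l) ω) :=
        (h.abs_netRate_sub_le hj hk ω).trans (mul_le_mul_of_nonneg_left
          (le_add_of_nonneg_right (S.jump_nonneg M _ ω)) hLF)
      refine (mul_le_mul e2 e1 (abs_nonneg _) ((abs_nonneg _).trans e2)).trans_eq ?_
      ring
    · rw [integral_const_mul]
      exact mul_le_mul_of_nonneg_left d.2 (by positivity)
  have c1 := h.abs_integral_start_sub_le hc hj hκ hb (le_refl (l + 1))
    (h.measurable_netRate hj le_rfl) hK (h.abs_netRate_le hj)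
  have c0 := h.abs_integral_start_sub_le hc hj hκ hb (Nat.le_succ l)
    (h.measurable_netRate hj le_rfl) hK (h.abs_netRate_le hj)
  have e : ∫ ω, S.netRate M j ω * (S.start M (k + 1) ω - S.start M k ω) ∂P
      = ∫ ω, S.netRate M j ω * S.start M (j + (l + 1)) ω ∂P
        - ∫ ω, S.netRate M j ω * S.start M (j + l) ω ∂P := by
    simp only [mul_sub]
    exact integral_sub (integrable_bdd_mul mj (h.abs_netRate_le hj) is1)
      (integrable_bdd_mul mj (h.abs_netRate_le hj) is0)
  rw [e] at b1
  have hNN : N ≤ S.customers j (l + 1) := by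
    unfold Controlled.customers at *
    rw [Finset.sum_range_succ]; omega
  have g1 := h.gap_le_gap (b := b) hκ hb (le_refl (l + 1)) hNN
  have g0 := h.gap_le_gap (b := b) hκ hb (Nat.le_succ l) (le_refl N)
  have hp : ρ ^ S.customers j (l + 1) ≤ ρ ^ N :=
    pow_le_pow_of_le_one H.ρ_pos.le (H.ρ_lt.trans H.σ_lt).le hNN
  have hw := mul_le_mul_of_nonneg_left hp h.waitBound_nonneg
  have f1 := mul_le_mul_of_nonneg_left (add_le_add g1 hw) hK
  have f0 := mul_le_mul_of_nonneg_left (add_le_add_left g0 (M.waitBound ρ C * ρ ^ N)) hK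
  refine ⟨i1, ?_⟩
  rw [abs_le] at b1 c1 c0 ⊢
  constructor <;> linarith

/-! ### The regret of a cycle -/

lemma integrable_steadyCost (h : Regime S M P ℱ β ρ σ C m) {k : ℕ} (hk : 1 ≤ k)
    (hf : ∀ ω, M.f (S.mu k ω) (S.p k ω) = S.netRate M k ω + M.cost (S.mu k ω)) :
    Integrable (S.steadyCost M k) P := by
  have hup : ∀ {f : Ω → ℝ}, Measurable[ℱ k] f → Measurable f :=
    fun hf => hf.mono (ℱ.le k) le_rfl
  have mc : Measurable[ℱ k] fun ω => M.cost (S.mu k ω) :=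
    measurable_comp_of_continuousOn h.stable.cost_contDiff.continuousOn (h.adm.hist_mu k hk)
      (h.adm.mu_mem k hk)
  have hcb : ∀ ω, |M.cost (S.mu k ω)| ≤ max |M.cost M.muLo| |M.cost M.muHi| := fun ω => by
    have h1 := h.adm.mu_mem k hk ω
    exact abs_le_max_abs_abs
      (h.stable.cost_mono (Set.left_mem_Icc.2 h.std.mu_le) h1 h1.1)
      (h.stable.cost_mono h1 (Set.right_mem_Icc.2 h.std.mu_le) h1.2)
  have iT : Integrable (fun ω => (∑ i ∈ Finset.range (S.D k),
        S.U k i ω * (S.iat M k ω + S.old M k i ω * (S.iat M (k - 1) ω - S.iat M k ω)))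
      + S.start M (k + 1) ω - S.start M k ω) P := by
    refine ((integrable_finsetSum _ fun i _ => ?_).add
      (h.integrable_start (k := k + 1) (by omega))).sub (h.integrable_start hk)
    have hm : ∀ {f : Ω → ℝ}, Measurable[ℱ k] f → Measurable f := fun hf => hf.mono (ℱ.le k) le_rfl
    have m1 := hm (h.measurable_iat hk le_rfl)
    have m2 := hm (h.measurable_iat hk (Nat.sub_le k 1))
    have m3 := (h.measurable_old hk i).mono ((h.filt hk).le i) le_rfl
    have hU : Integrable (S.U k i) P :=
      (h.innov hk).integrable_comp i (g := fun y => y.1) h.tilted.intU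
    have := integrable_bdd_mul (m1.add (m3.mul (m2.sub m1))) (K := 1 / M.lam M.pHi
      + 1 * (1 / M.lam M.pHi + 1 / M.lam M.pHi)) (fun ω => by
        refine (abs_add_le _ _).trans (add_le_add (h.iat_le k ω) ?_)
        rw [Pi.mul_apply, abs_mul, abs_of_nonneg (old_mem S M k i ω).1]
        exact mul_le_mul (old_mem S M k i ω).2
          ((abs_sub _ _).trans (add_le_add (h.iat_le _ ω) (h.iat_le k ω))) (abs_nonneg _)
          zero_le_one) hU
    refine this.congr (ae_of_all _ fun ω => ?_)
    simp only [Pi.add_apply, Pi.mul_apply, Pi.sub_apply]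
    ring
  have i1 := integrable_bdd_mul (hup ((h.measurable_netRate hk le_rfl).add mc))
    (fun ω => (abs_add_le _ _).trans (add_le_add (h.abs_netRate_le hk ω) (hcb ω))) iT
  refine i1.congr ?_
  filter_upwards [h.ae_nonneg] with ω hω
  have := Controlled.T_eq (S := S) (M := M) (fun k => h.lam_pos k ω)
    (fun k hk n => (hω k hk n).1) hk
  unfold Controlled.steadyCost
  rw [hf ω, this]
  rfl

/-- Coefficient of the mean square distance of the decisions in the regret of a cycle. -/
noncomputable def distCoeff (M : Model) (β ρ σ C : ℝ) (l : ℕ) : ℝ :=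
  M.h0 * (sens ρ σ C / (1 - σ) + transLip ρ σ C * (l * (C / (1 - ρ)) + 1)) + M.h0
    + (1 + M.netRateBound ρ C) / (1 - ρ) + M.netRateLip ρ σ C / β
    + 2 * (M.netRateBound ρ C * ((l + 1) * (C / (1 - ρ))))

/-- Coefficient of the memory of the initial state in the regret of a cycle. -/
noncomputable def memCoeff (M : Model) (β ρ σ C m : ℝ) : ℝ :=
  M.h0 * (transLip ρ σ C * (m / β) + 1 / M.muLo * C / (1 - ρ) ^ 2)
    + 2 * (M.netRateBound ρ C * (m / β + M.waitBound ρ C))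

lemma cycle_regret_le (h : Regime S M P ℱ β ρ σ C m) (hc : Close S M P j l κ b)
    (hj : 1 ≤ j) (hκ : 0 < κ) (hb : 0 ≤ b) {η θ a γ₀ : ℝ} (hL : M.LightTail η θ a γ₀) :
    Integrable (S.cycleCost M (j + l)) P ∧ Integrable (S.steadyCost M (j + l)) P ∧
      |S.R1 M P (j + l)| ≤ distCoeff M β ρ σ C l * small m κ b
        + memCoeff M β ρ σ C m * ρ ^ S.customers j l := by
  have H := h.tilted
  have hk : 1 ≤ j + l := by omega
  have h0 := h.std.h0_pos
  have h1ρ : 0 < 1 - ρ := sub_pos.2 (H.ρ_lt.trans H.σ_lt)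
  have hsm := h.small_nonneg hκ hb
  have t1 := h.abs_integral_wait_sub_le hc hj hκ hb (S.D (j + l))
  have t6 := h.abs_integral_terminal_le hc hj hκ hb
  -- the decisions of the next cycle
  have hnext : |∫ ω, S.svc (j + l + 1) ω ∂P - ∫ ω, S.svc (j + l) ω ∂P| ≤ small m κ b := by
    have md : Measurable (S.dd M (j + l + 1) (j + l)) :=
      (h.measurable_dd (by omega) hk le_rfl (by omega)).mono (ℱ.le (j + l + 1)) le_rfl
    -- With exponents zero the weight is 1, and only the passage from mean square to mean remains.
    have d := mul_exp_moment_le (P := P) (X := fun _ => 0) (X' := fun _ => 0) (m := m) (β := β)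
      hκ md (S.dd_nonneg M _ _) measurable_const measurable_const hc.next_le.1 hc.next_le.2
      (by simpa using h.one_le) (by simpa using h.one_le)
    rw [← integral_sub (h.integrable_svc (by omega)) (h.integrable_svc hk), ← Real.norm_eq_abs]
    refine (norm_integral_le_of_norm_le d.1 (ae_of_all _ fun ω => ?_)).trans (d.2.trans ?_)
    · simp only [max_self, mul_zero, Real.exp_zero, mul_one, Real.norm_eq_abs]
      have h1 := abs_nonneg (S.iat M (j + l + 1) ω - S.iat M (j + l) ω)
      have h2 := abs_nonneg (S.p (j + l + 1) ω - S.p (j + l) ω)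
      unfold Controlled.dd
      linarith
    · unfold small
      gcongr
      linarith
  have t2 := h.abs_integral_service_le hk hnext
  have t4 := h.integral_net_mul hk
  have hjump : Integrable (fun ω => S.jump M (j + l) ω * Real.exp (β * S.start M (j + l) ω)) P ∧
      ∫ ω, S.jump M (j + l) ω * Real.exp (β * S.start M (j + l) ω) ∂P ≤ small m κ b := by
    have d := h.dd_add_jump hc hj hκ le_rfl (h.measurable_start' hk) (h.measurable_start' hk)
      (h.exp_start hk) (h.exp_start hk)
    have hle : ∀ ω, S.jump M (j + l) ω * Real.exp (β * S.start M (j + l) ω)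
        ≤ (S.dd M (j + l) j ω + S.jump M (j + l) ω)
          * Real.exp (β * max (S.start M (j + l) ω) (S.start M (j + l) ω)) := by
      intro ω
      rw [max_self]
      exact mul_le_mul_of_nonneg_right (le_add_of_nonneg_left (S.dd_nonneg M _ _ ω))
        (Real.exp_pos _).le
    have mjmp : Measurable (S.jump M (j + l)) :=
      (h.measurable_jump hk le_rfl).mono (ℱ.le (j + l)) le_rfl
    have hint : Integrable (fun ω => S.jump M (j + l) ω
        * Real.exp (β * S.start M (j + l) ω)) P := by
      refine d.1.mono' (mjmp.mul ((h.measurable_start' hk).const_mul β).exp).aestronglyMeasurable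
        (ae_of_all _ fun ω => ?_)
      rw [Real.norm_eq_abs, abs_of_nonneg (mul_nonneg (S.jump_nonneg M _ ω) (Real.exp_pos _).le)]
      exact hle ω
    exact ⟨hint, (integral_mono hint d.1 hle).trans d.2⟩
  have t5 := h.abs_integral_oldTerm_le hk hsm hjump.1 hjump.2 (S.D (j + l))
  have hf := fun ω => Controlled.f_eq hL h.std h.stable (h.adm.mu_mem _ hk ω)
    (h.adm.p_mem (j + l) ω)
  have iS := h.integrable_steadyCost hk hf
  have i1 : Integrable (fun ω => ∑ i ∈ Finset.range (S.D (j + l)),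
      (S.proc M (j + l) (i + 1) ω - S.steady M (j + l) ω)) P :=
    integrable_finsetSum _ fun i _ => (h.integrable_proc hk (i + 1)).sub (h.integrable_steadyWait hk)
  have i2 : Integrable (fun ω => ∑ i ∈ Finset.range (S.D (j + l)),
      (S.service (j + l) (i + 1) ω - S.svc (j + l) ω)) P :=
    integrable_finsetSum _ fun i _ => h.integrable_service_sub hk (i + 1)
  have i4 : Integrable (fun ω => ∑ i ∈ Finset.range (S.D (j + l)),
      S.net M (j + l) ω * (1 - S.U (j + l) i ω)) P :=
    integrable_finsetSum _ fun i _ => h.integrable_net_mul hk i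
  have i5 : Integrable (fun ω => ∑ i ∈ Finset.range (S.D (j + l)), S.oldTerm M (j + l) i ω) P :=
    integrable_finsetSum _ fun i _ => (h.oldTerm_moment hk hjump.1 hjump.2 i).1
  have i12 := (i1.const_mul M.h0).add (i2.const_mul M.h0)
  have iE : Integrable (S.excess M (j + l)) P := ((i12.add i4).sub i5).sub t6.1
  have hcc : S.cycleCost M (j + l) =ᵐ[P] fun ω => S.steadyCost M (j + l) ω
      + S.excess M (j + l) ω := by
    filter_upwards [h.ae_nonneg] with ω hω
    exact Controlled.cycleCost_eq (fun k => h.lam_pos k ω) (fun k hk n => (hω k hk n).1) hk (hf ω)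
  have iC : Integrable (S.cycleCost M (j + l)) P := (iS.add iE).congr hcc.symm
  refine ⟨iC, iS, ?_⟩
  have e : S.R1 M P (j + l) = ∫ ω, S.excess M (j + l) ω ∂P := by
    unfold Controlled.R1
    rw [integral_congr_ae hcc, integral_add iS iE]
    ring
  have e2 : ∫ ω, S.excess M (j + l) ω ∂P
      = M.h0 * (∫ ω, ∑ i ∈ Finset.range (S.D (j + l)),
          (S.proc M (j + l) (i + 1) ω - S.steady M (j + l) ω) ∂P)
        + M.h0 * (∫ ω, ∑ i ∈ Finset.range (S.D (j + l)),
          (S.service (j + l) (i + 1) ω - S.svc (j + l) ω) ∂P)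
        + (∫ ω, ∑ i ∈ Finset.range (S.D (j + l)), S.net M (j + l) ω * (1 - S.U (j + l) i ω) ∂P)
        - (∫ ω, ∑ i ∈ Finset.range (S.D (j + l)), S.oldTerm M (j + l) i ω ∂P)
        - ∫ ω, S.netRate M (j + l) ω * (S.start M (j + l + 1) ω - S.start M (j + l) ω) ∂P := by
    unfold Controlled.excess
    have r1 := integral_sub ((i12.add i4).sub i5) t6.1
    have r2 := integral_sub (i12.add i4) i5
    have r3 := integral_add i12 i4
    have r4 := integral_add (i1.const_mul M.h0) (i2.const_mul M.h0)
    rw [integral_const_mul, integral_const_mul] at r4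
    simp only [Pi.add_apply, Pi.sub_apply] at r1 r2 r3 r4
    rw [r1, r2, r3, r4]
  rw [e, e2, t4]
  have t1' := mul_le_mul_of_nonneg_left t1 h0.le
  have t2' := mul_le_mul_of_nonneg_left t2 h0.le
  have t6' := t6.2
  rw [← abs_of_pos h0, ← abs_mul, abs_of_pos h0] at t1' t2'
  have hfin : distCoeff M β ρ σ C l * small m κ b + memCoeff M β ρ σ C m * ρ ^ S.customers j l
      = M.h0 * (sens ρ σ C / (1 - σ) * small m κ b
        + transLip ρ σ C * (gap β ρ C m κ b l (S.customers j l) + small m κ b)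
        + 1 / M.muLo * C / (1 - ρ) ^ 2 * ρ ^ S.customers j l)
      + M.h0 * small m κ b + (1 + M.netRateBound ρ C) * small m κ b / (1 - ρ)
      + (M.netRateLip ρ σ C / β * small m κ b
        + 2 * (M.netRateBound ρ C * (gap β ρ C m κ b (l + 1) (S.customers j l)
          + M.waitBound ρ C * ρ ^ S.customers j l))) := by
    unfold distCoeff memCoeff gap
    push_cast
    ring
  rw [hfin]
  unfold Controlled.steady
  rw [abs_le] at t1' t2' t5 t6' ⊢
  constructor <;> linarith

end Regime

end

end GIGIOne

/-! ### Closeness of nearby decisions and length of the memory -/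

namespace GIGIOne

set_option linter.unusedSectionVars false

lemma abs_one_div_sub_le {x y c : ℝ} (hc : 0 < c) (hx : c ≤ x) (hy : c ≤ y) :
    |1 / x - 1 / y| ≤ 1 / c ^ 2 * |x - y| := by
  have hx0 := hc.trans_le hx
  have hy0 := hc.trans_le hy
  have e : 1 / x - 1 / y = (y - x) / (x * y) := by field_simp
  rw [e, abs_div, abs_of_pos (mul_pos hx0 hy0), abs_sub_comm, div_eq_mul_one_div, mul_comm]
  refine mul_le_mul_of_nonneg_right (one_div_le_one_div_of_le (by positivity) ?_) (abs_nonneg _)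
  rw [sq]
  exact mul_le_mul hx hy hc.le hx0.le

/-- Mean service times and mean interarrival times are Lipschitz functions of the decision. -/
lemma Model.exists_decision_lip {M : Model} (hM : M.Standing) (hS : M.Stable) :
    ∃ A : ℝ, 0 < A ∧ ∀ mu ∈ Set.Icc M.muLo M.muHi, ∀ mu' ∈ Set.Icc M.muLo M.muHi,
      ∀ p ∈ Set.Icc M.pLo M.pHi, ∀ p' ∈ Set.Icc M.pLo M.pHi,
      (|1 / mu - 1 / mu'| + |1 / M.lam p - 1 / M.lam p'| + |p - p'|) ^ 2
        ≤ A * ((mu - mu') ^ 2 + (p - p') ^ 2) := by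
  obtain ⟨Kl, hKl⟩ := hS.lam_contDiff.exists_lipschitzOnWith one_ne_zero (convex_Icc _ _)
    isCompact_Icc
  have h0 := hM.muLo_pos hS
  have hr := Set.right_mem_Icc.2 hM.p_le
  have h1 := hM.lam_pos _ hr
  set a := 1 / M.muLo ^ 2 + 1 / M.lam M.pHi ^ 2 * Kl + 1 with ha
  have hKl0 : (0 : ℝ) ≤ Kl := Kl.2
  have ha0 : 0 < a := by positivity
  refine ⟨2 * a ^ 2, by positivity, fun mu hmu mu' hmu' p hp p' hp' => ?_⟩
  have d1 := abs_one_div_sub_le h0 hmu.1 hmu'.1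
  have d2 := abs_one_div_sub_le h1 (hS.lam_anti hp hr hp.2) (hS.lam_anti hp' hr hp'.2)
  have d3 := hKl.dist_le_mul p hp p' hp'
  rw [Real.dist_eq, Real.dist_eq] at d3
  have d4 := d2.trans (mul_le_mul_of_nonneg_left d3 (by positivity))
  have hx := abs_nonneg (mu - mu')
  have hy := abs_nonneg (p - p')
  have d5 : |1 / mu - 1 / mu'| + |1 / M.lam p - 1 / M.lam p'| + |p - p'|
      ≤ a * (|mu - mu'| + |p - p'|) := by
    have q1 : 0 ≤ 1 / M.muLo ^ 2 * |p - p'| := by positivity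
    have q2 : 0 ≤ (1 / M.lam M.pHi ^ 2 * Kl + 1) * |mu - mu'| := by positivity
    rw [ha]
    linarith
  calc _ ≤ (a * (|mu - mu'| + |p - p'|)) ^ 2 := pow_le_pow_left₀ (by positivity) d5 2
    _ ≤ 2 * a ^ 2 * (|mu - mu'| ^ 2 + |p - p'| ^ 2) := by
        nlinarith [mul_nonneg (sq_nonneg a) (sq_nonneg (|mu - mu'| - |p - p'|))]
    _ = _ := by rw [sq_abs, sq_abs]

lemma rpow_neg_two_mul_le {i k q α : ℝ} (hi : 0 < i) (hk : 0 < k) (hq : 1 ≤ q) (hkq : k ≤ q * i)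
    (hα : 0 < α) (hα1 : α ≤ 1) : i ^ (-2 * α) ≤ q ^ 2 / (k ^ α) ^ 2 := by
  have h1 : k ^ α ≤ q * i ^ α := by
    refine (Real.rpow_le_rpow hk.le hkq hα.le).trans ?_
    rw [Real.mul_rpow (by linarith) hi.le]
    refine mul_le_mul_of_nonneg_right ?_ (Real.rpow_nonneg hi.le _)
    -- Uses α ≤ 1 to replace q^α by q, so that the constant is free of α.
    simpa using Real.rpow_le_rpow_of_exponent_le hq hα1
  have h2 : i ^ (-2 * α) = 1 / (i ^ α) ^ 2 := by
    rw [show -2 * α = -(α * (2 : ℕ)) by push_cast; ring, Real.rpow_neg hi.le, Real.rpow_mul hi.le,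
      Real.rpow_natCast, one_div]
  have hi' := Real.rpow_pos_of_pos hi α
  have hk' := Real.rpow_pos_of_pos hk α
  rw [h2, div_le_div_iff₀ (by positivity) (by positivity), one_mul, ← mul_pow]
  exact pow_le_pow_left₀ hk'.le h1 2

section

variable {Ω : Type*} [mΩ : MeasurableSpace Ω]

namespace Controlled

lemma dd_self (S : Controlled Ω) (M : Model) (i : ℕ) (ω : Ω) : S.dd M i i ω = 0 := by
  simp [dd]

lemma dd_triangle (S : Controlled Ω) (M : Model) (i j k : ℕ) (ω : Ω) :
    S.dd M i k ω ≤ S.dd M i j ω + S.dd M j k ω := by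
  unfold dd
  have h1 := abs_sub_le (S.svc i ω) (S.svc j ω) (S.svc k ω)
  have h2 := abs_sub_le (S.iat M i ω) (S.iat M j ω) (S.iat M k ω)
  have h3 := abs_sub_le (S.p i ω) (S.p j ω) (S.p k ω)
  linarith

lemma dd_le_sum (S : Controlled Ω) (M : Model) (j i : ℕ) (ω : Ω) :
    S.dd M (j + i) j ω ≤ ∑ r ∈ Finset.range i, S.dd M (j + r + 1) (j + r) ω := by
  induction i with
  | zero => simp [dd_self]
  | succ i ih =>
    rw [Finset.sum_range_succ]
    have := S.dd_triangle M (j + i + 1) (j + i) j ω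
    rw [← add_assoc]
    linarith

end Controlled

namespace Regime

variable {S : Controlled Ω} {M : Model} {P : Measure Ω} [IsProbabilityMeasure P]
  {ℱ : Filtration ℕ mΩ} {β ρ σ C m : ℝ}

/-- Bound of the price changes. -/
noncomputable def jumpBound (M : Model) : ℝ :=
  (1 / M.lam M.pHi + 1 / M.lam M.pHi) + (max |M.pLo| |M.pHi| + max |M.pLo| |M.pHi|)

lemma abs_p_le (h : Regime S M P ℱ β ρ σ C m) (k : ℕ) (ω : Ω) :
    |S.p k ω| ≤ max |M.pLo| |M.pHi| :=
  abs_le_max_abs_abs (h.adm.p_mem k ω).1 (h.adm.p_mem k ω).2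

lemma jump_le (h : Regime S M P ℱ β ρ σ C m) (k : ℕ) (ω : Ω) : S.jump M k ω ≤ jumpBound M :=
  add_le_add ((abs_sub _ _).trans (add_le_add (h.iat_le _ ω) (h.iat_le _ ω)))
    ((abs_sub _ _).trans (add_le_add (h.abs_p_le _ ω) (h.abs_p_le _ ω)))

lemma integrable_dd_sq (h : Regime S M P ℱ β ρ σ C m) {i j : ℕ} (hi : 1 ≤ i) (hj : 1 ≤ j) :
    Integrable (fun ω => S.dd M i j ω ^ 2) P := by
  have hm : Measurable (S.dd M i j) :=
    (h.measurable_dd (k := max i j) hi hj (le_max_left _ _) (le_max_right _ _)).mono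
      (ℱ.le _) le_rfl
  refine integrable_of_abs_le (K := ((1 / M.muLo + 1 / M.muLo) + jumpBound M) ^ 2)
    (hm.pow_const 2) fun ω => ?_
  rw [abs_of_nonneg (sq_nonneg _)]
  refine pow_le_pow_left₀ (S.dd_nonneg M i j ω) ?_ 2
  have h1 := (abs_sub (S.svc i ω) (S.svc j ω)).trans (add_le_add (h.abs_svc_le hi ω)
    (h.abs_svc_le hj ω))
  have h2 := (abs_sub (S.iat M i ω) (S.iat M j ω)).trans (add_le_add (h.iat_le i ω) (h.iat_le j ω))
  have h3 := (abs_sub (S.p i ω) (S.p j ω)).trans (add_le_add (h.abs_p_le i ω) (h.abs_p_le j ω))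
  unfold Controlled.dd jumpBound
  linarith

lemma integrable_jump_sq (h : Regime S M P ℱ β ρ σ C m) {i : ℕ} (hi : 1 ≤ i) :
    Integrable (fun ω => S.jump M i ω ^ 2) P := by
  have hm : Measurable (S.jump M i) := (h.measurable_jump hi le_rfl).mono (ℱ.le _) le_rfl
  refine integrable_of_abs_le (K := jumpBound M ^ 2) (hm.pow_const 2) fun ω => ?_
  rw [abs_of_nonneg (sq_nonneg _)]
  exact pow_le_pow_left₀ (S.jump_nonneg M i ω) (h.jump_le i ω) 2

lemma integral_dd_sq_le (h : Regime S M P ℱ β ρ σ C m) {A : ℝ}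
    (hA : ∀ mu ∈ Set.Icc M.muLo M.muHi, ∀ mu' ∈ Set.Icc M.muLo M.muHi,
      ∀ p ∈ Set.Icc M.pLo M.pHi, ∀ p' ∈ Set.Icc M.pLo M.pHi,
      (|1 / mu - 1 / mu'| + |1 / M.lam p - 1 / M.lam p'| + |p - p'|) ^ 2
        ≤ A * ((mu - mu') ^ 2 + (p - p') ^ 2)) {i : ℕ} (hi : 1 ≤ i) :
    ∫ ω, S.dd M (i + 1) i ω ^ 2 ∂P
      ≤ A * ∫ ω, ((S.mu i ω - S.mu (i + 1) ω) ^ 2 + (S.p i ω - S.p (i + 1) ω) ^ 2) ∂P := by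
  have hi' : 1 ≤ i + 1 := by omega
  have hint : Integrable (fun ω => (S.mu i ω - S.mu (i + 1) ω) ^ 2
      + (S.p i ω - S.p (i + 1) ω) ^ 2) P := by
    have m1 : Measurable (S.mu i) := (h.adm.hist_mu i hi).mono (ℱ.le _) le_rfl
    have m2 : Measurable (S.mu (i + 1)) := (h.adm.hist_mu _ hi').mono (ℱ.le _) le_rfl
    have m3 : Measurable (S.p i) := (h.adm.hist_p i hi).mono (ℱ.le _) le_rfl
    have m4 : Measurable (S.p (i + 1)) := (h.adm.hist_p _ hi').mono (ℱ.le _) le_rfl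
    refine integrable_of_abs_le (K := (M.muHi - M.muLo) ^ 2 + (M.pHi - M.pLo) ^ 2)
      (((m1.sub m2).pow_const 2).add ((m3.sub m4).pow_const 2)) fun ω => ?_
    have b1 := h.adm.mu_mem i hi ω
    have b2 := h.adm.mu_mem (i + 1) hi' ω
    have b3 := h.adm.p_mem i ω
    have b4 := h.adm.p_mem (i + 1) ω
    rw [abs_of_nonneg (by positivity)]
    exact add_le_add (sq_le_sq' (by linarith [b1.1, b2.2]) (by linarith [b1.2, b2.1]))
      (sq_le_sq' (by linarith [b3.1, b4.2]) (by linarith [b3.2, b4.1]))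
  rw [← integral_const_mul]
  refine integral_mono (h.integrable_dd_sq hi' hi) (hint.const_mul A) fun ω => ?_
  have := hA _ (h.adm.mu_mem i hi ω) _ (h.adm.mu_mem (i + 1) hi' ω) _ (h.adm.p_mem i ω) _
    (h.adm.p_mem (i + 1) ω)
  have e : S.dd M (i + 1) i ω = |1 / S.mu i ω - 1 / S.mu (i + 1) ω|
      + |1 / M.lam (S.p i ω) - 1 / M.lam (S.p (i + 1) ω)| + |S.p i ω - S.p (i + 1) ω| := by
    unfold Controlled.dd Controlled.svc Controlled.iat
    rw [abs_sub_comm, abs_sub_comm (1 / M.lam (S.p (i + 1) ω)), abs_sub_comm (S.p (i + 1) ω)]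
  rw [← e] at this
  exact this

/-- The decisions of a bounded number of consecutive cycles are close. -/
lemma close (h : Regime S M P ℱ β ρ σ C m) {a α : ℝ} (ha : 0 ≤ a) (hα : 0 < α) (hα1 : α ≤ 1)
    (hstep : ∀ i : ℕ, 1 ≤ i → ∫ ω, S.dd M (i + 1) i ω ^ 2 ∂P ≤ a * (i : ℝ) ^ (-2 * α))
    {j l n : ℕ} (hj : 1 ≤ j) (hl : l ≤ n) :
    Close S M P j l (((j + l : ℕ) : ℝ) ^ α)
      (((n + 1) ^ 2 * a + jumpBound M ^ 2) * (2 * (n + 1)) ^ 2) := by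
  set κ := ((j + l : ℕ) : ℝ) ^ α with hκdef
  have hk0 : (0 : ℝ) < ((j + l : ℕ) : ℝ) := by
    have : 0 < j + l := by omega
    exact_mod_cast this
  have hκ : 0 < κ := Real.rpow_pos_of_pos hk0 α
  set q : ℝ := 2 * (n + 1) with hq
  have hn0 : (0 : ℝ) ≤ n := Nat.cast_nonneg n
  have hq1 : 1 ≤ q := by rw [hq]; linarith
  -- The condition `j ≤ i + 1` admits i = j - 1, which is needed for the price change at the
  -- beginning of cycle `j`. In this range j + l ≤ 2 (n + 1) i, so all scales are comparable with
  -- that of cycle j + l.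
  have hpow : ∀ i : ℕ, 1 ≤ i → j ≤ i + 1 → (i : ℝ) ^ (-2 * α) ≤ q ^ 2 / κ ^ 2 := by
    intro i hi hji
    refine rpow_neg_two_mul_le (by exact_mod_cast hi) hk0 hq1 ?_ hα hα1
    have h1 : j + l ≤ 2 * (n + 1) * i := by nlinarith
    rw [hq]
    exact_mod_cast h1
  have hd : ∀ i : ℕ, 1 ≤ i → j ≤ i + 1 → ∫ ω, S.dd M (i + 1) i ω ^ 2 ∂P ≤ a * (q ^ 2 / κ ^ 2) :=
    fun i hi hji => (hstep i hi).trans (mul_le_mul_of_nonneg_left (hpow i hi hji) ha)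
  have hr0 : 0 ≤ q ^ 2 / κ ^ 2 := by positivity
  have hJ := sq_nonneg (jumpBound M)
  have hn2 : (1 : ℝ) ≤ (n + 1) ^ 2 := by nlinarith
  have e : ((n + 1) ^ 2 * a + jumpBound M ^ 2) * q ^ 2 / κ ^ 2
      = ((n + 1) ^ 2 * a + jumpBound M ^ 2) * (q ^ 2 / κ ^ 2) := by ring
  have hone : a * (q ^ 2 / κ ^ 2) ≤ ((n + 1) ^ 2 * a + jumpBound M ^ 2) * q ^ 2 / κ ^ 2 := by
    rw [e]
    refine mul_le_mul_of_nonneg_right ?_ hr0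
    nlinarith [mul_le_mul_of_nonneg_right hn2 ha]
  refine ⟨fun i hi => ⟨h.integrable_dd_sq (by omega) hj, ?_⟩,
    fun i hi => ⟨h.integrable_jump_sq (by omega), ?_⟩,
    h.integrable_dd_sq (by omega) (by omega), (hd (j + l) (by omega) (by omega)).trans hone⟩
  · have h1 : ∀ ω, S.dd M (j + i) j ω ^ 2
        ≤ (i : ℝ) * ∑ r ∈ Finset.range i, S.dd M (j + r + 1) (j + r) ω ^ 2 := fun ω => by
      refine (pow_le_pow_left₀ (S.dd_nonneg M _ _ ω) (S.dd_le_sum M j i ω) 2).trans ?_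
      simpa using sq_sum_le_card_mul_sum_sq (s := Finset.range i)
        (f := fun r => S.dd M (j + r + 1) (j + r) ω)
    have i2 : Integrable (fun ω => ∑ r ∈ Finset.range i, S.dd M (j + r + 1) (j + r) ω ^ 2) P :=
      integrable_finsetSum _ fun r _ => h.integrable_dd_sq (by omega) (by omega)
    refine (integral_mono (h.integrable_dd_sq (by omega) hj) (i2.const_mul (i : ℝ)) h1).trans ?_
    rw [integral_const_mul, integral_finsetSum _ fun r _ =>
      h.integrable_dd_sq (i := j + r + 1) (j := j + r) (by omega) (by omega)]
    have h3 : ∑ r ∈ Finset.range i, ∫ ω, S.dd M (j + r + 1) (j + r) ω ^ 2 ∂P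
        ≤ (i : ℝ) * (a * (q ^ 2 / κ ^ 2)) := by
      refine (Finset.sum_le_sum fun r _ => hd (j + r) (by omega) (by omega)).trans_eq ?_
      rw [Finset.sum_const, Finset.card_range, nsmul_eq_mul]
    refine (mul_le_mul_of_nonneg_left h3 (Nat.cast_nonneg i)).trans ?_
    have hin : (i : ℝ) ≤ n + 1 := by
      have : i ≤ n + 1 := by omega
      exact_mod_cast this
    have hi2 : (i : ℝ) ^ 2 ≤ (n + 1) ^ 2 := pow_le_pow_left₀ (Nat.cast_nonneg i) hin 2
    rw [e]
    calc (i : ℝ) * (i * (a * (q ^ 2 / κ ^ 2))) = i ^ 2 * a * (q ^ 2 / κ ^ 2) := by ring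
      _ ≤ _ := mul_le_mul_of_nonneg_right
        (by nlinarith [mul_le_mul_of_nonneg_right hi2 ha]) hr0
  -- The first price change, from the price before cycle 1, is not controlled by the hypothesis on
  -- the decisions. It is only bounded, which suffices because then j = 1 and j + l ≤ n + 1.
  · rcases Nat.lt_or_ge (j + i) 2 with h2 | h2
    · have hj1 : j = 1 := by omega
      have h3 : ∫ ω, S.jump M (j + i) ω ^ 2 ∂P ≤ jumpBound M ^ 2 := by
        refine (integral_mono (h.integrable_jump_sq (by omega))
          (integrable_const (jumpBound M ^ 2)) fun ω =>
          pow_le_pow_left₀ (S.jump_nonneg M _ ω) (h.jump_le _ ω) 2).trans_eq ?_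
        simp
      have h4 := hpow 1 le_rfl (by omega)
      rw [Nat.cast_one, Real.one_rpow] at h4
      refine h3.trans ?_
      rw [e]
      have h5 := mul_le_mul_of_nonneg_left h4 hJ
      have h6 : 0 ≤ ((n : ℝ) + 1) ^ 2 * a * (q ^ 2 / κ ^ 2) := by positivity
      linarith
    · obtain ⟨r, hr⟩ : ∃ r, j + i = r + 1 := ⟨j + i - 1, by omega⟩
      refine le_trans ?_ ((hd r (by omega) (by omega)).trans hone)
      rw [hr]
      refine integral_mono (h.integrable_jump_sq (by omega))
        (h.integrable_dd_sq (by omega) (by omega)) fun ω =>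
        pow_le_pow_left₀ (S.jump_nonneg M _ ω) ?_ 2
      unfold Controlled.jump Controlled.dd
      rw [Nat.add_sub_cancel, abs_sub_comm, abs_sub_comm (S.p r ω)]
      linarith [abs_nonneg (S.svc (r + 1) ω - S.svc r ω)]

end Regime

/-- The cycle lengths make the memory of the initial state decay. -/
lemma Controlled.pow_customers_le (S : Controlled Ω) {ρ r : ℝ} (hρ : 0 < ρ) (hρ1 : ρ < 1)
    (hr : 0 < r) {n : ℕ} (hn : 1 ≤ n * (2 / r * -Real.log ρ))
    (hD : ∀ k : ℕ, 1 ≤ k → 2 * Real.log k / r ≤ (S.D k : ℝ)) {j l : ℕ} (hj : 1 ≤ j)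
    (hl : j = 1 ∨ l = n) : ρ ^ S.customers j l ≤ 1 / j := by
  rcases hl with rfl | rfl
  -- For j = 1 the claim is only that the power is at most 1.
  · simpa using pow_le_one₀ hρ.le hρ1.le
  · have hj0 : (0 : ℝ) < j := by exact_mod_cast hj
    have hlogj : 0 ≤ Real.log j := Real.log_nonneg (by exact_mod_cast hj)
    have hN : (l : ℝ) * (2 * Real.log j / r) ≤ (S.customers j l : ℝ) := by
      unfold Controlled.customers
      push_cast
      have h1 : ∀ i ∈ Finset.range l, 2 * Real.log j / r ≤ (S.D (j + i) : ℝ) := fun i _ => by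
        refine le_trans ?_ (hD (j + i) (by omega))
        gcongr
        omega
      refine le_trans (le_of_eq ?_) (Finset.sum_le_sum h1)
      rw [Finset.sum_const, Finset.card_range, nsmul_eq_mul]
    have hlρ : Real.log ρ < 0 := Real.log_neg hρ hρ1
    rw [← Real.log_le_log_iff (pow_pos hρ _) (by positivity), Real.log_pow, one_div, Real.log_inv]
    have h2 := mul_le_mul_of_nonneg_right hN (neg_pos.2 hlρ).le
    have h3 := mul_le_mul_of_nonneg_right hn hlogj
    have h4 : (l : ℝ) * (2 / r * -Real.log ρ) * Real.log j
        = l * (2 * Real.log j / r) * -Real.log ρ := by ring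
    linarith

end

end GIGIOne

/-! ### Choice of the constants and proof of the theorem -/

theorem theorem1 (M : GIGIOne.Model) (hM : M.Standing) (hStable : M.Stable)
    (η θ a γ₀ : ℝ) (hLight : M.LightTail η θ a γ₀)
    (K₂ α : ℝ) (hK₂ : 0 < K₂) (hα : 0 < α) (hα1 : α ≤ 1)
    (ε M₀ : ℝ) (hε : 0 < ε) :
    ∃ K : ℝ, 0 < K ∧
      ∀ (Ω : Type*) [mΩ : MeasurableSpace Ω] (P : Measure Ω) [IsProbabilityMeasure P]
        (ℱ : Filtration ℕ mΩ) (S : GIGIOne.Controlled Ω),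
        S.IsAdmissible M P ℱ →
        (∫⁻ ω, ENNReal.ofReal (Real.exp (ε * S.W0 ω)) ∂P ≤ ENNReal.ofReal M₀) →
        (∀ k : ℕ, 1 ≤ k → 2 * Real.log k / M.rate γ₀ ≤ (S.D k : ℝ)) →
        (∀ k : ℕ, 1 ≤ k →
          ∫ ω, ((S.mu k ω - S.mu (k + 1) ω) ^ 2 + (S.p k ω - S.p (k + 1) ω) ^ 2) ∂P
            ≤ K₂ * (k : ℝ) ^ (-2 * α)) →
        (∀ k : ℕ, 1 ≤ k →
          Integrable (S.cycleCost M k) P ∧ Integrable (S.steadyCost M k) P ∧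
          S.R1 M P k ≤ K * (k : ℝ) ^ (-α)) ∧
        (∀ L : ℕ, 1 ≤ L →
          S.R1Total M P L ≤ K * ∑ k ∈ Finset.Icc 1 L, (k : ℝ) ^ (-α)) := by

  obtain ⟨β, ρ, σ, C, H, hβε⟩ := hLight.exists_tilted hM hStable hε
  obtain ⟨A, hA0, hA⟩ := GIGIOne.Model.exists_decision_lip hM hStable
  have hρ0 := H.ρ_pos
  have hρ1 : ρ < 1 := H.ρ_lt.trans H.σ_lt
  have hrate : 0 < M.rate γ₀ := by
    have h1 := hM.muLo_pos hStable
    have h2 := hM.lam_pLo_pos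
    have h3 : 0 < M.muHi := h1.trans_le hM.mu_le
    exact mul_pos hLight.gamma_pos (lt_min (by positivity) (by positivity))
  have hlρ : 0 < -Real.log ρ := neg_pos.2 (Real.log_neg hρ0 hρ1)
  have hrρ : 0 < 2 / M.rate γ₀ * -Real.log ρ := by positivity
  -- The number of cycles to look back. The forgetting rate -log ρ may be much smaller than γ, so
  -- one cycle of length 2 log(k)/γ need not suffice; n of them do, and n depends only on the
  -- constants at hand.
  obtain ⟨n, hn⟩ := exists_nat_ge (1 / (2 / M.rate γ₀ * -Real.log ρ))
  rw [div_le_iff₀ hrρ] at hn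
  -- The level of the exponential moments must cover the first cycle (M₀), the empty reference queue
  -- (1), and be preserved by the recursion (1/(1 - ρ)).
  set m := max (max M₀ 1) (1 / (1 - ρ)) with hm
  have hm1 : 1 ≤ m := (le_max_right _ _).trans (le_max_left _ _)
  have hmM : M₀ ≤ m := (le_max_left _ _).trans (le_max_left _ _)
  have hmρ : 1 + ρ * m ≤ m := by
    have h1 : 1 / (1 - ρ) ≤ m := le_max_right _ _
    rw [div_le_iff₀ (sub_pos.2 hρ1)] at h1
    linarith
  set b : ℝ := ((n + 1) ^ 2 * (A * K₂) + GIGIOne.Regime.jumpBound M ^ 2) * (2 * (n + 1)) ^ 2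
    with hb
  have hb0 : 0 ≤ b := by positivity
  set K := |GIGIOne.Regime.distCoeff M β ρ σ C n * (2 * b + m)|
    + |GIGIOne.Regime.memCoeff M β ρ σ C m| * (n + 1) + 1 with hK
  have hK0 : 0 < K := by positivity
  refine ⟨K, hK0, ?_⟩
  intro Ω mΩ P _ ℱ S hadm hW hD hx
  have hW0m : Measurable S.W0 := hadm.hist_W0.mono (ℱ.le 1) le_rfl
  have hexp : Measurable fun ω => Real.exp (2 * β * S.W0 ω) := (hW0m.const_mul _).exp
  have hlint : ∫⁻ ω, ENNReal.ofReal (Real.exp (2 * β * S.W0 ω)) ∂P ≤ ENNReal.ofReal m :=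
    (lintegral_mono fun ω => ENNReal.ofReal_le_ofReal (Real.exp_le_exp.2
      (mul_le_mul_of_nonneg_right hβε (hadm.W0_nonneg ω)))).trans
      (hW.trans (ENNReal.ofReal_le_ofReal hmM))
  have hR : GIGIOne.Regime S M P ℱ β ρ σ C m := by
    refine ⟨hM, hStable, H, hadm, hmρ, hm1, ?_, ?_⟩
    · exact ⟨hexp.aestronglyMeasurable, (hasFiniteIntegral_iff_ofReal
        (ae_of_all _ fun ω => (Real.exp_pos _).le)).2 (hlint.trans_lt ENNReal.ofReal_lt_top)⟩
    · rw [integral_eq_lintegral_of_nonneg_ae (ae_of_all _ fun ω => (Real.exp_pos _).le)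
        hexp.aestronglyMeasurable]
      exact ENNReal.toReal_le_of_le_ofReal (by linarith) hlint
  have hmono : ∀ l ≤ n, GIGIOne.Regime.distCoeff M β ρ σ C l
      ≤ GIGIOne.Regime.distCoeff M β ρ σ C n := by
    intro l hl
    have h1 : (l : ℝ) ≤ n := by exact_mod_cast hl
    have h2 := hM.h0_pos
    have h3 := H.transLip_pos
    have h4 := H.C_pos
    have h5 := hR.netRateBound_nonneg
    have h6 : 0 < 1 - ρ := sub_pos.2 hρ1
    unfold GIGIOne.Regime.distCoeff
    gcongr
  have hcycle : ∀ k : ℕ, 1 ≤ k → Integrable (S.cycleCost M k) P ∧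
      Integrable (S.steadyCost M k) P ∧ S.R1 M P k ≤ K * (k : ℝ) ^ (-α) := by
    intro k hk
    -- The decision is frozen n cycles earlier, or in the first cycle if fewer have passed.
    obtain ⟨j, l, hj, hl, hjl, rfl⟩ : ∃ j l, 1 ≤ j ∧ l ≤ n ∧ (j = 1 ∨ l = n) ∧ k = j + l := by
      rcases Nat.lt_or_ge n k with h | h
      · exact ⟨k - n, n, by omega, le_rfl, Or.inr rfl, by omega⟩
      · exact ⟨1, k - 1, le_rfl, by omega, Or.inl rfl, by omega⟩
    have hc := hR.close (by positivity : 0 ≤ A * K₂) hα hα1 (fun i hi =>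
      (hR.integral_dd_sq_le hA hi).trans ((mul_le_mul_of_nonneg_left (hx i hi) hA0.le).trans_eq
        (mul_assoc A K₂ _).symm)) hj hl
    have hk0 : (0 : ℝ) < ((j + l : ℕ) : ℝ) := by exact_mod_cast hk
    have hκ : 0 < ((j + l : ℕ) : ℝ) ^ α := Real.rpow_pos_of_pos hk0 α
    obtain ⟨i1, i2, h3⟩ := hR.cycle_regret_le hc hj hκ hb0 hLight
    refine ⟨i1, i2, (le_abs_self _).trans (h3.trans ?_)⟩
    have hneg : ((j + l : ℕ) : ℝ) ^ (-α) = 1 / ((j + l : ℕ) : ℝ) ^ α := by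
      rw [Real.rpow_neg hk0.le, one_div]
    have hpos : 0 < ((j + l : ℕ) : ℝ) ^ (-α) := Real.rpow_pos_of_pos hk0 _
    have hmem : ρ ^ S.customers j l ≤ (n + 1) * ((j + l : ℕ) : ℝ) ^ (-α) := by
      refine (S.pow_customers_le hρ0 hρ1 hrate hn hD hj hjl).trans ?_
      have hj0 : (0 : ℝ) < j := by exact_mod_cast hj
      -- As l ≤ n and j ≥ 1, the cycle number is at most (n + 1) j. The memory term is thus of order
      -- 1/k, and α ≤ 1 makes it negligible or comparable.
      have h4 : (1 : ℝ) / j ≤ (n + 1) * ((j + l : ℕ) : ℝ) ^ (-1 : ℝ) := by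
        rw [Real.rpow_neg_one, ← div_eq_mul_inv, div_le_div_iff₀ hj0 hk0, one_mul]
        have : j + l ≤ (n + 1) * j := by nlinarith
        exact_mod_cast this
      refine h4.trans (mul_le_mul_of_nonneg_left ?_ (by positivity))
      exact Real.rpow_le_rpow_of_exponent_le (by exact_mod_cast hk) (by linarith)
    have hsmall : GIGIOne.Regime.small m (((j + l : ℕ) : ℝ) ^ α) b
        = (2 * b + m) * ((j + l : ℕ) : ℝ) ^ (-α) := by
      unfold GIGIOne.Regime.small
      rw [hneg]; ring
    have hbm : 0 ≤ 2 * b + m := by linarith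
    have t1 : GIGIOne.Regime.distCoeff M β ρ σ C l * ((2 * b + m) * ((j + l : ℕ) : ℝ) ^ (-α))
        ≤ |GIGIOne.Regime.distCoeff M β ρ σ C n * (2 * b + m)| * ((j + l : ℕ) : ℝ) ^ (-α) := by
      rw [← mul_assoc]
      exact mul_le_mul_of_nonneg_right ((mul_le_mul_of_nonneg_right (hmono l hl) hbm).trans
        (le_abs_self _)) hpos.le
    have t2 : GIGIOne.Regime.memCoeff M β ρ σ C m * ρ ^ S.customers j l
        ≤ |GIGIOne.Regime.memCoeff M β ρ σ C m| * ((n + 1) * ((j + l : ℕ) : ℝ) ^ (-α)) :=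
      mul_le_mul (le_abs_self _) hmem (pow_nonneg hρ0.le _) (abs_nonneg _)
    rw [hsmall, hK]
    linarith
  refine ⟨hcycle, fun L _ => ?_⟩
  unfold GIGIOne.Controlled.R1Total
  rw [Finset.mul_sum]
  exact Finset.sum_le_sum fun k hk => (hcycle k (Finset.mem_Icc.1 hk).1).2.2
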